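/- Let $X$ be a separated scheme of finite type over $\mathbb C$ that carries an ample line bundle $L$ ($L$ is invertible and $X$ is covered by affine open sets of the form $X_s$ with $s\in\Gamma(X,L^{\otimes n})$, $n>0$). For $\mathcal O_X$-modules $\mathcal F,\mathcal G$ let $\mathcal{E}xt^p(\mathcal F,\mathcal G)$ be the value at $\mathcal G$ of the $p$-th right derived functor of the sheaf functor $\mathcal{H}om(\mathcal F,-)$. A $p$-extension of $\mathcal N$ by $\mathcal M$ is an exact sequence $0\to\mathcal N\to\mathcal H_{p-1}\to\dots\to\mathcal H_0\to\mathcal M\to 0$ of modules. (1) Every coherent sheaf $\mathcal F$ on $X$ has a resolution $\dots\to\mathcal E_1\to\mathcal E_0\to\mathcal F\to0$ by locally free sheaves of finite rank. (2) For every sufficiently fine open cover $\mathfrak U=\{U_\alpha\}$ of $X$ (that is, there is an open cover $\mathfrak V$ of $X$ such that the following holds for every open cover $\mathfrak U$ refining $\mathfrak V$), for all coherent $\mathcal F,\mathcal G$, every locally free resolution $\mathcal E_\bullet\to\mathcal F$ of finite rank, every $p>0$ and every $\alpha$, there is a group homomorphism $$\Phi_\alpha:\ H^0(X,\mathcal{E}xt^p(\mathcal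 F,\mathcal G))\to h^p\big(\mathrm{Hom}_{\mathcal O_{U_\alpha}}(\mathcal E_\bullet|_{U_\alpha},\mathcal G|_{U_\alpha})\big)$$ such that for each $f\in H^0(X,\mathcal{E}xt^p(\mathcal F,\mathcal G))$ the following hold. (a) Let $f_\alpha:\mathcal E_p|_{U_\alpha}\to\mathcal G|_{U_\alpha}$ be any cocycle in the class $\Phi_\alpha(f)$, let $\mathcal K_p=\mathrm{coker}(\mathcal E_{p+1}|_{U_\alpha}\to\mathcal E_p|_{U_\alpha})$, let $\hat f_\alpha:\mathcal K_p\to\mathcal G|_{U_\alpha}$ be the morphism induced by $f_\alpha$, and let $\mathcal H$ be the pushout of $\mathcal K_p\to\mathcal E_{p-1}|_{U_\alpha}$ along $\hat f_\alpha$. Then $$0\to\mathcal G|_{U_\alpha}\to\mathcal H\to\mathcal E_{p-2}|_{U_\alpha}\to\dots\to\mathcal E_0|_{U_\alpha}\to\mathcal F|_{U_\alpha}\to0$$ is a $p$-extension of $\mathcal G|_{U_\alpha}$ by $\mathcal F|_{U_\alpha}$. (For $p=1$ it reads $0\to\mathcal G|_{U_\alpha}\to\mathcal H\to\mathcal F|_{U_\alpha}\to0$.)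 (b) This extension represents $f|_{U_\alpha}$: for an injective resolution $\mathcal G\to\mathcal I^\bullet$, there is a commutative ladder from it to $0\to\mathcal G|_{U_\alpha}\to\mathcal I^0|_{U_\alpha}\to\dots\to\mathcal I^{p}|_{U_\alpha}$ that is the identity on $\mathcal G|_{U_\alpha}$, and whose last component $\mathcal F|_{U_\alpha}\to\mathcal I^p|_{U_\alpha}$ is a cocycle of $\mathcal{H}om(\mathcal F,\mathcal I^\bullet)$ over $U_\alpha$ with class $f|_{U_\alpha}\in\Gamma(U_\alpha,\mathcal{E}xt^p(\mathcal F,\mathcal G))$. (c) Up to an isomorphism of exact sequences that is the identity on $\mathcal G|_{U_\alpha}$ and $\mathcal F|_{U_\alpha}$, the extension does not depend on the choice of the cocycle $f_\alpha$ in the class $\Phi_\alpha(f)$. -/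

import Mathlib

open CategoryTheory Limits AlgebraicGeometry Opposite TopologicalSpace

universe u v w

namespace SheafExt

/-! ### The category of `𝒪_X`-modules has enough injectives -/

theorem presheafOfModules_hasExactColimitsOfShape {C : Type u} [SmallCategory C]
    (R : Cᵒᵖ ⥤ RingCat.{u}) (K : Type u) [SmallCategory K] [IsFiltered K] :
    HasExactColimitsOfShape K (PresheafOfModules.{u} R) :=
  HasExactColimitsOfShape.domain_of_functor K (PresheafOfModules.toPresheaf R)

theorem presheafOfModules_isSeparator {C : Type u} [SmallCategory C]
    (R : Cᵒᵖ ⥤ RingCat.{u}) :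
    IsSeparator (∐ fun X : C => (PresheafOfModules.free R).obj (yoneda.obj X)) := by
  have h : ObjectProperty.IsSeparating
      (.ofObj fun X : C => (PresheafOfModules.free R).obj (yoneda.obj X)) :=
    PresheafOfModules.freeYoneda.isSeparating R
  exact h.isSeparator_coproduct

theorem isSeparator_of_adjunction {C D : Type*} [Category* C] [Category* D]
    {F : C ⥤ D} {G : D ⥤ C} (adj : F ⊣ G) [G.Faithful] {S : C} (hS : IsSeparator S) :
    IsSeparator (F.obj S) := by
  rw [isSeparator_def] at hS ⊢
  intro A B f g hfg
  apply G.map_injective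
  apply hS
  intro h
  have := hfg ((adj.homEquiv _ _).symm h)
  simpa [← adj.homEquiv_naturality_right_symm] using this

theorem sheafOfModules_isGrothendieckAbelian {X : TopCat.{u}}
    (R : Sheaf (Opens.grothendieckTopology X) RingCat.{u}) :
    IsGrothendieckAbelian.{u} (SheafOfModules.{u} R) := by
  let adj := PresheafOfModules.sheafificationAdjunction (𝟙 R.obj)
  refine { ab5OfSize := ⟨fun K _ _ => ?_⟩,
           hasSeparator := ⟨_, isSeparator_of_adjunction adj (presheafOfModules_isSeparator _)⟩ }
  have := presheafOfModules_hasExactColimitsOfShape R.obj K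
  exact adj.hasExactColimitsOfShape K

theorem modules_isGrothendieckAbelian (X : Scheme.{u}) :
    IsGrothendieckAbelian.{u} X.Modules :=
  sheafOfModules_isGrothendieckAbelian X.ringCatSheaf

instance modules_hasInjectiveResolutions (X : Scheme.{u}) : HasInjectiveResolutions X.Modules := by
  have := modules_isGrothendieckAbelian X
  infer_instance
instance restrictFunctor_additive {X Y : Scheme.{u}} (f : X ⟶ Y) [IsOpenImmersion f] :
    (Scheme.Modules.restrictFunctor f).Additive where
  map_add := rfl

/-! ### The sheaf of homomorphisms and the Ext sheaves -/

section SheafHom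

variable {X : Scheme.{u}}

/-- The group of morphisms of `𝒪_U`-modules `F|_U ⟶ G|_U`: families of additive maps
`F(V) → G(V)`, for `V ⊆ U` open, that are `𝒪(V)`-linear and commute with restriction. -/
def localHom (F G : X.Modules) (U : X.Opens) :
    AddSubgroup (∀ V : {V : X.Opens // V ≤ U}, Γ(F, V.1) →+ Γ(G, V.1)) where
  carrier := {φ |
    (∀ (V : {V : X.Opens // V ≤ U}) (a : Γ(X, V.1)) (s : Γ(F, V.1)),
      φ V (a • s) = a • φ V s) ∧
    ∀ (V W : {V : X.Opens // V ≤ U}) (i : W.1 ⟶ V.1) (s : Γ(F, V.1)),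
      φ W (F.presheaf.map i.op s) = G.presheaf.map i.op (φ V s)}
  zero_mem' := ⟨fun _ _ _ => by simp, fun _ _ _ _ => by simp⟩
  add_mem' := fun {φ ψ} hφ hψ =>
    ⟨fun V a s => by simp [hφ.1, hψ.1], fun V W i s => by simp [hφ.2 V W, hψ.2 V W]⟩
  neg_mem' := fun {φ} hφ =>
    ⟨fun V a s => by simp [hφ.1], fun V W i s => by simp [hφ.2 V W]⟩

namespace localHom
variable {F G : X.Modules} {U V W : X.Opens}

/-- The restriction of a morphism `F|_U ⟶ G|_U` to an open subset `V ⊆ U`. -/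
noncomputable def res (h : V ≤ U) : localHom F G U →+ localHom F G V where
  toFun φ := ⟨fun W => φ.1 ⟨W.1, W.2.trans h⟩,
    fun W => φ.2.1 ⟨W.1, W.2.trans h⟩,
    fun W W' => φ.2.2 ⟨W.1, W.2.trans h⟩ ⟨W'.1, W'.2.trans h⟩⟩
  map_zero' := rfl
  map_add' _ _ := rfl

/-- Composition with a morphism of sheaves of modules. -/
noncomputable def postcomp {G' : X.Modules} (g : G ⟶ G') : localHom F G U →+ localHom F G' U where
  toFun φ := ⟨fun W => (g.app W.1).hom.comp (φ.1 W),
    fun W a s => by simp [φ.2.1 W a s],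
    fun W W' i s => by
      have := ConcreteCategory.congr_hom (g.mapPresheaf.naturality i.op) (φ.1 W s)
      simpa [φ.2.2 W W' i s] using this⟩
  map_zero' := by ext; simp
  map_add' _ _ := by ext; simp

end localHom

/-- The presheaf `U ↦ Hom(F|_U, G|_U)` of abelian groups. -/
noncomputable def homPresheaf (F G : X.Modules) : TopCat.Presheaf AddCommGrpCat.{u} X where
  obj U := AddCommGrpCat.of (localHom F G U.unop)
  map i := AddCommGrpCat.ofHom (localHom.res i.unop.le)

theorem eq_of_eq_on_cover (G : X.Modules) {ι : Type u} (U : ι → X.Opens) {V : X.Opens}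
    (hV : V ≤ iSup U) (s t : Γ(G, V))
    (h : ∀ i, G.presheaf.map (homOfLE (inf_le_left : V ⊓ U i ≤ V)).op s =
      G.presheaf.map (homOfLE (inf_le_left : V ⊓ U i ≤ V)).op t) : s = t :=
  TopCat.Sheaf.eq_of_locally_eq' (⟨G.presheaf, G.isSheaf⟩ : TopCat.Sheaf AddCommGrpCat.{u} X)
    (fun i => V ⊓ U i) V (fun i => homOfLE inf_le_left)
    (by rw [← inf_iSup_eq]; exact le_inf le_rfl hV) s t h

theorem exists_glue (G : X.Modules) {ι : Type u} (U : ι → X.Opens) {V : X.Opens}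
    (hV : V ≤ iSup U) (t : ∀ i, Γ(G, V ⊓ U i))
    (ht : ∀ i j, G.presheaf.map (homOfLE
        (inf_le_left : (V ⊓ U i) ⊓ (V ⊓ U j) ≤ V ⊓ U i)).op (t i) =
      G.presheaf.map (homOfLE
        (inf_le_right : (V ⊓ U i) ⊓ (V ⊓ U j) ≤ V ⊓ U j)).op (t j)) :
    ∃ s : Γ(G, V), ∀ i, G.presheaf.map (homOfLE (inf_le_left : V ⊓ U i ≤ V)).op s = t i :=
  (TopCat.Sheaf.existsUnique_gluing'
    (⟨G.presheaf, G.isSheaf⟩ : TopCat.Sheaf AddCommGrpCat.{u} X)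
    (fun i => V ⊓ U i) V (fun i => homOfLE inf_le_left)
    (by rw [← inf_iSup_eq]; exact le_inf le_rfl hV) t ht).exists

theorem res_res (G : X.Modules) {U V W : X.Opens} (i : V ⟶ U) (j : W ⟶ V) (k : W ⟶ U)
    (s : Γ(G, U)) : G.presheaf.map j.op (G.presheaf.map i.op s) = G.presheaf.map k.op s := by
  rw [← ConcreteCategory.comp_apply, ← Functor.map_comp]
  rfl

theorem homPresheaf_isSheaf (F G : X.Modules) : (homPresheaf F G).IsSheaf := by
  rw [TopCat.Presheaf.isSheaf_iff_isSheaf_comp (CategoryTheory.forget AddCommGrpCat.{u})]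
  apply TopCat.Presheaf.isSheaf_of_isSheafUniqueGluing_types
  intro ι U sf hsf
  let φ : ∀ i, localHom F G (U i) := sf
  have hφ : ∀ i j (W : X.Opens) (hi : W ≤ U i) (hj : W ≤ U j),
      (φ i).1 ⟨W, hi⟩ = (φ j).1 ⟨W, hj⟩ := fun i j W hi hj =>
    congrFun (congrArg Subtype.val (hsf i j)) ⟨W, le_inf hi hj⟩
  have key : ∀ (V : {V : X.Opens // V ≤ iSup U}) (s : Γ(F, V.1)), ∃ t : Γ(G, V.1), ∀ i,
      G.presheaf.map (homOfLE (inf_le_left : V.1 ⊓ U i ≤ V.1)).op t =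
        (φ i).1 ⟨V.1 ⊓ U i, inf_le_right⟩
          (F.presheaf.map (homOfLE (inf_le_left : V.1 ⊓ U i ≤ V.1)).op s) := by
    intro V s
    apply exists_glue G U V.2
    intro i j
    have hi := (φ i).2.2 ⟨V.1 ⊓ U i, inf_le_right⟩
      ⟨(V.1 ⊓ U i) ⊓ (V.1 ⊓ U j), inf_le_left.trans inf_le_right⟩ (homOfLE inf_le_left)
      (F.presheaf.map (homOfLE (inf_le_left : V.1 ⊓ U i ≤ V.1)).op s)
    have hj := (φ j).2.2 ⟨V.1 ⊓ U j, inf_le_right⟩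
      ⟨(V.1 ⊓ U i) ⊓ (V.1 ⊓ U j), inf_le_right.trans inf_le_right⟩ (homOfLE inf_le_right)
      (F.presheaf.map (homOfLE (inf_le_left : V.1 ⊓ U j ≤ V.1)).op s)
    rw [← hi, ← hj, res_res F _ _ (homOfLE (inf_le_left.trans inf_le_left)),
      res_res F _ _ (homOfLE (inf_le_left.trans inf_le_left)), hφ i j]
  choose t ht using key
  have ht' : ∀ (V : {V : X.Opens // V ≤ iSup U}) (i : ι) (hV : V.1 ≤ U i) (s : Γ(F, V.1)),
      t V s = (φ i).1 ⟨V.1, hV⟩ s := by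
    intro V i hV s
    apply eq_of_eq_on_cover G U V.2
    intro j
    rw [ht, hφ j i (V.1 ⊓ U j) inf_le_right (inf_le_left.trans hV)]
    exact (φ i).2.2 ⟨V.1, hV⟩ ⟨V.1 ⊓ U j, inf_le_left.trans hV⟩ (homOfLE inf_le_left) s
  let ψ : localHom F G (iSup U) := ⟨fun V =>
    { toFun := t V
      map_zero' := eq_of_eq_on_cover G U V.2 _ _ fun i => by rw [ht]; simp
      map_add' := fun a b => eq_of_eq_on_cover G U V.2 _ _ fun i => by
        rw [ht, map_add, map_add, map_add, ht, ht] },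
    fun V a s => eq_of_eq_on_cover G U V.2 _ _ fun i => by
      change G.presheaf.map _ (t V (a • s)) = G.presheaf.map _ (a • t V s)
      rw [ht, Scheme.Modules.map_smul, Scheme.Modules.map_smul, ht]
      exact (φ i).2.1 _ _ _,
    fun V W k s => eq_of_eq_on_cover G U W.2 _ _ fun i => by
      change G.presheaf.map _ (t W (F.presheaf.map k.op s)) =
        G.presheaf.map _ (G.presheaf.map k.op (t V s))
      rw [ht, res_res G k _ (homOfLE (inf_le_left.trans k.le)),
        ← res_res G (homOfLE (inf_le_left : V.1 ⊓ U i ≤ V.1))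
          (homOfLE (inf_le_inf_right _ k.le)) _ (t V s), ht,
        res_res F k _ (homOfLE (inf_le_left.trans k.le)),
        ← res_res F (homOfLE (inf_le_left : V.1 ⊓ U i ≤ V.1))
          (homOfLE (inf_le_inf_right _ k.le)) (homOfLE (inf_le_left.trans k.le)) s]
      exact (φ i).2.2 ⟨V.1 ⊓ U i, inf_le_right⟩ ⟨W.1 ⊓ U i, inf_le_right⟩ _ _⟩
  refine ⟨ψ, fun i => ?_, fun χ hχ => ?_⟩
  · apply Subtype.ext
    funext V
    ext s
    exact ht' ⟨V.1, V.2.trans (le_iSup U i)⟩ i V.2 s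
  · apply Subtype.ext
    funext V
    ext s
    apply eq_of_eq_on_cover G U V.2
    intro i
    refine (χ.2.2 V ⟨V.1 ⊓ U i, inf_le_left.trans V.2⟩ (homOfLE inf_le_left) s).symm.trans ?_
    refine Eq.trans ?_ (ht V s i).symm
    exact DFunLike.congr_fun
      (congrFun (congrArg Subtype.val (hχ i)) ⟨V.1 ⊓ U i, inf_le_right⟩) _

/-- The functor `G ↦ ℋom(F, G)` from `𝒪_X`-modules to sheaves of abelian groups. -/
noncomputable def sheafHom (F : X.Modules) : X.Modules ⥤ TopCat.Sheaf AddCommGrpCat.{u} X where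
  obj G := ⟨homPresheaf F G, homPresheaf_isSheaf F G⟩
  map g := ⟨{ app := fun _ => AddCommGrpCat.ofHom (localHom.postcomp g) }⟩

instance (F : X.Modules) : (sheafHom F).Additive where
  map_add := rfl

/-- The sheaf `ℰxt^p(F, G)`: the value at `G` of the `p`-th right derived functor of the sheaf
functor `ℋom(F, -)`. -/
noncomputable def extSheaf (F G : X.Modules) (p : ℕ) : TopCat.Sheaf AddCommGrpCat.{u} X :=
  ((sheafHom F).rightDerived p).obj G

/-- The group of sections `Γ(U, ℰxt^p(F, G))`. -/
abbrev extSections (F G : X.Modules) (p : ℕ) (U : X.Opens) : Type u :=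
  (extSheaf F G p).obj.obj (op U)

/-- The restriction of a global section of `ℰxt^p(F, G)` to the open subset `U`. -/
noncomputable def extSectionsRestrict {F G : X.Modules} {p : ℕ} (f : extSections F G p ⊤)
    (U : X.Opens) : extSections F G p U :=
  (extSheaf F G p).obj.map (homOfLE (le_top : U ≤ ⊤)).op f

end SheafHom

/-! ### Coherent, locally free and ample sheaves -/

section Sheaves

variable {X : Scheme.{u}}

/-- The free `𝒪_X`-module `𝒪_X^n`. -/
noncomputable def freeModule (X : Scheme.{u}) (n : ℕ) : X.Modules :=
  SheafOfModules.free (R := X.ringCatSheaf) (ULift.{u} (Fin n))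

/-- `F` is of finite type, that is, locally generated by finitely many sections. -/
def IsOfFiniteType (F : X.Modules) : Prop :=
  SheafOfModules.IsFiniteType (R := X.ringCatSheaf) F

/-- `F` is coherent: it is of finite type, and over every open `U` the kernel of every morphism
`𝒪_U^n ⟶ F|_U` is of finite type. -/
def IsCoherent (F : X.Modules) : Prop :=
  IsOfFiniteType F ∧ ∀ (U : X.Opens) (n : ℕ) (g : freeModule U n ⟶ F.restrict U.ι),
    IsOfFiniteType (kernel g)

/-- `E` is locally free of finite rank. -/
def IsLocallyFreeOfFiniteRank (E : X.Modules) : Prop :=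
  ∀ x : X, ∃ (U : X.Opens) (n : ℕ), x ∈ U ∧ Nonempty (E.restrict U.ι ≅ freeModule U n)

/-- `L` is a line bundle, that is, locally free of rank one. -/
def IsLineBundle (L : X.Modules) : Prop :=
  ∀ x : X, ∃ U : X.Opens, x ∈ U ∧ Nonempty (L.restrict U.ι ≅ freeModule U 1)

/-- The tensor product of two `𝒪_X`-modules: the sheaf associated to the presheaf
`U ↦ M(U) ⊗ N(U)`. -/
noncomputable def tensor (M N : X.Modules) : X.Modules :=
  (PresheafOfModules.sheafification (𝟙 X.ringCatSheaf.obj)).obj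
    (MonoidalCategory.tensorObj
      (C := PresheafOfModules (X.presheaf ⋙ forget₂ CommRingCat RingCat)) M.val N.val)

/-- The tensor power `L^{⊗ n}`. -/
noncomputable def tensorPower (L : X.Modules) : ℕ → X.Modules
  | 0 => SheafOfModules.unit X.ringCatSheaf
  | n + 1 => tensor (tensorPower L n) L

/-- The open set `X_s` of the points at which the section `s` of the line bundle `L` does not
vanish: the largest open set over which `a ↦ a s` is an isomorphism `𝒪 ⟶ L`. -/
noncomputable def nonvanishingLocus (L : X.Modules) (s : Γ(L, ⊤)) : X.Opens :=
  sSup {U | ∀ V : X.Opens, V ≤ U → Function.Bijective fun a : Γ(X, V) =>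
    a • L.presheaf.map (homOfLE (le_top : V ≤ ⊤)).op s}

/-- The line bundle `L` is ample: `X` is covered by affine open sets of the form `X_s`, where `s`
is a global section of a positive tensor power of `L`. -/
def IsAmple (L : X.Modules) : Prop :=
  IsLineBundle L ∧ ∀ x : X, ∃ n : ℕ, 0 < n ∧ ∃ s : Γ(tensorPower L n, ⊤),
    x ∈ nonvanishingLocus (tensorPower L n) s ∧
      IsAffineOpen (nonvanishingLocus (tensorPower L n) s)

/-- A resolution `⋯ ⟶ E₁ ⟶ E₀ ⟶ F ⟶ 0` by locally free sheaves of finite rank. -/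
structure LocallyFreeResolution (F : X.Modules) where
  /-- the complex `⋯ ⟶ E₁ ⟶ E₀` -/
  complex : ChainComplex X.Modules ℕ
  isLocallyFree : ∀ i, IsLocallyFreeOfFiniteRank (complex.X i)
  /-- the augmentation `E₀ ⟶ F` -/
  aug : complex.X 0 ⟶ F
  d_comp_aug : complex.d 1 0 ≫ aug = 0
  exact : ∀ i, (complex.augment aug d_comp_aug).ExactAt i

namespace LocallyFreeResolution

variable {F : X.Modules} (E : LocallyFreeResolution F) (U : X.Opens)

/-- The restricted complex `⋯ ⟶ E₁|_U ⟶ E₀|_U`. -/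
noncomputable abbrev complexOn : ChainComplex (U : Scheme.{u}).Modules ℕ :=
  ((Scheme.Modules.restrictFunctor U.ι).mapHomologicalComplex _).obj E.complex

/-- The restricted augmentation `E₀|_U ⟶ F|_U`. -/
noncomputable abbrev augOn : (E.complexOn U).X 0 ⟶ F.restrict U.ι :=
  (Scheme.Modules.restrictFunctor U.ι).map E.aug

theorem d_comp_augOn : (E.complexOn U).d 1 0 ≫ E.augOn U = 0 := by
  change (Scheme.Modules.restrictFunctor U.ι).map (E.complex.d 1 0) ≫
    (Scheme.Modules.restrictFunctor U.ι).map E.aug = 0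
  rw [← Functor.map_comp, E.d_comp_aug, Functor.map_zero]

end LocallyFreeResolution

end Sheaves

/-! ### The cohomology of `Hom(E_•, N)` and extensions of length `p` -/

section Extensions

variable {A : Type v} [Category.{w} A] [Abelian A]

/-- The group of `p`-cocycles of the complex `Hom(C_•, N)`: morphisms `c : C_p ⟶ N` with
`c ∘ ∂ = 0`. -/
def homCocycles (C : ChainComplex A ℕ) (N : A) (p : ℕ) : AddSubgroup (C.X p ⟶ N) :=
  (Preadditive.leftComp N (C.d (p + 1) p)).ker

/-- The group of `p`-coboundaries of `Hom(C_•, N)`: morphisms of the form `h ∘ ∂` with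
`h : C_{p-1} ⟶ N`. (For `p = 0` the differential `C.d 0 0` is zero.) -/
def homCoboundaries (C : ChainComplex A ℕ) (N : A) (p : ℕ) : AddSubgroup (C.X p ⟶ N) :=
  (Preadditive.leftComp N (C.d p (p - 1))).range

/-- The cohomology group `h^p(Hom(C_•, N))`. -/
abbrev HomCohomology (C : ChainComplex A ℕ) (N : A) (p : ℕ) : Type w :=
  homCocycles C N p ⧸ (homCoboundaries C N p).addSubgroupOf (homCocycles C N p)

/-- The class of a cocycle in `h^p(Hom(C_•, N))`. -/
def homClass {C : ChainComplex A ℕ} {N : A} {p : ℕ} (c : homCocycles C N p) :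
    HomCohomology C N p :=
  QuotientAddGroup.mk c

/-- A length `p` extension of `N` by `M`: an exact sequence
`0 ⟶ N ⟶ H_{p-1} ⟶ ⋯ ⟶ H_0 ⟶ M ⟶ 0`. It is given as an exact chain complex with `M` in degree
`0`, with `H_i` in degree `i + 1`, with `N` in degree `p + 1`, and zero in higher degrees. -/
structure LengthExtension (p : ℕ) (N M : A) where
  /-- the exact sequence -/
  complex : ChainComplex A ℕ
  exact : ∀ i, complex.ExactAt i
  /-- the term in degree `0` -/
  right : complex.X 0 ≅ M
  /-- the term in degree `p + 1` -/
  left : complex.X (p + 1) ≅ N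
  isZero : ∀ i, p + 1 < i → IsZero (complex.X i)

/-- Two extensions are isomorphic, by an isomorphism of exact sequences that is the identity
on both ends. -/
def LengthExtension.Isomorphic {p : ℕ} {N M : A} (S T : LengthExtension p N M) : Prop :=
  ∃ e : S.complex ≅ T.complex, e.hom.f 0 ≫ T.right.hom = S.right.hom ∧
    e.hom.f (p + 1) ≫ T.left.hom = S.left.hom

/-- Let `⋯ ⟶ C₁ ⟶ C₀ ⟶ M ⟶ 0` be an augmented complex and let `c : C_p ⟶ N` be a cocycle, where
`0 < p`. Let `K_p` be the cokernel of `C_{p+1} ⟶ C_p`, and `ĉ : K_p ⟶ N` the morphism through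
which `c` factors. The extension `S` is the pushout extension of `c` if it is
`0 ⟶ N ⟶ H ⟶ C_{p-2} ⟶ ⋯ ⟶ C_0 ⟶ M ⟶ 0`, where `H` is the pushout of `K_p ⟶ C_{p-1}`
along `ĉ`.  This is expressed by a morphism `t` from the augmented complex (with `M` in degree
`0` and `C_i` in degree `i + 1`) to `S`, which is the identity on `M`, an isomorphism on
`C_0, …, C_{p-2}`, the coprojection `C_{p-1} ⟶ H`, and `c` on `C_p`. -/
def IsPushoutExtension (C : ChainComplex A ℕ) {M : A} (aug : C.X 0 ⟶ M) (w : C.d 1 0 ≫ aug = 0)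
    {N : A} {p : ℕ} (c : homCocycles C N p) (S : LengthExtension p N M) : Prop :=
  ∃ t : C.augment aug w ⟶ S.complex,
    t.f 0 ≫ S.right.hom = 𝟙 M ∧
    (∀ i, i < p → IsIso (t.f i)) ∧
    t.f (p + 1) ≫ S.left.hom = c.1 ∧
    IsPushout ((C.augment aug w).fromOpcycles (p + 1) p)
      ((C.augment aug w).descOpcycles (i := p + 1) c.1 (p + 2) (by simp) c.2)
      (t.f p) (S.left.inv ≫ S.complex.d (p + 1) p)

end Extensions

/-! ### The section of the Ext sheaf given by an extension -/

/-- The extension `S : 0 ⟶ G|_U ⟶ H_{p-1} ⟶ ⋯ ⟶ H_0 ⟶ F|_U ⟶ 0` of `𝒪_U`-modules represents the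
section `s` of `ℰxt^p(F, G)` over `U`: for an injective resolution `G ⟶ I^•`, the identity of
`G|_U` extends to a commutative ladder from `S` to `G|_U ⟶ I^0|_U ⟶ ⋯ ⟶ I^p|_U`, with components
`ψ i j` for `i + j = p`, and the component `F|_U ⟶ I^p|_U`, which is a cocycle in
`Γ(U, ℋom(F, I^p))`, has `s` as its cohomology class. -/
def Represents {X : Scheme.{u}} {F G : X.Modules} {U : X.Opens} {p : ℕ}
    (S : LengthExtension p (G.restrict U.ι) (F.restrict U.ι)) (s : extSections F G p U) : Prop :=
  ∃ (I : InjectiveResolution G)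
    (ψ : ∀ i j : ℕ, i + j = p → (S.complex.X i ⟶ (I.cocomplex.X j).restrict U.ι)),
    S.complex.d (p + 1) p ≫ ψ p 0 rfl =
      S.left.hom ≫ (Scheme.Modules.restrictFunctor U.ι).map (I.ι.f 0) ∧
    (∀ (i j : ℕ) (h : i + 1 + j = p),
      S.complex.d (i + 1) i ≫ ψ i (j + 1) (by omega) =
        ψ (i + 1) j h ≫ (Scheme.Modules.restrictFunctor U.ι).map (I.cocomplex.d j (j + 1))) ∧
    ∃ z : ((((sheafHom F).mapHomologicalComplex (ComplexShape.up ℕ)).obj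
        I.cocomplex).cycles p).obj.obj (op U),
      (∀ V : (U : Scheme.{u}).Opens,
        (((((sheafHom F).mapHomologicalComplex (ComplexShape.up ℕ)).obj
          I.cocomplex).iCycles p).hom.app (op U) z : localHom F (I.cocomplex.X p) U).1
            ⟨U.ι ''ᵁ V, U.ι_image_le V⟩ =
          ((S.right.inv ≫ ψ 0 p (zero_add p)).app V).hom) ∧
      ((((sheafHom F).mapHomologicalComplex (ComplexShape.up ℕ)).obj
          I.cocomplex).homologyπ p).hom.app (op U) z =
        (I.isoRightDerivedObj (sheafHom F) p).hom.hom.app (op U) s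

end SheafExt

namespace SheafExt

/-! ### Sections of sheaves of modules -/

section Sections

variable {X : Scheme.{u}}

/-! Let `G ⟶ I^•` be an injective resolution. The complexes Hom(E_•|_U, G|_U) and Hom(F|_U, I^•|_U)
are two edges of the commuting double complex of local homomorphisms between the augmented sequences
E_• ⟶ F and G ⟶ I^•. Away from these edges everything is exact. Maps into an injective are exact
over every open set, because restrictions of injectives to open subsets are injective
(`injective_restrict`). Maps out of a locally free sheaf of finite rank are exact locally
(`Bires.exists_η_eq`). Walking from one edge to the other by zigzags (`Bires.Zig`) therefore
compares cocycles of Hom(E_•, G) with cocycles of ℋom(F, I^•): a cocycle over U determines a section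
of the Ext sheaf (`exists_zigClass`), every section arises so locally (`exists_zigClass_local`), and
in positive degree the section is zero exactly when the cocycle is locally a coboundary
(`ZigClass.eq_zero`, `ZigClass.exists_mem_rangeδ`).

The word "locally" disappears over affine opens. The sheaves ℋom(E_i, G) are quasi-coherent in the
sense of `QCOn`, kernels and cokernels inherit this, and an epimorphism with quasi-coherent kernel
is surjective on sections over an affine open (`surjective_of_qcOn_kernel`). Hence over an affine V
a local coboundary is a coboundary and each section of the Ext sheaf comes from one cocycle, unique
up to coboundaries. The required cover consists of the affine opens; for U contained in an affine V,
the map Φ sends f to the restriction to U of its class over V, so U itself need not be affine.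

A pushout extension S of a cocycle c comes with a morphism t from the augmented complex E_• ⟶ F. As
S is exact and the I^j|_U are injective, the identity of G|_U extends to a ladder from S to I^•|_U.
Composed with t, this ladder is a zigzag from c to its last component F|_U ⟶ I^p|_U, which therefore
has the class attached to c (`represents_of_zigClass`). Adding a coboundary to c changes only a
coprojection of the same pushout, whence the independence (`isomorphic_of_isPushoutExtension`).

For resolutions, let s be a section of a power M of L with D = X_s affine. A section of a
quasi-coherent F over D extends to X after multiplication by a power of s
(`IsMulTower.exists_extend`). Read in ℋom(M^{-n}, F), the extension is a morphism M^{-n} ⟶ F whose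
image contains the given section over D (`IsEquation.exists_hom`). By compactness a finite direct
sum of such line bundles surjects onto F. The kernel is again quasi-coherent and, X being locally
Noetherian, locally finitely generated, so the construction iterates. -/

/-- Restriction of sections of the structure sheaf. -/
noncomputable def rres {U V : X.Opens} (h : V ≤ U) : Γ(X, U) →+* Γ(X, V) :=
  (X.presheaf.map (homOfLE h).op).hom

/-- Restriction of sections of a sheaf of modules. -/
noncomputable def sres (F : X.Modules) {U V : X.Opens} (h : V ≤ U) : Γ(F, U) →+ Γ(F, V) :=
  (F.presheaf.map (homOfLE h).op).hom

/-- The map on sections over `U` induced by a morphism of sheaves of modules. -/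
noncomputable def happ {F G : X.Modules} (φ : F ⟶ G) (U : X.Opens) :
    Γ(F, U) →ₗ[Γ(X, U)] Γ(G, U) where
  toFun := φ.app U
  map_add' := map_add _
  map_smul' := Scheme.Modules.Hom.app_smul φ

variable {F G H : X.Modules} {U V W : X.Opens}

@[simp]
theorem sres_self (h : U ≤ U) (s : Γ(F, U)) : sres F h s = s := by
  simp [sres]

@[simp]
theorem sres_sres (h : V ≤ U) (k : W ≤ V) (s : Γ(F, U)) :
    sres F k (sres F h s) = sres F (k.trans h) s :=
  res_res F (homOfLE h) (homOfLE k) (homOfLE (k.trans h)) s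

@[simp]
theorem rres_self (h : U ≤ U) (a : Γ(X, U)) : rres h a = a := by
  simp [rres]

@[simp]
theorem rres_rres (h : V ≤ U) (k : W ≤ V) (a : Γ(X, U)) :
    rres k (rres h a) = rres (k.trans h) a := by
  change (X.presheaf.map _ ≫ X.presheaf.map _).hom a = _
  rw [← Functor.map_comp]
  rfl

@[simp]
theorem sres_smul (h : V ≤ U) (a : Γ(X, U)) (s : Γ(F, U)) :
    sres F h (a • s) = rres h a • sres F h s :=
  Scheme.Modules.map_smul F (homOfLE h) a s

@[simp]
theorem happ_sres (φ : F ⟶ G) (h : V ≤ U) (s : Γ(F, U)) :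
    happ φ V (sres F h s) = sres G h (happ φ U s) :=
  ConcreteCategory.congr_hom (φ.mapPresheaf.naturality (homOfLE h).op) s

@[simp]
theorem happ_comp (φ : F ⟶ G) (ψ : G ⟶ H) (s : Γ(F, U)) :
    happ (φ ≫ ψ) U s = happ ψ U (happ φ U s) := rfl

@[simp]
theorem happ_id (s : Γ(F, U)) : happ (𝟙 F) U s = s := rfl

@[simp]
theorem happ_zero (s : Γ(F, U)) : happ (0 : F ⟶ G) U s = 0 := rfl

@[simp]
theorem happ_add (φ ψ : F ⟶ G) (s : Γ(F, U)) : happ (φ + ψ) U s = happ φ U s + happ ψ U s := rfl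

theorem happ_sum {ι : Type*} (t : Finset ι) (φ : ι → (F ⟶ G)) (s : Γ(F, U)) :
    happ (∑ i ∈ t, φ i) U s = ∑ i ∈ t, happ (φ i) U s := by
  classical
  induction t using Finset.induction_on with
  | empty => simp
  | insert a t ha ih => simp [Finset.sum_insert ha, ih]

theorem hom_ext_happ {φ ψ : F ⟶ G} (h : ∀ U (s : Γ(F, U)), happ φ U s = happ ψ U s) : φ = ψ := by
  apply Scheme.Modules.hom_ext
  intro U
  ext s
  exact h U s

/-- The morphism of sheaves of modules with given components. -/
noncomputable def mkHom (φ : ∀ U : X.Opens, Γ(F, U) →+ Γ(G, U))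
    (hsmul : ∀ U (a : Γ(X, U)) (s : Γ(F, U)), φ U (a • s) = a • φ U s)
    (hres : ∀ (U V : X.Opens) (h : V ≤ U) (s : Γ(F, U)),
      φ V (sres F h s) = sres G h (φ U s)) : F ⟶ G :=
  ⟨PresheafOfModules.homMk
    { app := fun U => AddCommGrpCat.ofHom (φ U.unop)
      naturality := fun U V i => by
        ext s
        exact hres _ _ i.unop.le s } fun U a s => hsmul U.unop a s⟩

/-- Two sections are equal if they agree near every point. -/
theorem section_ext {s t : Γ(F, U)}
    (h : ∀ x ∈ U, ∃ (V : X.Opens) (hV : V ≤ U), x ∈ V ∧ sres F hV s = sres F hV t) : s = t := by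
  choose V hV hx hs using h
  apply TopCat.Sheaf.eq_of_locally_eq' (⟨F.presheaf, F.isSheaf⟩ : TopCat.Sheaf AddCommGrpCat.{u} X)
    (fun x : U => V x.1 x.2) U (fun x => homOfLE (hV x.1 x.2))
  · intro x hxU
    exact Opens.mem_iSup.2 ⟨⟨x, hxU⟩, hx x hxU⟩
  · intro x
    exact hs x.1 x.2

/-- Gluing of sections. -/
theorem section_glue {ι : Type u} (V : ι → X.Opens) (hV : ∀ i, V i ≤ U) (hU : U ≤ iSup V)
    (s : ∀ i, Γ(F, V i))
    (h : ∀ i j, sres F (inf_le_left : V i ⊓ V j ≤ V i) (s i) =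
      sres F (inf_le_right : V i ⊓ V j ≤ V j) (s j)) :
    ∃ t : Γ(F, U), ∀ i, sres F (hV i) t = s i :=
  (TopCat.Sheaf.existsUnique_gluing'
    (⟨F.presheaf, F.isSheaf⟩ : TopCat.Sheaf AddCommGrpCat.{u} X)
    V U (fun i => homOfLE (hV i)) hU s h).exists

/-- Gluing of sections along a family of opens containing a neighbourhood of each point. -/
theorem section_glue_nhds (P : ∀ (V : X.Opens), V ≤ U → Γ(F, V) → Prop)
    (hP : ∀ x ∈ U, ∃ (V : X.Opens) (hV : V ≤ U), x ∈ V ∧ ∃ s, P V hV s)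
    (h : ∀ V V' (hV : V ≤ U) (hV' : V' ≤ U) s s', P V hV s → P V' hV' s' →
      sres F (inf_le_left : V ⊓ V' ≤ V) s = sres F (inf_le_right : V ⊓ V' ≤ V') s') :
    ∃ t : Γ(F, U), ∀ x ∈ U, ∃ (V : X.Opens) (hV : V ≤ U), x ∈ V ∧ P V hV (sres F hV t) := by
  choose V hV hx s hs using hP
  obtain ⟨t, ht⟩ := section_glue (F := F) (fun x : U => V x.1 x.2) (fun x => hV x.1 x.2)
    (fun x hxU => Opens.mem_iSup.2 ⟨⟨x, hxU⟩, hx x hxU⟩) (fun x => s x.1 x.2)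
    (fun x y => h _ _ _ _ _ _ (hs _ _) (hs _ _))
  refine ⟨t, fun x hxU => ⟨V x hxU, hV x hxU, hx x hxU, ?_⟩⟩
  rw [ht ⟨x, hxU⟩]
  exact hs x hxU

/-- A sheaf of modules given by its sections. -/
noncomputable def mkModules (M : TopCat.Presheaf AddCommGrpCat.{u} X) (hM : M.IsSheaf)
    [∀ U : X.Opens, Module Γ(X, U) (M.obj (op U))]
    (hsmul : ∀ (U V : X.Opens) (i : V ⟶ U) (a : Γ(X, U)) (m : M.obj (op U)),
      M.map i.op (a • m) = X.presheaf.map i.op a • M.map i.op m) : X.Modules :=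
  letI : ∀ U : (Opens X)ᵒᵖ, Module (X.ringCatSheaf.obj.obj U) (M.obj U) :=
    fun U => inferInstanceAs (Module Γ(X, U.unop) (M.obj (op U.unop)))
  { val := PresheafOfModules.ofPresheaf (R := X.ringCatSheaf.obj) M
      (fun U V i a m => hsmul U.unop V.unop i.unop a m)
    isSheaf := hM }

/-- A subsheaf of modules: a family of submodules that is local. -/
structure SubSheaf (F : X.Modules) where
  /-- the sections of the subsheaf -/
  obj (U : X.Opens) : Submodule Γ(X, U) Γ(F, U)
  res {U V : X.Opens} (h : V ≤ U) {s : Γ(F, U)} : s ∈ obj U → sres F h s ∈ obj V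
  loc {U : X.Opens} {s : Γ(F, U)} :
    (∀ x ∈ U, ∃ (V : X.Opens) (h : V ≤ U), x ∈ V ∧ sres F h s ∈ obj V) → s ∈ obj U

namespace SubSheaf

variable (S : SubSheaf F)

/-- The presheaf of abelian groups underlying a subsheaf of modules. -/
noncomputable def presheaf : TopCat.Presheaf AddCommGrpCat.{u} X where
  obj U := AddCommGrpCat.of (S.obj U.unop)
  map {U V} i := AddCommGrpCat.ofHom
    { toFun := fun s => ⟨sres F i.unop.le s.1, S.res i.unop.le s.2⟩
      map_zero' := by ext; simp
      map_add' := fun a b => by ext; simp }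
  map_id U := by
    ext s
    exact sres_self _ _
  map_comp i j := by
    ext s
    exact (sres_sres _ _ _).symm

theorem presheaf_isSheaf : S.presheaf.IsSheaf := by
  rw [TopCat.Presheaf.isSheaf_iff_isSheaf_comp (CategoryTheory.forget AddCommGrpCat.{u})]
  apply TopCat.Presheaf.isSheaf_of_isSheafUniqueGluing_types
  intro ι U sf hsf
  let s : ∀ i, S.obj (U i) := sf
  obtain ⟨t, ht⟩ := section_glue (F := F) U (fun i => le_iSup U i) le_rfl (fun i => (s i).1)
    (fun i j => congrArg Subtype.val (hsf i j))
  refine ⟨⟨t, S.loc fun x hx => ?_⟩, fun i => Subtype.ext (ht i), fun t' ht' => Subtype.ext ?_⟩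
  · obtain ⟨i, hi⟩ := Opens.mem_iSup.1 hx
    refine ⟨U i, le_iSup U i, hi, ?_⟩
    rw [ht]
    exact (s i).2
  · refine section_ext fun x hx => ?_
    obtain ⟨i, hi⟩ := Opens.mem_iSup.1 hx
    refine ⟨U i, le_iSup U i, hi, ?_⟩
    rw [ht]
    exact congrArg Subtype.val (ht' i)

/-- The sheaf of modules associated to a subsheaf. -/
noncomputable def toModules : X.Modules :=
  letI : ∀ U : X.Opens, Module Γ(X, U) (S.presheaf.obj (op U)) :=
    fun U => inferInstanceAs (Module Γ(X, U) (S.obj U))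
  mkModules S.presheaf S.presheaf_isSheaf
    (fun _ _ i a m => Subtype.ext (sres_smul i.le a m.1))

/-- The inclusion of a subsheaf. -/
noncomputable def ι : S.toModules ⟶ F :=
  mkHom (fun U => (S.obj U).subtype.toAddMonoidHom) (fun _ _ _ => rfl) (fun _ _ _ _ => rfl)

theorem happ_ι_mem (s : Γ(S.toModules, U)) : happ S.ι U s ∈ S.obj U :=
  Subtype.property (p := fun x => x ∈ S.obj U) s

theorem happ_ι_injective : Function.Injective (happ S.ι U) :=
  fun _ _ h => Subtype.ext h

theorem exists_happ_ι_eq {s : Γ(F, U)} (hs : s ∈ S.obj U) :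
    ∃ t : Γ(S.toModules, U), happ S.ι U t = s := ⟨(⟨s, hs⟩ : S.obj U), rfl⟩

end SubSheaf

/-- The morphism into a subsheaf induced by a morphism with values in the subsheaf. -/
noncomputable def SubSheaf.lift (S : SubSheaf F) (φ : G ⟶ F)
    (h : ∀ U (s : Γ(G, U)), happ φ U s ∈ S.obj U) : G ⟶ S.toModules :=
  mkHom (fun U => ((happ φ U).codRestrict (S.obj U) (h U)).toAddMonoidHom)
    (fun U a s => ((happ φ U).codRestrict (S.obj U) (h U)).map_smul a s)
    (fun _ _ i s => Subtype.ext (happ_sres φ i s))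

@[simp]
theorem SubSheaf.lift_ι (S : SubSheaf F) (φ : G ⟶ F)
    (h : ∀ U (s : Γ(G, U)), happ φ U s ∈ S.obj U) : S.lift φ h ≫ S.ι = φ := rfl

/-- The kernel of a morphism, as a subsheaf. -/
noncomputable def kerSub (φ : F ⟶ G) : SubSheaf F where
  obj U := (happ φ U).ker
  res h s hs := by
    rw [LinearMap.mem_ker] at hs ⊢
    rw [happ_sres, hs, map_zero]
  loc {U s} h := by
    rw [LinearMap.mem_ker]
    refine section_ext fun x hx => ?_
    obtain ⟨V, hV, hx, hs⟩ := h x hx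
    refine ⟨V, hV, hx, ?_⟩
    rw [map_zero, ← happ_sres]
    exact hs

/-- The image of a morphism, as a subsheaf. -/
noncomputable def imSub (φ : F ⟶ G) : SubSheaf G where
  obj U :=
    { carrier := {t | ∀ x ∈ U, ∃ (V : X.Opens) (h : V ≤ U), x ∈ V ∧
        ∃ s, happ φ V s = sres G h t}
      zero_mem' := fun x hx => ⟨U, le_rfl, hx, 0, by simp⟩
      add_mem' := fun {a b} ha hb x hx => by
        obtain ⟨V, hV, hxV, s, hs⟩ := ha x hx
        obtain ⟨V', hV', hxV', s', hs'⟩ := hb x hx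
        refine ⟨V ⊓ V', inf_le_left.trans hV, ⟨hxV, hxV'⟩,
          sres F inf_le_left s + sres F inf_le_right s', ?_⟩
        simp [hs, hs']
      smul_mem' := fun a t ht x hx => by
        obtain ⟨V, hV, hxV, s, hs⟩ := ht x hx
        exact ⟨V, hV, hxV, rres hV a • s, by simp [hs]⟩ }
  res {U V} h s hs x hx := by
    obtain ⟨W, hW, hxW, t, ht⟩ := hs x (h hx)
    exact ⟨W ⊓ V, inf_le_right, ⟨hxW, hx⟩, sres F inf_le_left t, by simp [ht]⟩
  loc {U s} h x hx := by
    obtain ⟨V, hV, hxV, hs⟩ := h x hx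
    obtain ⟨W, hW, hxW, t, ht⟩ := hs x hxV
    exact ⟨W, hW.trans hV, hxW, t, by simpa using ht⟩

theorem kerSub_ι_comp (φ : F ⟶ G) : (kerSub φ).ι ≫ φ = 0 :=
  hom_ext_happ fun _ s => (kerSub φ).happ_ι_mem s

theorem injective_of_mono (φ : F ⟶ G) [Mono φ] (U : X.Opens) : Function.Injective (happ φ U) := by
  rw [injective_iff_map_eq_zero]
  intro s hs
  obtain ⟨t, rfl⟩ := (kerSub φ).exists_happ_ι_eq (U := U) hs
  rw [zero_of_comp_mono φ (kerSub_ι_comp φ), happ_zero]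

theorem mono_of_injective {φ : F ⟶ G} (h : ∀ U, Function.Injective (happ φ U)) : Mono φ where
  right_cancellation a b hab := hom_ext_happ fun U s => h U (by
    rw [← happ_comp, hab, happ_comp])

instance (S : SubSheaf F) : Mono S.ι := mono_of_injective fun _ => S.happ_ι_injective

/-- Surjectivity near every point. -/
def LocSurj (φ : F ⟶ G) : Prop :=
  ∀ (U : X.Opens) (t : Γ(G, U)), ∀ x ∈ U, ∃ (V : X.Opens) (h : V ≤ U), x ∈ V ∧
    ∃ s, happ φ V s = sres G h t

theorem epi_of_locSurj {φ : F ⟶ G} (h : LocSurj φ) : Epi φ where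
  left_cancellation a b hab := hom_ext_happ fun U t => section_ext fun x hx => by
    obtain ⟨V, hV, hxV, s, hs⟩ := h U t x hx
    refine ⟨V, hV, hxV, ?_⟩
    rw [← happ_sres, ← happ_sres, ← hs, ← happ_comp, hab, happ_comp]

theorem surjective_of_isIso (φ : F ⟶ G) [IsIso φ] (U : X.Opens) :
    Function.Surjective (happ φ U) := fun t => ⟨happ (inv φ) U t, by simp [← happ_comp]⟩

/-- The inclusion of the image subsheaf is a monomorphism, and an epimorphism because φ factors
through it; in an abelian category it is then an isomorphism. -/
theorem locSurj_of_epi (φ : F ⟶ G) [Epi φ] : LocSurj φ := by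
  have hφ : ∀ U (s : Γ(F, U)), happ φ U s ∈ (imSub φ).obj U :=
    fun U s x hx => ⟨U, le_rfl, hx, s, by simp⟩
  have : Epi (imSub φ).ι := epi_of_epi_fac ((imSub φ).lift_ι φ hφ)
  have : IsIso (imSub φ).ι := isIso_of_mono_of_epi _
  intro U t
  obtain ⟨s, rfl⟩ := surjective_of_isIso (imSub φ).ι U t
  exact (imSub φ).happ_ι_mem s

theorem isIso_of_bijective {φ : F ⟶ G} (h : ∀ U, Function.Bijective (happ φ U)) : IsIso φ := by
  have : Mono φ := mono_of_injective fun U => (h U).1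
  have : Epi φ := epi_of_locSurj fun U t x hx => by
    obtain ⟨s, hs⟩ := (h U).2 t
    exact ⟨U, le_rfl, hx, s, by simp [hs]⟩
  exact isIso_of_mono_of_epi _

/-- Exactness in the middle, on sections near every point. -/
def LocExact (φ : F ⟶ G) (ψ : G ⟶ H) : Prop :=
  ∀ (U : X.Opens) (t : Γ(G, U)), happ ψ U t = 0 → ∀ x ∈ U,
    ∃ (V : X.Opens) (h : V ≤ U), x ∈ V ∧ ∃ s, happ φ V s = sres G h t

/-- Exactness gives a lift of the kernel subsheaf after an epimorphic refinement, and an epimorphism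
of sheaves lifts sections near every point. -/
theorem locExact_of_exact {S : ShortComplex X.Modules} (hS : S.Exact) : LocExact S.f S.g := by
  intro U t ht x hx
  obtain ⟨k, rfl⟩ := (kerSub S.g).exists_happ_ι_eq (U := U) ht
  obtain ⟨A, π, hπ, y, hy⟩ := hS.exact_up_to_refinements (kerSub S.g).ι (kerSub_ι_comp _)
  obtain ⟨V, hV, hxV, s, hs⟩ := locSurj_of_epi π U k x hx
  refine ⟨V, hV, hxV, happ y V s, ?_⟩
  rw [← happ_comp, ← hy, happ_comp, hs, happ_sres]

theorem exact_of_locExact {S : ShortComplex X.Modules} (hS : LocExact S.f S.g) : S.Exact := by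
  rw [S.exact_iff_epi_toCycles]
  refine epi_of_locSurj fun U t x hx => ?_
  obtain ⟨V, hV, hxV, s, hs⟩ := hS U (happ S.iCycles U t)
    (by rw [← happ_comp, S.iCycles_g, happ_zero]) x hx
  refine ⟨V, hV, hxV, s, injective_of_mono S.iCycles V ?_⟩
  rw [← happ_comp, S.toCycles_i, hs, happ_sres]

theorem happ_kernel_ι_eq_zero (φ : F ⟶ G) (s : Γ(kernel φ, U)) :
    happ φ U (happ (kernel.ι φ) U s) = 0 := by
  rw [← happ_comp, kernel.condition, happ_zero]

theorem exists_happ_kernel_ι_eq (φ : F ⟶ G) (s : Γ(F, U)) (hs : happ φ U s = 0) :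
    ∃ t, happ (kernel.ι φ) U t = s := by
  obtain ⟨k, rfl⟩ := (kerSub φ).exists_happ_ι_eq (U := U) hs
  exact ⟨happ (kernel.lift φ _ (kerSub_ι_comp φ)) U k, by rw [← happ_comp, kernel.lift_ι]⟩

end Sections

/-! ### Restriction to an open subset preserves exactness -/

section Restrict

variable {X : Scheme.{u}}

theorem happ_restrict {F G : X.Modules} (φ : F ⟶ G) (U : X.Opens) (V : (U : Scheme.{u}).Opens)
    (s : Γ(F, U.ι ''ᵁ V)) :
    happ ((Scheme.Modules.restrictFunctor U.ι).map φ) V s = happ φ (U.ι ''ᵁ V) s := rfl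

theorem restrict_locExact {F G H : X.Modules} {φ : F ⟶ G} {ψ : G ⟶ H} (h : LocExact φ ψ)
    (U : X.Opens) : LocExact ((Scheme.Modules.restrictFunctor U.ι).map φ)
      ((Scheme.Modules.restrictFunctor U.ι).map ψ) := by
  intro V t ht x hx
  obtain ⟨W, hW, hxW, s, hs⟩ := h (U.ι ''ᵁ V) t ht (U.ι x) ⟨x, hx, rfl⟩
  have hWU : W ≤ U := hW.trans (U.ι_image_le V)
  refine ⟨U.ι ⁻¹ᵁ W, ?_, hxW, sres F ?_ s, ?_⟩
  · intro y hy
    obtain ⟨z, hz, hzy⟩ := hW hy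
    rwa [← U.ι.isOpenEmbedding.injective hzy]
  · exact U.ι.image_preimage_le W
  · refine (happ_restrict φ U _ _).trans ((happ_sres φ _ s).trans ?_)
    rw [hs]
    exact sres_sres (F := G) hW (U.ι.image_preimage_le W) t

theorem restrict_exact {S : ShortComplex X.Modules} (hS : S.Exact) (U : X.Opens) :
    (S.map (Scheme.Modules.restrictFunctor U.ι)).Exact :=
  exact_of_locExact (restrict_locExact (locExact_of_exact hS) U)

end Restrict

/-! ### Quasi-coherence on sections -/

section QuasiCoherent

variable {X : Scheme.{u}}

/-- Over the affine open subsets `W` of `U`, the sections over the basic open subset of `r` are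
the localization at `r` of the sections over `W`. -/
structure QCOn (F : X.Modules) (U : X.Opens) : Prop where
  ann : ∀ (W : X.Opens), W ≤ U → IsAffineOpen W → ∀ (r : Γ(X, W)) (s : Γ(F, W)),
    sres F (X.basicOpen_le r) s = 0 → ∃ n : ℕ, r ^ n • s = 0
  ext : ∀ (W : X.Opens), W ≤ U → IsAffineOpen W → ∀ (r : Γ(X, W)) (t : Γ(F, X.basicOpen r)),
    ∃ (n : ℕ) (s : Γ(F, W)), sres F (X.basicOpen_le r) s = rres (X.basicOpen_le r) r ^ n • t

variable {F G A B C : X.Modules} {U V W : X.Opens}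

theorem QCOn.mono (h : QCOn F U) (hV : V ≤ U) : QCOn F V :=
  ⟨fun W hW => h.ann W (hW.trans hV), fun W hW => h.ext W (hW.trans hV)⟩

theorem basicOpen_rres (h : W ≤ V) (r : Γ(X, V)) :
    X.basicOpen (rres h r) = W ⊓ X.basicOpen r := X.basicOpen_res _ _

theorem QCOn.exists_pow_smul_eq_zero (hF : QCOn F U) (hW : IsAffineOpen W) (hWU : W ≤ U)
    (hWV : W ≤ V) (r : Γ(X, V)) {W' : X.Opens} (hW' : W' = W ⊓ X.basicOpen r) (h : W' ≤ W)
    (s : Γ(F, W)) (hs : sres F h s = 0) : ∃ n : ℕ, rres hWV r ^ n • s = 0 := by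
  rw [← basicOpen_rres hWV] at hW'
  subst hW'
  exact hF.ann W hWU hW _ s hs

theorem QCOn.exists_extend (hF : QCOn F U) (hW : IsAffineOpen W) (hWU : W ≤ U)
    (hWV : W ≤ V) (r : Γ(X, V)) {W' : X.Opens} (hW' : W' = W ⊓ X.basicOpen r) (h : W' ≤ W)
    (t : Γ(F, W')) : ∃ (n : ℕ) (s : Γ(F, W)), sres F h s = rres (h.trans hWV) r ^ n • t := by
  rw [← basicOpen_rres hWV] at hW'
  subst hW'
  obtain ⟨n, s, hs⟩ := hF.ext W hWU hW _ t
  exact ⟨n, s, by rw [hs, rres_rres]⟩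

/-- Annihilation by powers of r passes to subsheaves. For extension, extend in F: the image in G
vanishes on D(r), so a further power of r kills it and moves the extension into A. -/
theorem QCOn.of_kernel (hF : QCOn F U) (hG : QCOn G U) (i : A ⟶ F) (φ : F ⟶ G)
    (hi : ∀ V, Function.Injective (happ i V)) (hiφ : i ≫ φ = 0)
    (hex : ∀ V (s : Γ(F, V)), happ φ V s = 0 → ∃ a, happ i V a = s) : QCOn A U where
  ann W hW hWa r s hs := by
    obtain ⟨n, hn⟩ := hF.ann W hW hWa r (happ i W s) (by rw [← happ_sres, hs, map_zero])
    exact ⟨n, hi W (by rw [map_smul, hn, map_zero])⟩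
  ext W hW hWa r t := by
    obtain ⟨n, s, hs⟩ := hF.ext W hW hWa r (happ i _ t)
    obtain ⟨m, hm⟩ := hG.ann W hW hWa r (happ φ W s) (by
      rw [← happ_sres, hs, map_smul, ← happ_comp, hiφ, happ_zero, smul_zero])
    obtain ⟨a, ha⟩ := hex W (r ^ m • s) (by rw [map_smul, hm])
    refine ⟨m + n, a, hi _ ?_⟩
    rw [happ_sres, ha, sres_smul, hs, map_smul, map_pow, smul_smul, pow_add]

protected theorem QCOn.kernel (hF : QCOn F U) (hG : QCOn G U) (φ : F ⟶ G) : QCOn (kernel φ) U :=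
  hF.of_kernel hG (kernel.ι φ) φ (injective_of_mono _) (kernel.condition φ)
    fun _ => exists_happ_kernel_ι_eq φ

theorem exists_basicOpen (hV : IsAffineOpen V) {x : X} (hx : x ∈ V) (hU : x ∈ U) :
    ∃ r : Γ(X, V), X.basicOpen r ≤ U ∧ x ∈ X.basicOpen r :=
  hV.exists_basicOpen_le ⟨x, hU⟩ hx

theorem ideal_eq_top (hV : IsAffineOpen V) (I : Ideal Γ(X, V))
    (h : ∀ x ∈ V, ∃ r ∈ I, x ∈ X.basicOpen r) : I = ⊤ := by
  rw [← Ideal.span_eq I, ← hV.iSup_basicOpen_eq_self_iff]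
  refine le_antisymm (iSup_le fun r => X.basicOpen_le _) fun x hx => ?_
  obtain ⟨r, hr, hxr⟩ := h x hx
  exact Opens.mem_iSup.2 ⟨⟨r, hr⟩, hxr⟩

theorem exists_finset_cover (hV : IsAffineOpen V) (P : Γ(X, V) → Prop)
    (h : ∀ x ∈ V, ∃ r, P r ∧ x ∈ X.basicOpen r) :
    ∃ t : Finset Γ(X, V), (∀ r ∈ t, P r) ∧ ∀ x ∈ V, ∃ r ∈ t, x ∈ X.basicOpen r := by
  have : Ideal.span {r | P r} = ⊤ := ideal_eq_top hV _ fun x hx => by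
    obtain ⟨r, hr, hx⟩ := h x hx
    exact ⟨r, Ideal.subset_span hr, hx⟩
  obtain ⟨t, ht, htop⟩ := (Ideal.span_eq_top_iff_finite _).1 this
  refine ⟨t, ht, fun x hx => ?_⟩
  rw [← hV.iSup_basicOpen_eq_self_iff] at htop
  rw [← htop] at hx
  obtain ⟨r, hr⟩ := Opens.mem_iSup.1 hx
  exact ⟨r.1, r.2, hr⟩

/-- Sections over a finite cover that agree on overlaps up to multiplication by a power of `r`
glue after multiplication by a power of `r`. -/
theorem exists_glue_pow (r : Γ(X, V)) (t : Finset Γ(X, V))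
    (ht : ∀ x ∈ V, ∃ h ∈ t, x ∈ X.basicOpen h) (b : ∀ h : Γ(X, V), Γ(B, X.basicOpen h))
    (hb : ∀ h ∈ t, ∀ h' ∈ t, ∃ n : ℕ,
      rres (show X.basicOpen h ⊓ X.basicOpen h' ≤ V from inf_le_left.trans (X.basicOpen_le h)) r ^ n •
        (sres B (inf_le_left : X.basicOpen h ⊓ X.basicOpen h' ≤ _) (b h) -
          sres B (inf_le_right : X.basicOpen h ⊓ X.basicOpen h' ≤ _) (b h')) = 0) :
    ∃ (n : ℕ) (c : Γ(B, V)), ∀ h ∈ t,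
      sres B (X.basicOpen_le h) c = rres (X.basicOpen_le h) r ^ n • b h := by
  choose! n hn using hb
  let N := t.sup fun h => t.sup (n h)
  have hN : ∀ h ∈ t, ∀ h' ∈ t, n h h' ≤ N := fun h hh h' hh' =>
    (Finset.le_sup (f := n h) hh').trans (Finset.le_sup (f := fun h => t.sup (n h)) hh)
  obtain ⟨c, hc⟩ := section_glue (F := B) (U := V) (fun h : t => X.basicOpen h.1)
    (fun h => X.basicOpen_le _) (fun x hx => by
      obtain ⟨h, hh, hxh⟩ := ht x hx
      exact Opens.mem_iSup.2 ⟨⟨h, hh⟩, hxh⟩)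
    (fun h => rres (X.basicOpen_le h.1) r ^ N • b h.1) (fun h h' => by
      have := hn h.1 h.2 h'.1 h'.2
      obtain ⟨k, hk⟩ := Nat.exists_eq_add_of_le (hN h.1 h.2 h'.1 h'.2)
      rw [← sub_eq_zero, sres_smul, sres_smul, map_pow, map_pow, rres_rres, rres_rres, ← smul_sub,
        hk, pow_add, mul_comm, mul_smul, this, smul_zero])
  exact ⟨N, c, fun h hh => hc ⟨h, hh⟩⟩

theorem pow_smul_eq_zero_of_le {R M : Type*} [CommRing R] [AddCommGroup M] [Module R M] {r : R}
    {m : M} {n N : ℕ} (h : r ^ n • m = 0) (hN : n ≤ N) : r ^ N • m = 0 := by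
  rw [← Nat.sub_add_cancel hN, pow_add, mul_smul, h, smul_zero]

/-- Quasi-coherence is local. -/
theorem QCOn.of_local (h : ∀ x ∈ U, ∃ V : X.Opens, x ∈ V ∧ QCOn F V) : QCOn F U := by
  have cover : ∀ W : X.Opens, W ≤ U → IsAffineOpen W → ∃ t : Finset Γ(X, W),
      (∀ r ∈ t, QCOn F (X.basicOpen r)) ∧ ∀ x ∈ W, ∃ r ∈ t, x ∈ X.basicOpen r := by
    intro W hW hWa
    refine exists_finset_cover hWa (fun r => QCOn F (X.basicOpen r)) fun x hx => ?_
    obtain ⟨V, hxV, hV⟩ := h x (hW hx)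
    obtain ⟨r, hr, hxr⟩ := exists_basicOpen hWa hx hxV
    exact ⟨r, hV.mono hr, hxr⟩
  refine ⟨fun W hW hWa r s hs => ?_, fun W hW hWa r t => ?_⟩
  · obtain ⟨c, hc, hcov⟩ := cover W hW hWa
    have : ∀ f ∈ c, ∃ n : ℕ, rres (X.basicOpen_le f) r ^ n • sres F (X.basicOpen_le f) s = 0 := by
      intro f hf
      refine (hc f hf).exists_pow_smul_eq_zero (hWa.basicOpen f) le_rfl _ r rfl inf_le_left _ ?_
      have := congrArg (sres F (inf_le_right : X.basicOpen f ⊓ X.basicOpen r ≤ _)) hs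
      simpa using this
    choose! n hn using this
    refine ⟨c.sup n, section_ext fun x hx => ?_⟩
    obtain ⟨f, hf, hxf⟩ := hcov x hx
    refine ⟨_, X.basicOpen_le f, hxf, ?_⟩
    rw [map_zero, sres_smul, map_pow]
    exact pow_smul_eq_zero_of_le (hn f hf) (Finset.le_sup hf)
  · obtain ⟨c, hc, hcov⟩ := cover W hW hWa
    have : ∀ f ∈ c, ∃ (n : ℕ) (s : Γ(F, X.basicOpen f)),
        sres F (inf_le_left : X.basicOpen f ⊓ X.basicOpen r ≤ _) s =
          rres (show X.basicOpen f ⊓ X.basicOpen r ≤ W from inf_le_left.trans (X.basicOpen_le f)) r ^ n •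
            sres F (show X.basicOpen f ⊓ X.basicOpen r ≤ _ from inf_le_right) t := by
      intro f hf
      exact (hc f hf).exists_extend (hWa.basicOpen f) le_rfl (X.basicOpen_le f) r rfl inf_le_left _
    choose! n s hs using this
    -- One exponent for all members of the finite cover, so that the local extensions all restrict
    -- to the same section over D(r).
    let N := c.sup n
    have hs' : ∀ f ∈ c, sres F (inf_le_left : X.basicOpen f ⊓ X.basicOpen r ≤ _)
          (rres (X.basicOpen_le f) r ^ (N - n f) • s f) =
          rres (show X.basicOpen f ⊓ X.basicOpen r ≤ W from inf_le_left.trans (X.basicOpen_le f)) r ^ N •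
            sres F (show X.basicOpen f ⊓ X.basicOpen r ≤ _ from inf_le_right) t := by
      intro f hf
      rw [sres_smul, hs f hf, map_pow, rres_rres, smul_smul, ← pow_add,
        Nat.sub_add_cancel (Finset.le_sup hf)]
    -- Over D(f) ∩ D(g) ∩ D(r) both local extensions equal the restriction of r^N t, so their
    -- difference on D(f) ∩ D(g) is killed by a power of r.
    obtain ⟨m, b, hb⟩ := exists_glue_pow (B := F) r c hcov
      (fun f => rres (X.basicOpen_le f) r ^ (N - n f) • s f) (by
        intro f hf g hg
        refine ((hc f hf).mono inf_le_left).exists_pow_smul_eq_zero ?_ le_rfl _ r rfl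
          inf_le_left _ ?_
        · rw [← basicOpen_rres (X.basicOpen_le f)]
          exact (hWa.basicOpen f).basicOpen _
        · have h1 := congrArg (sres F (show X.basicOpen f ⊓ X.basicOpen g ⊓ X.basicOpen r ≤
            X.basicOpen f ⊓ X.basicOpen r from inf_le_inf_right _ inf_le_left)) (hs' f hf)
          have h2 := congrArg (sres F (show X.basicOpen f ⊓ X.basicOpen g ⊓ X.basicOpen r ≤
            X.basicOpen g ⊓ X.basicOpen r from inf_le_inf_right _ inf_le_right)) (hs' g hg)
          simp only [sres_smul, sres_sres, map_pow, rres_rres, map_sub] at h1 h2 ⊢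
          rw [h1, h2, sub_self])
    refine ⟨m + N, b, section_ext fun x hx => ?_⟩
    obtain ⟨f, hf, hxf⟩ := hcov x (X.basicOpen_le _ hx)
    refine ⟨X.basicOpen f ⊓ X.basicOpen r, inf_le_right, ⟨hxf, hx⟩, ?_⟩
    have h1 := congrArg (sres F (inf_le_left : X.basicOpen f ⊓ X.basicOpen r ≤ _)) (hb f hf)
    rw [sres_smul (h := inf_le_left), hs' f hf, sres_sres] at h1
    rw [sres_sres, h1, sres_smul, smul_smul, map_pow, map_pow, rres_rres, rres_rres, pow_add]

/-- Over an affine open, an epimorphism with quasi-coherent kernel is surjective on sections. -/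
theorem surjective_of_qcOn_kernel (hV : IsAffineOpen V) (hA : QCOn A V) (i : A ⟶ B) (g : B ⟶ C)
    (hi : ∀ V, Function.Injective (happ i V)) (hig : i ≫ g = 0)
    (hex : ∀ V (s : Γ(B, V)), happ g V s = 0 → ∃ a, happ i V a = s)
    (hg : LocSurj g) : Function.Surjective (happ g V) := by
  intro c
  -- The r for which r • c lifts form an ideal; it is the unit ideal once every point of V lies in
  -- D(r) for some member r.
  let I : Ideal Γ(X, V) :=
    { carrier := {r | ∃ b, happ g V b = r • c}
      zero_mem' := ⟨0, by simp⟩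
      add_mem' := fun {r r'} ⟨b, hb⟩ ⟨b', hb'⟩ => ⟨b + b', by rw [map_add, hb, hb', add_smul]⟩
      smul_mem' := fun a r ⟨b, hb⟩ => ⟨a • b, by rw [map_smul, hb, smul_smul, smul_eq_mul]⟩ }
  suffices I = ⊤ by
    obtain ⟨b, hb⟩ := (Ideal.eq_top_iff_one I).1 this
    exact ⟨b, by simpa using hb⟩
  have lift : ∀ x ∈ V, ∃ r : Γ(X, V), x ∈ X.basicOpen r ∧
      ∃ b, happ g _ b = sres C (X.basicOpen_le r) c := by
    intro x hx
    obtain ⟨W, hW, hxW, b, hb⟩ := hg V c x hx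
    obtain ⟨r, hr, hxr⟩ := exists_basicOpen hV hx hxW
    exact ⟨r, hxr, sres B hr b, by rw [happ_sres, hb, sres_sres]⟩
  refine ideal_eq_top hV I fun x hx => ?_
  obtain ⟨r, hxr, b, hb⟩ := lift x hx
  -- The exponent must be positive for D(r^(n+1)) to be D(r).
  suffices ∃ n : ℕ, r ^ (n + 1) ∈ I by
    obtain ⟨n, hn⟩ := this
    exact ⟨_, hn, by rwa [X.basicOpen_pow _ n.succ_pos]⟩
  obtain ⟨t, hlift, hcov⟩ := exists_finset_cover hV
    (fun h => ∃ b, happ g _ b = sres C (X.basicOpen_le h) c) fun x hx => by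
      obtain ⟨r, h1, h2⟩ := lift x hx
      exact ⟨r, h2, h1⟩
  -- Over D(h) ∩ D(r) a lift on D(h) differs from b by a section of A. A power of r times this
  -- difference extends to D(h); subtracting the extension makes the modified lift restrict to r^n b
  -- without altering its image in C.
  have key : ∀ h ∈ t, ∃ (n : ℕ) (b' : Γ(B, X.basicOpen h)),
      happ g _ b' = rres (X.basicOpen_le h) r ^ n • sres C (X.basicOpen_le h) c ∧
      sres B (inf_le_left : X.basicOpen h ⊓ X.basicOpen r ≤ _) b' =
        rres (show X.basicOpen h ⊓ X.basicOpen r ≤ V from inf_le_left.trans (X.basicOpen_le h)) r ^ n •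
          sres B (show X.basicOpen h ⊓ X.basicOpen r ≤ _ from inf_le_right) b := by
    intro h hh
    obtain ⟨b', hb'⟩ := hlift h hh
    obtain ⟨a, ha⟩ := hex (X.basicOpen h ⊓ X.basicOpen r)
      (sres B inf_le_left b' - sres B inf_le_right b)
      (by rw [map_sub, happ_sres, happ_sres, hb, hb', sres_sres, sres_sres, sub_self])
    obtain ⟨n, a', ha'⟩ := (hA.mono (X.basicOpen_le h)).exists_extend (hV.basicOpen h) le_rfl
      (X.basicOpen_le h) r rfl inf_le_left a
    refine ⟨n, rres (X.basicOpen_le h) r ^ n • b' - happ i _ a', ?_, ?_⟩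
    · rw [map_sub, ← happ_comp, hig, happ_zero, sub_zero, map_smul, hb']
    · rw [map_sub, sres_smul, ← happ_sres, ha', map_smul, ha, map_pow, rres_rres, smul_sub,
        sub_sub_cancel]
  choose! n b' hb' hbr using key
  let N := t.sup n
  have h1 : ∀ h ∈ t, happ g _ (rres (X.basicOpen_le h) r ^ (N - n h) • b' h) =
      rres (X.basicOpen_le h) r ^ N • sres C (X.basicOpen_le h) c := by
    intro h hh
    rw [map_smul, hb' h hh, smul_smul, ← pow_add, Nat.sub_add_cancel (Finset.le_sup hh)]
  have h2 : ∀ h ∈ t, sres B (inf_le_left : X.basicOpen h ⊓ X.basicOpen r ≤ _)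
      (rres (X.basicOpen_le h) r ^ (N - n h) • b' h) =
        rres (show X.basicOpen h ⊓ X.basicOpen r ≤ V from inf_le_left.trans (X.basicOpen_le h)) r ^ N •
          sres B (show X.basicOpen h ⊓ X.basicOpen r ≤ _ from inf_le_right) b := by
    intro h hh
    rw [sres_smul, hbr h hh, map_pow, rres_rres, smul_smul, ← pow_add,
      Nat.sub_add_cancel (Finset.le_sup hh)]
  -- On overlaps the modified lifts have the same image in C, so they differ by a section of A. It
  -- vanishes over D(r), since there both are r^N b, and is therefore killed by a power of r.
  obtain ⟨m, d, hd⟩ := exists_glue_pow (B := B) r t hcov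
    (fun h => rres (X.basicOpen_le h) r ^ (N - n h) • b' h) (by
      intro h hh h' hh'
      obtain ⟨a, ha⟩ := hex (X.basicOpen h ⊓ X.basicOpen h')
        (sres B inf_le_left (rres (X.basicOpen_le h) r ^ (N - n h) • b' h) -
          sres B inf_le_right (rres (X.basicOpen_le h') r ^ (N - n h') • b' h'))
        (by rw [map_sub, happ_sres, happ_sres, h1 h hh, h1 h' hh', sres_smul, sres_smul,
              sres_sres, sres_sres, map_pow, map_pow, rres_rres, rres_rres, sub_self])
      rw [← ha]
      obtain ⟨k, hk⟩ := (hA.mono (inf_le_left.trans (X.basicOpen_le h))).exists_pow_smul_eq_zero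
        (by
          rw [← basicOpen_rres (X.basicOpen_le h)]
          exact (hV.basicOpen h).basicOpen _) le_rfl (inf_le_left.trans (X.basicOpen_le h)) r
        rfl inf_le_left a (hi _ (by
          have e1 := congrArg (sres B (show X.basicOpen h ⊓ X.basicOpen h' ⊓ X.basicOpen r ≤
            X.basicOpen h ⊓ X.basicOpen r from inf_le_inf_right _ inf_le_left)) (h2 h hh)
          have e2 := congrArg (sres B (show X.basicOpen h ⊓ X.basicOpen h' ⊓ X.basicOpen r ≤
            X.basicOpen h' ⊓ X.basicOpen r from inf_le_inf_right _ inf_le_right)) (h2 h' hh')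
          simp only [happ_sres, ha, map_zero, sres_smul, sres_sres, map_pow, rres_rres, map_sub]
            at e1 e2 ⊢
          rw [e1, e2, sub_self]))
      exact ⟨k, by rw [← map_smul, hk, map_zero]⟩)
  have hmem : r ^ (m + N) ∈ I := by
    refine ⟨d, section_ext fun x hx => ?_⟩
    obtain ⟨h, hh, hxh⟩ := hcov x hx
    refine ⟨_, X.basicOpen_le h, hxh, ?_⟩
    rw [← happ_sres, hd h hh, map_smul, h1 h hh, smul_smul, sres_smul, map_pow, pow_add]
  exact ⟨m + N, by rw [pow_succ']; exact I.mul_mem_left _ hmem⟩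

/-- Sections of C over W and over D(r), both affine, lift to B. A lift of a section vanishing on
D(r) lies there in A; correcting r^n times it by an extension from A gives a section of B vanishing
on D(r), to which annihilation in B applies. -/
theorem QCOn.of_cokernel (hA : QCOn A U) (hB : QCOn B U) (i : A ⟶ B) (g : B ⟶ C)
    (hi : ∀ V, Function.Injective (happ i V)) (hig : i ≫ g = 0)
    (hex : ∀ V (s : Γ(B, V)), happ g V s = 0 → ∃ a, happ i V a = s)
    (hg : LocSurj g) : QCOn C U where
  ann W hW hWa r s hs := by
    obtain ⟨b, rfl⟩ := surjective_of_qcOn_kernel hWa (hA.mono hW) i g hi hig hex hg s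
    obtain ⟨a, ha⟩ := hex _ (sres B (X.basicOpen_le r) b) (by rw [happ_sres, hs])
    obtain ⟨n, a', ha'⟩ := hA.ext W hW hWa r a
    obtain ⟨m, hm⟩ := hB.ann W hW hWa r (r ^ n • b - happ i W a') (by
      rw [map_sub, sres_smul, ← happ_sres, ha', map_smul, ha, map_pow, sub_self])
    refine ⟨m + n, ?_⟩
    have := congrArg (happ g W) hm
    rwa [map_smul, map_sub, ← happ_comp, hig, happ_zero, sub_zero, map_smul, map_zero, smul_smul,
      ← pow_add] at this
  ext W hW hWa r t := by
    obtain ⟨b, rfl⟩ := surjective_of_qcOn_kernel (hWa.basicOpen r)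
      (hA.mono ((X.basicOpen_le r).trans hW)) i g hi hig hex hg t
    obtain ⟨n, s, hs⟩ := hB.ext W hW hWa r b
    exact ⟨n, happ g W s, by rw [← happ_sres, hs, map_smul]⟩

/-- The cokernel of a morphism of quasi-coherent modules is quasi-coherent. -/
theorem QCOn.of_locExact (hA : QCOn A U) (hB : QCOn B U) (f : A ⟶ B) (g : B ⟶ C)
    (hfg : f ≫ g = 0) (hex : LocExact f g) (hg : LocSurj g) : QCOn C U := by
  -- The kernel of g is the image of f, that is, the quotient of A by the kernel of f; two
  -- applications of the case of an injective first map then suffice.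
  have hK : QCOn (kernel g) U := by
    have hfac : kernel.lift g f hfg ≫ kernel.ι g = f := kernel.lift_ι g f hfg
    refine (hA.kernel hB f).of_cokernel hA (kernel.ι f) (kernel.lift g f hfg)
      (injective_of_mono _) ?_ ?_ ?_
    · rw [← cancel_mono (kernel.ι g), Category.assoc, hfac, kernel.condition, zero_comp]
    · intro V s hs
      refine exists_happ_kernel_ι_eq f s ?_
      rw [← hfac, happ_comp, hs, map_zero]
    · intro V t x hx
      obtain ⟨W, hW, hxW, s, hs⟩ := hex V (happ (kernel.ι g) V t) (happ_kernel_ι_eq_zero g t) x hx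
      refine ⟨W, hW, hxW, s, injective_of_mono (kernel.ι g) W ?_⟩
      rw [← happ_comp, hfac, hs, happ_sres]
  exact hK.of_cokernel hB (kernel.ι g) g (injective_of_mono _) (kernel.condition g)
    (fun _ => exists_happ_kernel_ι_eq g) hg

end QuasiCoherent

/-! ### Bases, free modules and the module of homomorphisms -/

section Basis

variable {X : Scheme.{u}} {E F G : X.Modules} {U V W : X.Opens} {ι : Type} [Fintype ι]

/-- A family of sections over `U` which is a basis over every open subset of `U`. -/
def IsBasis (E : X.Modules) (U : X.Opens) (e : ι → Γ(E, U)) : Prop :=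
  ∀ (W : X.Opens) (h : W ≤ U),
    Function.Bijective fun a : ι → Γ(X, W) => ∑ i, a i • sres E h (e i)

theorem IsBasis.res {e : ι → Γ(E, U)} (he : IsBasis E U e) (h : V ≤ U) :
    IsBasis E V fun i => sres E h (e i) := by
  intro W hW
  simpa using he W (hW.trans h)

/-- The coordinates with respect to a basis. -/
noncomputable def IsBasis.coord {e : ι → Γ(E, U)} (he : IsBasis E U e) (h : W ≤ U) :
    Γ(E, W) ≃ₗ[Γ(X, W)] (ι → Γ(X, W)) :=
  (LinearEquiv.ofBijective (Fintype.linearCombination Γ(X, W) fun i => sres E h (e i))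
    (he W h)).symm

theorem IsBasis.sum_coord {e : ι → Γ(E, U)} (he : IsBasis E U e) (h : W ≤ U) (s : Γ(E, W)) :
    ∑ i, he.coord h s i • sres E h (e i) = s :=
  LinearEquiv.apply_symm_apply (LinearEquiv.ofBijective (Fintype.linearCombination Γ(X, W)
    fun i => sres E h (e i)) _) s

theorem IsBasis.coord_sum {e : ι → Γ(E, U)} (he : IsBasis E U e) (h : W ≤ U) (a : ι → Γ(X, W)) :
    he.coord h (∑ i, a i • sres E h (e i)) = a :=
  LinearEquiv.symm_apply_apply (LinearEquiv.ofBijective (Fintype.linearCombination Γ(X, W)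
    fun i => sres E h (e i)) _) a

theorem IsBasis.coord_res {e : ι → Γ(E, U)} (he : IsBasis E U e) (h : W ≤ U) (h' : V ≤ W)
    (s : Γ(E, W)) (i : ι) : he.coord (h'.trans h) (sres E h' s) i = rres h' (he.coord h s i) := by
  conv_lhs => rw [← he.sum_coord h s]
  rw [map_sum]
  simp only [sres_smul, sres_sres]
  rw [he.coord_sum]

/-- Both conditions are checked coordinatewise; finiteness of the index set provides a common
exponent. -/
theorem QCOn.of_equiv (hG : QCOn G U)
    (θ : ∀ W : X.Opens, W ≤ U → (Γ(E, W) ≃ₗ[Γ(X, W)] (ι → Γ(G, W))))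
    (hθ : ∀ (W W' : X.Opens) (h : W ≤ U) (h' : W' ≤ W) (s : Γ(E, W)) (i : ι),
      θ W' (h'.trans h) (sres E h' s) i = sres G h' (θ W h s i)) : QCOn E U where
  ann W hW hWa r s hs := by
    have : ∀ i, ∃ n : ℕ, r ^ n • θ W hW s i = 0 := fun i =>
      hG.ann W hW hWa r _ (by rw [← hθ, hs, map_zero]; rfl)
    choose n hn using this
    refine ⟨Finset.univ.sup n, (θ W hW).injective (funext fun i => ?_)⟩
    rw [map_smul, map_zero]
    exact pow_smul_eq_zero_of_le (hn i) (Finset.le_sup (Finset.mem_univ i))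
  ext W hW hWa r t := by
    have : ∀ i, ∃ (n : ℕ) (s : Γ(G, W)), sres G (X.basicOpen_le r) s =
        rres (X.basicOpen_le r) r ^ n • θ _ ((X.basicOpen_le r).trans hW) t i := fun i =>
      hG.ext W hW hWa r _
    choose n s hs using this
    refine ⟨Finset.univ.sup n, (θ W hW).symm fun i => r ^ (Finset.univ.sup n - n i) • s i,
      (θ _ ((X.basicOpen_le r).trans hW)).injective (funext fun i => ?_)⟩
    rw [hθ _ _ hW, LinearEquiv.apply_symm_apply, sres_smul, hs, map_smul, map_pow, smul_smul,
      ← pow_add, Nat.sub_add_cancel (Finset.le_sup (Finset.mem_univ i))]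
    rfl

/-- The structure sheaf as a module. -/
noncomputable abbrev unitModule (X : Scheme.{u}) : X.Modules := SheafOfModules.unit X.ringCatSheaf

/-- The sections of the structure sheaf as a module. -/
noncomputable def unitEquiv (U : X.Opens) : Γ(unitModule X, U) ≃ₗ[Γ(X, U)] Γ(X, U) where
  toFun a := a
  invFun a := a
  map_add' _ _ := rfl
  map_smul' _ _ := rfl

@[simp]
theorem unitEquiv_sres (h : V ≤ U) (a : Γ(unitModule X, U)) :
    unitEquiv V (sres (unitModule X) h a) = rres h (unitEquiv U a) := rfl

@[simp]
theorem sres_unitEquiv_symm (h : V ≤ U) (a : Γ(X, U)) :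
    sres (unitModule X) h ((unitEquiv U).symm a) = (unitEquiv V).symm (rres h a) := rfl

theorem qcOn_unitModule (U : X.Opens) : QCOn (unitModule X) U where
  ann W _ hWa r s hs := by
    let : Algebra Γ(X, W) Γ(X, X.basicOpen r) := (rres (X.basicOpen_le r)).toAlgebra
    have : IsLocalization (Submonoid.powers r) Γ(X, X.basicOpen r) :=
      hWa.isLocalization_basicOpen r
    have h0 : algebraMap Γ(X, W) Γ(X, X.basicOpen r) (unitEquiv W s) =
        algebraMap Γ(X, W) Γ(X, X.basicOpen r) 0 := by
      rw [map_zero]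
      exact (congrArg (unitEquiv _) hs).trans (map_zero _)
    obtain ⟨⟨_, n, rfl⟩, hn⟩ := (IsLocalization.eq_iff_exists (Submonoid.powers r)
      Γ(X, X.basicOpen r)).1 h0
    refine ⟨n, (unitEquiv W).injective ?_⟩
    rw [map_smul, map_zero]
    exact hn.trans (mul_zero _)
  ext W _ hWa r t := by
    let : Algebra Γ(X, W) Γ(X, X.basicOpen r) := (rres (X.basicOpen_le r)).toAlgebra
    have : IsLocalization (Submonoid.powers r) Γ(X, X.basicOpen r) :=
      hWa.isLocalization_basicOpen r
    obtain ⟨⟨s, ⟨_, n, rfl⟩⟩, hn⟩ := IsLocalization.surj (Submonoid.powers r)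
      (S := Γ(X, X.basicOpen r)) (unitEquiv _ t)
    refine ⟨n, (unitEquiv W).symm s, (unitEquiv _).injective ?_⟩
    rw [sres_unitEquiv_symm, LinearEquiv.apply_symm_apply, map_smul]
    refine Eq.trans hn.symm ?_
    rw [mul_comm]
    exact congrArg (· * _) (map_pow (rres (X.basicOpen_le r)) r n)

theorem IsBasis.qcOn {e : ι → Γ(E, U)} (he : IsBasis E U e) : QCOn E U :=
  (qcOn_unitModule U).of_equiv (fun _ h => he.coord h) fun _ _ h h' s i => he.coord_res h h' s i

/-- The morphism `𝒪_X ⟶ F` given by a global section. -/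
noncomputable def ofSection (s : Γ(F, ⊤)) : unitModule X ⟶ F :=
  mkHom (fun U => ((LinearMap.toSpanSingleton Γ(X, U) Γ(F, U) (sres F le_top s)).comp
      (unitEquiv U).toLinearMap).toAddMonoidHom)
    (fun U a b => ((LinearMap.toSpanSingleton Γ(X, U) Γ(F, U) (sres F le_top s)).comp
      (unitEquiv U).toLinearMap).map_smul a b)
    (fun U V h b => by
      change unitEquiv V (sres _ h b) • sres F le_top s = sres F h (unitEquiv U b • sres F le_top s)
      rw [sres_smul, sres_sres, unitEquiv_sres])

@[simp]
theorem happ_ofSection (s : Γ(F, ⊤)) (a : Γ(unitModule X, U)) :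
    happ (ofSection s) U a = unitEquiv U a • sres F le_top s := rfl

theorem happ_unitModule (φ : unitModule X ⟶ F) (a : Γ(unitModule X, U)) :
    happ φ U a = unitEquiv U a • sres F le_top (happ φ ⊤ ((unitEquiv ⊤).symm 1)) := by
  rw [← happ_sres, ← map_smul]
  congr 1
  apply (unitEquiv U).injective
  rw [sres_unitEquiv_symm, map_smul, LinearEquiv.apply_symm_apply, map_one, smul_eq_mul, mul_one]

variable {n : ℕ}

/-- The inclusion of a summand into a free module. -/
noncomputable def freeι (i : Fin n) : unitModule X ⟶ freeModule X n :=
  SheafOfModules.ιFree (R := X.ringCatSheaf) (ULift.up.{u} i)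

/-- The morphism out of a free module with given components. -/
noncomputable def freeDesc (f : Fin n → (unitModule X ⟶ F)) : freeModule X n ⟶ F :=
  Cofan.IsColimit.desc (SheafOfModules.isColimitFreeCofan (R := X.ringCatSheaf) (ULift.{u} (Fin n)))
    (fun i => f i.down)

@[simp]
theorem freeι_freeDesc (f : Fin n → (unitModule X ⟶ F)) (i : Fin n) :
    freeι i ≫ freeDesc f = f i :=
  Cofan.IsColimit.fac (SheafOfModules.isColimitFreeCofan (R := X.ringCatSheaf) (ULift.{u} (Fin n)))
    (fun i => f i.down) (ULift.up i)

theorem freeModule_hom_ext {φ ψ : freeModule X n ⟶ F}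
    (h : ∀ i, freeι i ≫ φ = freeι i ≫ ψ) : φ = ψ :=
  Cofan.IsColimit.hom_ext
    (SheafOfModules.isColimitFreeCofan (R := X.ringCatSheaf) (ULift.{u} (Fin n))) _ _
    (fun i => h i.down)

/-- The projection of a free module to a summand. -/
noncomputable def freeπ (i : Fin n) : freeModule X n ⟶ unitModule X :=
  freeDesc fun j => if j = i then 𝟙 _ else 0

theorem sum_freeπ_freeι : ∑ i : Fin n, freeπ i ≫ freeι i = 𝟙 (freeModule X n) := by
  refine freeModule_hom_ext fun j => ?_
  rw [Preadditive.comp_sum, Category.comp_id, Finset.sum_eq_single j]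
  · rw [← Category.assoc, freeπ, freeι_freeDesc, if_pos rfl, Category.id_comp]
  · intro i _ hij
    rw [← Category.assoc, freeπ, freeι_freeDesc, if_neg hij.symm, zero_comp]
  · simp

/-- The standard basis of a free module. -/
noncomputable def freeBasis (i : Fin n) : Γ(freeModule X n, ⊤) :=
  happ (freeι i) ⊤ ((unitEquiv ⊤).symm 1)

theorem sum_freeπ (s : Γ(freeModule X n, U)) :
    ∑ i, unitEquiv U (happ (freeπ i) U s) • sres _ le_top (freeBasis i) = s := by
  have := congrArg (fun φ => happ φ U s) (sum_freeπ_freeι (X := X) (n := n))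
  simp only [happ_id] at this
  rw [happ_sum] at this
  conv_rhs => rw [← this]
  exact Finset.sum_congr rfl fun i _ => (happ_unitModule (freeι i) (happ (freeπ i) U s)).symm

theorem freeπ_freeBasis (i j : Fin n) :
    happ (freeπ i) ⊤ (freeBasis j) = (unitEquiv (X := X) ⊤).symm (if j = i then 1 else 0) := by
  rw [freeBasis, ← happ_comp, freeπ, freeι_freeDesc]
  split_ifs <;> simp

theorem isBasis_freeBasis : IsBasis (freeModule X n) ⊤ freeBasis := by
  intro W h
  refine ⟨fun a b hab => funext fun j => ?_, fun s => ⟨_, sum_freeπ s⟩⟩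
  have key : ∀ a : Fin n → Γ(X, W), unitEquiv W
      (happ (freeπ j) W (∑ i, a i • sres (freeModule X n) h (freeBasis i))) = a j := by
    intro a
    rw [map_sum, map_sum, Finset.sum_eq_single j]
    · rw [map_smul, happ_sres, freeπ_freeBasis, if_pos rfl, sres_unitEquiv_symm, map_smul]
      simp
    · intro i _ hij
      rw [map_smul, happ_sres, freeπ_freeBasis, if_neg hij]
      simp
    · simp
  rw [← key a, ← key b]
  exact congrArg (fun s => unitEquiv W (happ (freeπ j) W s)) hab

theorem qcOn_freeModule (n : ℕ) (U : X.Opens) : QCOn (freeModule X n) U :=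
  isBasis_freeBasis.qcOn.mono le_top

theorem happ_freeDesc (f : Fin n → (unitModule X ⟶ F)) (i : Fin n) :
    happ (freeDesc f) ⊤ (freeBasis i) = happ (f i) ⊤ ((unitEquiv ⊤).symm 1) := by
  rw [freeBasis, ← happ_comp, freeι_freeDesc]

theorem happ_free (φ : freeModule X n ⟶ F) (s : Γ(freeModule X n, U)) :
    happ φ U s = ∑ i, unitEquiv U (happ (freeπ i) U s) • sres F le_top (happ φ ⊤ (freeBasis i)) := by
  conv_lhs => rw [← sum_freeπ s]
  simp [map_sum]

theorem IsBasis.of_isIso (φ : E ⟶ F) [IsIso φ] {e : ι → Γ(E, U)} (he : IsBasis E U e) :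
    IsBasis F U fun i => happ φ U (e i) := by
  intro W h
  have h1 : Function.Bijective (happ φ W) :=
    ⟨injective_of_mono φ W, surjective_of_isIso φ W⟩
  convert h1.comp (he W h) using 1
  funext a
  simp [map_sum]

theorem isIso_freeDesc {e : Fin n → Γ(F, ⊤)} (he : IsBasis F ⊤ e) :
    IsIso (freeDesc fun i => ofSection (e i)) := by
  refine isIso_of_bijective fun U => ?_
  have h1 := he U le_top
  have h2 := isBasis_freeBasis (X := X) (n := n) U le_top
  rw [← Function.Bijective.of_comp_iff _ h2]
  convert h1 using 1
  funext a
  simp [map_sum, happ_freeDesc, happ_ofSection]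

end Basis

/-! ### Local triviality, local generators and coherence on sections -/

section LocalStructure

variable {X : Scheme.{u}} {E F G : X.Modules} {U V W : X.Opens}

theorem exists_image_eq {U W : X.Opens} (h : W ≤ U) :
    ∃ W' : (U : Scheme.{u}).Opens, U.ι ''ᵁ W' = W :=
  ⟨U.ι ⁻¹ᵁ W, by simpa [Scheme.Hom.image_preimage_eq_opensRange_inf] using h⟩

theorem smul_restrict {U : X.Opens} {V : (U : Scheme.{u}).Opens} (a : Γ((U : Scheme.{u}), V))
    (s : Γ(F, U.ι ''ᵁ V)) :
    ((a • (show Γ(F.restrict U.ι, V) from s) : Γ(F.restrict U.ι, V)) : Γ(F, U.ι ''ᵁ V)) =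
      ((U.ι.appIso V).inv.hom a • s : Γ(F, U.ι ''ᵁ V)) := rfl

theorem appIso_inv_bijective (U : X.Opens) (V : (U : Scheme.{u}).Opens) :
    Function.Bijective (U.ι.appIso V).inv.hom :=
  ConcreteCategory.bijective_of_isIso (U.ι.appIso V).inv

theorem appIso_inv_rres {V W : (U : Scheme.{u}).Opens} (h : W ≤ V)
    (a : Γ((U : Scheme.{u}), V)) :
    (U.ι.appIso W).inv.hom (rres h a) = rres (U.ι.image_mono h) ((U.ι.appIso V).inv.hom a) := by
  simp only [Scheme.Opens.ι_appIso]
  rfl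

/-- The modules of sections are literally the same; only the scalars differ, by the ring isomorphism
`appIso`. This carries freeness between the scheme U and the open subsets of X. -/
theorem isBasis_restrict_iff {ι : Type} [Fintype ι] {V : (U : Scheme.{u}).Opens}
    (e : ι → Γ(E, U.ι ''ᵁ V)) :
    IsBasis (E.restrict U.ι) V e ↔ IsBasis E (U.ι ''ᵁ V) e := by
  have key : ∀ (W : (U : Scheme.{u}).Opens) (h : W ≤ V),
      (fun a : ι → Γ((U : Scheme.{u}), W) => ∑ i, a i • sres (E.restrict U.ι) h (e i)) =
      (fun a : ι → Γ(X, U.ι ''ᵁ W) => ∑ i, a i • sres E (U.ι.image_mono h) (e i)) ∘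
        fun a i => (U.ι.appIso W).inv.hom (a i) := fun _ _ => rfl
  have hb : ∀ W, Function.Bijective fun (a : ι → Γ((U : Scheme.{u}), W)) i =>
      (U.ι.appIso W).inv.hom (a i) := fun W =>
    Function.Bijective.piMap fun _ => appIso_inv_bijective U W
  constructor
  · intro H W hW
    obtain ⟨W', rfl⟩ := exists_image_eq (hW.trans (U.ι_image_le V))
    have hW' : W' ≤ V := (U.ι.image_le_image_iff _ _).1 hW
    have := H W' hW'
    rw [key] at this
    exact (Function.Bijective.of_comp_iff _ (hb W')).1 this
  · intro H W hW
    rw [key]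
    exact (H _ (U.ι.image_mono hW)).comp (hb W)

theorem IsLocallyFreeOfFiniteRank.exists_isBasis (hE : IsLocallyFreeOfFiniteRank E) (x : X) :
    ∃ (U : X.Opens) (n : ℕ) (e : Fin n → Γ(E, U)), x ∈ U ∧ IsBasis E U e := by
  obtain ⟨U, n, hx, ⟨φ⟩⟩ := hE x
  have h := (isBasis_restrict_iff (E := E) (V := ⊤) _).1 (isBasis_freeBasis.of_isIso φ.inv)
  exact ⟨U.ι ''ᵁ ⊤, n, _, ⟨⟨x, hx⟩, trivial, rfl⟩, h⟩

theorem isLocallyFreeOfFiniteRank_of_isBasis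
    (h : ∀ x : X, ∃ (U : X.Opens) (n : ℕ) (e : Fin n → Γ(E, U)), x ∈ U ∧ IsBasis E U e) :
    IsLocallyFreeOfFiniteRank E := by
  intro x
  obtain ⟨U, n, e, hx, he⟩ := h x
  have he' := (isBasis_restrict_iff (E := E) (U := U) (V := ⊤) _).2
    (he.res (U.ι_image_le ⊤))
  have := isIso_freeDesc (F := E.restrict U.ι) he'
  exact ⟨U, n, hx, ⟨(@asIso _ _ _ _ _ this).symm⟩⟩

theorem IsLineBundle.exists_isBasis (hE : IsLineBundle E) (x : X) :
    ∃ (U : X.Opens) (e : Fin 1 → Γ(E, U)), x ∈ U ∧ IsBasis E U e := by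
  obtain ⟨U, hx, ⟨φ⟩⟩ := hE x
  have h := (isBasis_restrict_iff (E := E) (V := ⊤) _).1 (isBasis_freeBasis.of_isIso φ.inv)
  exact ⟨U.ι ''ᵁ ⊤, _, ⟨⟨x, hx⟩, trivial, rfl⟩, h⟩

theorem IsLocallyFreeOfFiniteRank.qcOn (hE : IsLocallyFreeOfFiniteRank E) : QCOn E ⊤ :=
  QCOn.of_local fun x _ => by
    obtain ⟨U, n, e, hx, he⟩ := hE.exists_isBasis x
    exact ⟨U, hx, he.qcOn⟩

theorem isAffineOpen_image_iff {V : (U : Scheme.{u}).Opens} :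
    IsAffineOpen (U.ι ''ᵁ V) ↔ IsAffineOpen V := by
  exact U.ι.isAffineOpen_iff_of_isOpenImmersion

theorem QCOn.of_restrict {V : (U : Scheme.{u}).Opens} (h : QCOn (F.restrict U.ι) V) :
    QCOn F (U.ι ''ᵁ V) := by
  have hD : ∀ (W : (U : Scheme.{u}).Opens) (a : Γ((U : Scheme.{u}), W)),
      U.ι ''ᵁ (U : Scheme.{u}).basicOpen a = X.basicOpen ((U.ι.appIso W).inv.hom a) :=
    fun W a => Scheme.image_basicOpen U.ι a
  refine ⟨fun W hW hWa r s hs => ?_, fun W hW hWa r t => ?_⟩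
  · obtain ⟨W, rfl⟩ := exists_image_eq (hW.trans (U.ι_image_le V))
    obtain ⟨r, rfl⟩ := (appIso_inv_bijective U W).2 r
    obtain ⟨n, hn⟩ := h.ann W ((U.ι.image_le_image_iff _ _).1 hW)
      (isAffineOpen_image_iff.1 hWa) r s (by
        have := congrArg (sres F (hD W r).le) hs
        rwa [sres_sres, map_zero] at this)
    refine ⟨n, ?_⟩
    rw [← map_pow]
    exact hn
  · obtain ⟨W, rfl⟩ := exists_image_eq (hW.trans (U.ι_image_le V))
    obtain ⟨r, rfl⟩ := (appIso_inv_bijective U W).2 r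
    obtain ⟨n, s, hs⟩ := h.ext W ((U.ι.image_le_image_iff _ _).1 hW)
      (isAffineOpen_image_iff.1 hWa) r (sres F (hD W r).le t)
    refine ⟨n, s, ?_⟩
    have := congrArg (sres F (hD W r).ge) hs
    refine (sres_sres (F := F) (U.ι.image_mono ((U : Scheme.{u}).basicOpen_le r)) (hD W r).ge
      s).symm.trans (this.trans ?_)
    rw [smul_restrict, sres_smul, sres_sres, sres_self, map_pow, map_pow, appIso_inv_rres,
      rres_rres]

/-- Sections generating `F` near every point of `U`. -/
def Generates {ι : Type*} [Fintype ι] (F : X.Modules) (U : X.Opens) (σ : ι → Γ(F, U)) : Prop :=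
  ∀ (W : X.Opens) (h : W ≤ U) (t : Γ(F, W)), ∀ x ∈ W, ∃ (V : X.Opens) (hV : V ≤ W), x ∈ V ∧
    ∃ a : ι → Γ(X, V), ∑ i, a i • sres F (hV.trans h) (σ i) = sres F hV t

end LocalStructure

/-- Translates an arbitrary finite index type of generators into `Fin n`. -/
theorem exists_epi_free_of_generatingSections {X : Scheme.{u}} {F : X.Modules}
    (σ : SheafOfModules.GeneratingSections (R := X.ringCatSheaf) F) [σ.IsFiniteType] :
    ∃ (n : ℕ) (π : freeModule X n ⟶ F), Epi π := by
  have : Finite σ.I := SheafOfModules.GeneratingSections.IsFiniteType.finite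
  obtain ⟨n, ⟨e⟩⟩ := Finite.exists_equiv_fin σ.I
  let f : Fin n → (unitModule X ⟶ F) := fun i =>
    SheafOfModules.ιFree (R := X.ringCatSheaf) (e.symm i) ≫ σ.π
  let r : SheafOfModules.free (R := X.ringCatSheaf) σ.I ⟶ freeModule X n :=
    Cofan.IsColimit.desc (SheafOfModules.isColimitFreeCofan (R := X.ringCatSheaf) σ.I)
      (fun i => freeι (e i))
  have hr : ∀ i, SheafOfModules.ιFree (R := X.ringCatSheaf) i ≫ r = freeι (e i) := fun i =>
    Cofan.IsColimit.fac (SheafOfModules.isColimitFreeCofan (R := X.ringCatSheaf) σ.I) _ i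
  have hπ : r ≫ freeDesc f = σ.π := by
    refine Cofan.IsColimit.hom_ext
      (SheafOfModules.isColimitFreeCofan (R := X.ringCatSheaf) σ.I) _ _ fun i => ?_
    refine (Category.assoc _ _ _).symm.trans ?_
    refine (congrArg (· ≫ freeDesc f) (hr i)).trans ?_
    refine (freeι_freeDesc f (e i)).trans ?_
    simp only [f, Equiv.symm_apply_apply]
    rfl
  have : @Epi X.Modules _ _ _ σ.π := σ.epi
  exact ⟨n, freeDesc f, epi_of_epi_fac hπ⟩

theorem epi_comp_iso {C : Type*} [Category* C] {A B D : C} (f : A ⟶ B) (hf : Epi f) (k : B ≅ D) :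
    Epi (f ≫ k.hom) := inferInstance

/-- Finite type is phrased over the slice site of W. The equivalence with modules on the scheme W
preserves colimits and the unit, so it transports generating sections. -/
theorem exists_epi_free_of_over {X : Scheme.{u}} {F : X.Modules} (W : X.Opens)
    (σ : SheafOfModules.GeneratingSections
      (SheafOfModules.over (R := X.ringCatSheaf) F W)) [σ.IsFiniteType] :
    ∃ (n : ℕ) (π : freeModule W n ⟶ F.restrict W.ι), Epi π := by
  let Φ : SheafOfModules (X.ringCatSheaf.over W) ⥤
      SheafOfModules (W : Scheme.{u}).ringCatSheaf := (Scheme.Modules.overEquiv W).functor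
  have hΦ : PreservesColimitsOfSize.{u, u} Φ :=
    (Scheme.Modules.overEquiv W).toAdjunction.leftAdjoint_preservesColimits
  let η : SheafOfModules.unit (W : Scheme.{u}).ringCatSheaf ≅
      Φ.obj (SheafOfModules.unit (X.ringCatSheaf.over W)) :=
    (Scheme.Modules.restrictUnitIso W.ι).symm ≪≫
      ((Scheme.Modules.overFunctorEquiv W).app (unitModule X)).symm
  let g := SheafOfModules.GeneratingSections.map σ Φ η
  have hg : g.IsFiniteType := inferInstance
  obtain ⟨n, π, hπ⟩ := exists_epi_free_of_generatingSections (F := Φ.obj _) g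
  let k : @Iso (W : Scheme.{u}).Modules _
      (Φ.obj (SheafOfModules.over (R := X.ringCatSheaf) F W)) (F.restrict W.ι) :=
    (Scheme.Modules.overFunctorEquiv W).app F
  exact ⟨n, π ≫ k.hom, epi_comp_iso π hπ k⟩

theorem exists_epi_free {X : Scheme.{u}} {F : X.Modules} (hF : IsOfFiniteType F) (x : X) :
    ∃ (U : X.Opens) (n : ℕ) (π : freeModule U n ⟶ F.restrict U.ι), x ∈ U ∧ Epi π := by
  have hF' : SheafOfModules.IsFiniteType (R := X.ringCatSheaf) F := hF
  obtain ⟨σ, hσ⟩ := hF'.exists_localGeneratorsData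
  have cov := σ.coversTop
  rw [Opens.coversTop_iff] at cov
  have hx : x ∈ (⊤ : X.Opens) := trivial
  rw [← cov] at hx
  obtain ⟨i, hi⟩ := Opens.mem_iSup.1 hx
  have := hσ.isFiniteType i
  obtain ⟨n, π, hπ⟩ := exists_epi_free_of_over (F := F) (σ.X i) (σ.generators i)
  exact ⟨σ.X i, n, π, hi, hπ⟩

/-- `F` is locally generated by finitely many sections. -/
def LocallyFinitelyGenerated {X : Scheme.{u}} (F : X.Modules) : Prop :=
  ∀ x : X, ∃ (U : X.Opens) (n : ℕ) (σ : Fin n → Γ(F, U)), x ∈ U ∧ Generates F U σ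

theorem IsOfFiniteType.locallyFinitelyGenerated {X : Scheme.{u}} {F : X.Modules}
    (hF : IsOfFiniteType F) : LocallyFinitelyGenerated F := by
  intro x
  obtain ⟨U, n, π, hx, hπ⟩ := exists_epi_free hF x
  refine ⟨U.ι ''ᵁ ⊤, n, fun i => happ π ⊤ (freeBasis i), ⟨⟨x, hx⟩, trivial, rfl⟩, ?_⟩
  intro W hW t y hy
  obtain ⟨W, rfl⟩ := exists_image_eq (hW.trans (U.ι_image_le ⊤))
  obtain ⟨y, hy, rfl⟩ := hy
  obtain ⟨V, hV, hyV, s, hs⟩ := locSurj_of_epi π W t y hy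
  refine ⟨U.ι ''ᵁ V, U.ι.image_mono hV, ⟨y, hyV, rfl⟩,
    fun i => (U.ι.appIso V).inv.hom (unitEquiv V (happ (freeπ i) V s)), ?_⟩
  exact (happ_free π s).symm.trans hs

/-- Near each point F has a finite presentation: finite type gives a surjection from a free module,
coherence makes its kernel of finite type. Cokernels of maps between free modules are
quasi-coherent. -/
theorem IsCoherent.qcOn {X : Scheme.{u}} {F : X.Modules} (hF : IsCoherent F) : QCOn F ⊤ := by
  refine QCOn.of_local fun x _ => ?_
  obtain ⟨U, n, π, hx, hπ⟩ := exists_epi_free hF.1 x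
  obtain ⟨U', m, ρ, hx', hρ⟩ := exists_epi_free (hF.2 U n π) ⟨x, hx⟩
  have h1 : QCOn ((freeModule U n).restrict U'.ι) ⊤ :=
    ((isBasis_restrict_iff (E := freeModule U n) (U := U') (V := ⊤) _).2
      (isBasis_freeBasis.res le_top)).qcOn
  have h2 : QCOn ((F.restrict U.ι).restrict U'.ι) ⊤ := by
    refine QCOn.of_locExact (qcOn_freeModule m ⊤) h1
      (ρ ≫ (Scheme.Modules.restrictFunctor U'.ι).map (kernel.ι π))
      ((Scheme.Modules.restrictFunctor U'.ι).map π) ?_ ?_ ?_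
    · rw [Category.assoc, ← Functor.map_comp, kernel.condition, Functor.map_zero, comp_zero]
    · intro V t ht y hy
      obtain ⟨k, hk⟩ := exists_happ_kernel_ι_eq π (U := U'.ι ''ᵁ V) t ht
      obtain ⟨V', hV', hyV', s, hs⟩ := locSurj_of_epi ρ V k y hy
      refine ⟨V', hV', hyV', s, ?_⟩
      rw [happ_comp, hs, ← hk]
      exact (happ_sres _ _ _).trans rfl
    · intro V t y hy
      obtain ⟨W, hW, hyW, s, hs⟩ := locSurj_of_epi π (U'.ι ''ᵁ V) t (U'.ι y) ⟨y, hy, rfl⟩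
      obtain ⟨W, rfl⟩ := exists_image_eq (hW.trans (U'.ι_image_le V))
      obtain ⟨y', hy', he⟩ := hyW
      obtain rfl : y' = y := U'.ι.injective he
      exact ⟨W, (U'.ι.image_le_image_iff _ _).1 hW, hy', s, hs⟩
  have h3 : QCOn (F.restrict U.ι) (U'.ι ''ᵁ ⊤) := h2.of_restrict
  exact ⟨U.ι ''ᵁ (U'.ι ''ᵁ ⊤), ⟨⟨x, hx⟩, ⟨⟨⟨x, hx⟩, hx'⟩, trivial, rfl⟩, rfl⟩, h3.of_restrict⟩

/-! ### Local homomorphisms and the module of homomorphisms -/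

namespace localHom

variable {X : Scheme.{u}} {E F F' G G' H : X.Modules} {U V W : X.Opens}

/-- The map on sections over `V ⊆ U` given by a morphism `F|_U ⟶ G|_U`. -/
noncomputable def lapp (φ : localHom F G U) (h : V ≤ U) : Γ(F, V) →ₗ[Γ(X, V)] Γ(G, V) where
  toFun := φ.1 ⟨V, h⟩
  map_add' := map_add _
  map_smul' := φ.2.1 ⟨V, h⟩

theorem lapp_sres (φ : localHom F G U) (h : V ≤ U) (h' : W ≤ V) (s : Γ(F, V)) :
    lapp φ (h'.trans h) (sres F h' s) = sres G h' (lapp φ h s) :=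
  φ.2.2 ⟨V, h⟩ ⟨W, h'.trans h⟩ (homOfLE h') s

theorem ext_lapp {φ ψ : localHom F G U}
    (h : ∀ V (hV : V ≤ U) (s : Γ(F, V)), lapp φ hV s = lapp ψ hV s) : φ = ψ := by
  apply Subtype.ext
  funext V
  ext s
  exact h V.1 V.2 s

/-- The local homomorphism with given components. -/
noncomputable def mk' (φ : ∀ V : X.Opens, V ≤ U → (Γ(F, V) →ₗ[Γ(X, V)] Γ(G, V)))
    (hφ : ∀ V W (hV : V ≤ U) (hW : W ≤ V) (s : Γ(F, V)),
      φ W (hW.trans hV) (sres F hW s) = sres G hW (φ V hV s)) : localHom F G U :=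
  ⟨fun V => (φ V.1 V.2).toAddMonoidHom, fun V => (φ V.1 V.2).map_smul,
    fun V W i s => hφ V.1 W.1 V.2 i.le s⟩

@[simp]
theorem lapp_mk' (φ : ∀ V : X.Opens, V ≤ U → (Γ(F, V) →ₗ[Γ(X, V)] Γ(G, V))) (hφ) (h : V ≤ U)
    (s : Γ(F, V)) : lapp (mk' φ hφ) h s = φ V h s := rfl

@[simp]
theorem lapp_res (h : V ≤ U) (φ : localHom F G U) (h' : W ≤ V) (s : Γ(F, W)) :
    lapp (res h φ) h' s = lapp φ (h'.trans h) s := rfl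

@[simp]
theorem lapp_postcomp (g : G ⟶ G') (φ : localHom F G U) (h : V ≤ U) (s : Γ(F, V)) :
    lapp (postcomp g φ) h s = happ g V (lapp φ h s) := rfl

@[simp]
theorem lapp_zero (h : V ≤ U) (s : Γ(F, V)) : lapp (0 : localHom F G U) h s = 0 := rfl

@[simp]
theorem lapp_add (φ ψ : localHom F G U) (h : V ≤ U) (s : Γ(F, V)) :
    lapp (φ + ψ) h s = lapp φ h s + lapp ψ h s := rfl

/-- Precomposition with a morphism of sheaves of modules. -/
noncomputable def precomp (f : F' ⟶ F) : localHom F G U →+ localHom F' G U where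
  toFun φ := mk' (fun V hV => (lapp φ hV).comp (happ f V)) fun V W hV hW s => by
    simp only [LinearMap.comp_apply, happ_sres]
    exact lapp_sres φ hV hW _
  map_zero' := rfl
  map_add' _ _ := rfl

@[simp]
theorem lapp_precomp (f : F' ⟶ F) (φ : localHom F G U) (h : V ≤ U) (s : Γ(F', V)) :
    lapp (precomp f φ) h s = lapp φ h (happ f V s) := rfl

theorem precomp_comp (f : F' ⟶ F) (f' : F ⟶ H) (φ : localHom H G U) :
    precomp (f ≫ f') φ = precomp f (precomp f' φ) := rfl

theorem postcomp_comp (g : G ⟶ G') (g' : G' ⟶ H) (φ : localHom F G U) :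
    postcomp (g ≫ g') φ = postcomp g' (postcomp g φ) := rfl

theorem precomp_zero (φ : localHom F G U) : precomp (0 : F' ⟶ F) φ = 0 :=
  ext_lapp fun _ _ _ => by simp

theorem postcomp_zero (φ : localHom F G U) : postcomp (0 : G ⟶ G') φ = 0 :=
  ext_lapp fun _ _ _ => by simp

noncomputable instance : Module Γ(X, U) (localHom F G U) where
  smul a φ := mk' (fun V hV => rres hV a • lapp φ hV) fun V W hV hW s => by
    simp only [LinearMap.smul_apply, sres_smul, rres_rres]
    rw [← lapp_sres φ hV hW]
  one_smul φ := ext_lapp fun V hV s => by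
    change rres hV (1 : Γ(X, U)) • lapp φ hV s = _
    rw [map_one, one_smul]
  mul_smul a b φ := ext_lapp fun V hV s => by
    change rres hV (a * b) • lapp φ hV s = rres hV a • rres hV b • lapp φ hV s
    rw [map_mul, mul_smul]
  smul_zero a := ext_lapp fun V hV s => by
    change rres hV a • (0 : Γ(G, V)) = 0
    rw [smul_zero]
  smul_add a φ ψ := ext_lapp fun V hV s => by
    change rres hV a • (lapp φ hV s + lapp ψ hV s) = rres hV a • lapp φ hV s + rres hV a • lapp ψ hV s
    rw [smul_add]
  add_smul a b φ := ext_lapp fun V hV s => by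
    change rres hV (a + b) • lapp φ hV s = rres hV a • lapp φ hV s + rres hV b • lapp φ hV s
    rw [map_add, add_smul]
  zero_smul φ := ext_lapp fun V hV s => by
    change rres hV (0 : Γ(X, U)) • lapp φ hV s = 0
    rw [map_zero, zero_smul]

@[simp]
theorem lapp_smul (a : Γ(X, U)) (φ : localHom F G U) (h : V ≤ U) (s : Γ(F, V)) :
    lapp (a • φ) h s = rres h a • lapp φ h s := rfl

theorem res_smul (h : V ≤ U) (a : Γ(X, U)) (φ : localHom F G U) :
    res h (a • φ) = rres h a • res h φ :=
  ext_lapp fun W hW s => by simp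

/-- A local homomorphism defined over the whole scheme is a morphism. -/
noncomputable def toHom (φ : localHom F G ⊤) : F ⟶ G :=
  mkHom (fun _ => (lapp φ le_top).toAddMonoidHom) (fun _ => (lapp φ le_top).map_smul)
    fun _ _ h s => lapp_sres φ le_top h s

/-! ### Local homomorphisms out of a module with a finite basis -/

section Basis

variable {ι : Type} [Fintype ι] {e : ι → Γ(E, U)}

/-- The local homomorphism with given values on a basis. -/
noncomputable def ofBasis (he : IsBasis E U e) (g : ι → Γ(G, U)) : localHom E G U :=
  mk' (fun V hV => (Fintype.linearCombination Γ(X, V) fun i => sres G hV (g i)).comp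
      (he.coord hV).toLinearMap)
    fun V W hV hW s => by
      simp only [LinearMap.comp_apply, LinearEquiv.coe_coe, Fintype.linearCombination_apply,
        map_sum, sres_smul, sres_sres]
      exact Finset.sum_congr rfl fun i _ => by rw [← he.coord_res hV hW]

theorem lapp_ofBasis (he : IsBasis E U e) (g : ι → Γ(G, U)) (h : V ≤ U) (i : ι) :
    lapp (ofBasis he g) h (sres E h (e i)) = sres G h (g i) := by
  classical
  have : he.coord h (sres E h (e i)) = Pi.single i 1 := by
    have := he.coord_sum h (Pi.single i 1)
    rw [Finset.sum_eq_single i (fun j _ hj => by rw [Pi.single_eq_of_ne hj, zero_smul])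
      (by simp), Pi.single_eq_same, one_smul] at this
    exact this
  simp only [ofBasis, lapp_mk', LinearMap.comp_apply, LinearEquiv.coe_coe, this,
    Fintype.linearCombination_apply]
  rw [Finset.sum_eq_single i (fun j _ hj => by rw [Pi.single_eq_of_ne hj, zero_smul])
      (by simp), Pi.single_eq_same, one_smul]

theorem ext_basis (he : IsBasis E U e) {φ ψ : localHom E G U}
    (h : ∀ i, lapp φ le_rfl (e i) = lapp ψ le_rfl (e i)) : φ = ψ := by
  refine ext_lapp fun V hV s => ?_
  rw [← he.sum_coord hV s]
  simp only [map_sum, map_smul, lapp_sres _ le_rfl hV, h]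

/-- Local homomorphisms out of a module with a basis. -/
noncomputable def basisEquiv (he : IsBasis E U e) (h : V ≤ U) :
    localHom E G V ≃ₗ[Γ(X, V)] (ι → Γ(G, V)) where
  toFun φ i := lapp φ le_rfl (sres E h (e i))
  map_add' _ _ := rfl
  map_smul' a φ := by
    funext i
    simp
  invFun g := ofBasis (he.res h) g
  left_inv φ := ext_basis (he.res h) fun i => by
    have := lapp_ofBasis (he.res h) (fun i => lapp φ le_rfl (sres E h (e i))) le_rfl i
    simpa only [sres_self] using this
  right_inv g := funext fun i => by
    have := lapp_ofBasis (he.res h) g le_rfl i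
    simpa only [sres_self] using this

theorem basisEquiv_res (he : IsBasis E U e) (h : V ≤ U) (h' : W ≤ V) (φ : localHom E G V) (i : ι) :
    basisEquiv he (h'.trans h) (res h' φ) i = sres G h' (basisEquiv he h φ i) := by
  change lapp φ h' (sres E (h'.trans h) (e i)) = sres G h' (lapp φ le_rfl (sres E h (e i)))
  rw [← lapp_sres, sres_sres]

/-- Local exactness of `ℋom(E, -)` when `E` has a finite basis. -/
theorem exists_postcomp_eq (he : IsBasis E U e) {f : F ⟶ G} {g : G ⟶ H} (hfg : LocExact f g)
    (φ : localHom E G U) (hφ : postcomp g φ = 0) (x : X) (hx : x ∈ U) :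
    ∃ (V : X.Opens) (hV : V ≤ U), x ∈ V ∧ ∃ ψ : localHom E F V, postcomp f ψ = res hV φ := by
  have h1 : ∀ i, happ g U (lapp φ le_rfl (e i)) = 0 := fun i =>
    congrArg (fun χ => lapp χ (le_refl U) (e i)) hφ
  choose V hV hxV s hs using fun i => hfg U _ (h1 i) x hx
  -- The values on the basis lift on finitely many neighbourhoods of x; on their intersection the
  -- lifts define a homomorphism.
  let V' : X.Opens := U ⊓ Finset.univ.inf V
  have hV' : V' ≤ U := inf_le_left
  have hVi : ∀ i, V' ≤ V i := fun i => inf_le_right.trans (Finset.inf_le (Finset.mem_univ i))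
  have hx' : x ∈ V' := by
    refine ⟨hx, ?_⟩
    have : ∀ t : Finset ι, x ∈ t.inf V := by
      classical
      intro t
      induction t using Finset.induction_on with
      | empty => simp
      | insert a t _ ih =>
        rw [Finset.inf_insert]
        exact ⟨hxV a, ih⟩
    exact this _
  refine ⟨V', hV', hx', ofBasis (he.res hV') fun i => sres F (hVi i) (s i), ?_⟩
  refine ext_basis (he.res hV') fun i => ?_
  have h2 := lapp_ofBasis (he.res hV') (fun i => sres F (hVi i) (s i)) le_rfl i
  rw [sres_self] at h2
  rw [lapp_postcomp, h2, sres_self, happ_sres, hs, sres_sres]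
  exact (lapp_sres φ le_rfl hV' (e i)).symm

end Basis

end localHom

/-! ### The sheaf of homomorphisms as an `𝒪_X`-module -/

section ModHom

variable {X : Scheme.{u}} {E F F' G G' H : X.Modules} {U V W : X.Opens}

/-- The `𝒪_X`-module `ℋom(F, G)`. -/
noncomputable def modHom (F G : X.Modules) : X.Modules :=
  letI : ∀ U : X.Opens, Module Γ(X, U) ((homPresheaf F G).obj (op U)) :=
    fun U => inferInstanceAs (Module Γ(X, U) (localHom F G U))
  mkModules (homPresheaf F G) (homPresheaf_isSheaf F G)
    (fun _ _ i a φ => localHom.res_smul i.le a φ)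

/-- The sections of `ℋom(F, G)` are the local homomorphisms. -/
noncomputable def modHomEquiv (F G : X.Modules) (U : X.Opens) :
    Γ(modHom F G, U) ≃ₗ[Γ(X, U)] localHom F G U where
  toFun φ := φ
  invFun φ := φ
  map_add' _ _ := rfl
  map_smul' _ _ := rfl

/-- Precomposition as a morphism of modules of homomorphisms. -/
noncomputable def modHomPrecomp (f : F' ⟶ F) (G : X.Modules) : modHom F G ⟶ modHom F' G :=
  mkHom (fun U => ((modHomEquiv F' G U).symm.toLinearMap.toAddMonoidHom.comp
      (localHom.precomp f)).comp (modHomEquiv F G U).toLinearMap.toAddMonoidHom)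
    (fun U a φ => by
      apply (modHomEquiv F' G U).injective
      refine localHom.ext_lapp fun V hV s => ?_
      rfl)
    (fun U V h φ => rfl)

theorem IsBasis.qcOn_modHom {ι : Type} [Fintype ι] {e : ι → Γ(E, U)} (he : IsBasis E U e)
    (hG : QCOn G U) : QCOn (modHom E G) U :=
  hG.of_equiv (fun W hW => (modHomEquiv E G W).trans (localHom.basisEquiv he hW))
    fun _ _ h h' φ i => localHom.basisEquiv_res he h h' (modHomEquiv E G _ φ) i

theorem IsLocallyFreeOfFiniteRank.qcOn_modHom (hE : IsLocallyFreeOfFiniteRank E)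
    (hG : QCOn G U) : QCOn (modHom E G) U :=
  QCOn.of_local fun x hx => by
    obtain ⟨V, n, e, hxV, he⟩ := hE.exists_isBasis x
    exact ⟨V ⊓ U, ⟨hxV, hx⟩, (he.res inf_le_left).qcOn_modHom (hG.mono inf_le_right)⟩

end ModHom

/-! ### Restriction to an open subset: morphisms and injective objects -/

section Bridge

variable {X : Scheme.{u}} {F F' G G' : X.Modules} {U : X.Opens}

/-- The map on sections of a morphism of restrictions, linear over the sections of `𝒪_X`. -/
noncomputable def rhapp (φ : F.restrict U.ι ⟶ G.restrict U.ι) (V : (U : Scheme.{u}).Opens) :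
    Γ(F, U.ι ''ᵁ V) →ₗ[Γ(X, U.ι ''ᵁ V)] Γ(G, U.ι ''ᵁ V) where
  toFun := happ φ V
  map_add' := map_add (happ φ V)
  map_smul' a s := by
    -- Every scalar over the image open set comes from the structure sheaf of U, so linearity over
    -- the latter is enough.
    have h : ∃ b, (U.ι.appIso V).inv.hom b = a := (appIso_inv_bijective U V).2 a
    exact h.elim fun b hb => hb ▸ (happ φ V).map_smul b s

theorem rhapp_sres (φ : F.restrict U.ι ⟶ G.restrict U.ι) {V W : (U : Scheme.{u}).Opens}
    (h : W ≤ V) (s : Γ(F, U.ι ''ᵁ V)) :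
    rhapp φ W (sres F (U.ι.image_mono h) s) = sres G (U.ι.image_mono h) (rhapp φ V s) :=
  happ_sres φ h s

theorem image_preimage_eq {V : X.Opens} (hV : V ≤ U) : U.ι ''ᵁ (U.ι ⁻¹ᵁ V) = V := by
  simpa [Scheme.Hom.image_preimage_eq_opensRange_inf] using hV

/-- The local homomorphism corresponding to a morphism of restrictions. -/
noncomputable def ofRestrict (φ : F.restrict U.ι ⟶ G.restrict U.ι) : localHom F G U :=
  localHom.mk' (fun V hV =>
    { toFun := fun s => sres G (image_preimage_eq hV).ge
        (rhapp φ (U.ι ⁻¹ᵁ V) (sres F (image_preimage_eq hV).le s))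
      map_add' := fun a b => by simp only [map_add]
      map_smul' := fun a s => by
        simp only [sres_smul, map_smul, rres_rres, rres_self, RingHom.id_apply] })
    fun V W hV hW s => by
      have := rhapp_sres φ (show U.ι ⁻¹ᵁ W ≤ U.ι ⁻¹ᵁ V from U.ι.preimage_mono hW)
        (sres F (image_preimage_eq hV).le s)
      simp only [sres_sres] at this
      simp only [LinearMap.coe_mk, AddHom.coe_mk, sres_sres, this]

theorem lapp_ofRestrict (φ : F.restrict U.ι ⟶ G.restrict U.ι) (V : (U : Scheme.{u}).Opens)
    (s : Γ(F, U.ι ''ᵁ V)) :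
    localHom.lapp (ofRestrict φ) (U.ι_image_le V) s = rhapp φ V s := by
  have h : V ≤ U.ι ⁻¹ᵁ (U.ι ''ᵁ V) := (U.ι.preimage_image_eq V).ge
  have := rhapp_sres φ h (sres F (image_preimage_eq (U.ι_image_le V)).le s)
  simp only [sres_sres, sres_self] at this
  exact this.symm

theorem localHom.ext_image {φ ψ : localHom F G U}
    (h : ∀ (V : (U : Scheme.{u}).Opens) (s : Γ(F, U.ι ''ᵁ V)),
      lapp φ (U.ι_image_le V) s = lapp ψ (U.ι_image_le V) s) : φ = ψ := by
  refine localHom.ext_lapp fun V hV s => ?_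
  obtain ⟨V, rfl⟩ := exists_image_eq hV
  exact h V s

/-- Morphisms of restrictions are local homomorphisms. -/
noncomputable def restrictEquiv (F G : X.Modules) (U : X.Opens) :
    (F.restrict U.ι ⟶ G.restrict U.ι) ≃+ localHom F G U where
  toFun := ofRestrict
  invFun φ := mkHom (fun V => (localHom.lapp φ (U.ι_image_le V)).toAddMonoidHom)
    (fun V a s => (localHom.lapp φ (U.ι_image_le V)).map_smul ((U.ι.appIso V).inv.hom a) s)
    (fun V W h s => localHom.lapp_sres φ (U.ι_image_le V) (U.ι.image_mono h) s)
  left_inv φ := hom_ext_happ fun V s => lapp_ofRestrict φ V s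
  right_inv φ := localHom.ext_image fun V s => lapp_ofRestrict _ V s
  map_add' φ ψ := localHom.ext_image fun V s => by
    rw [localHom.lapp_add, lapp_ofRestrict, lapp_ofRestrict, lapp_ofRestrict]
    rfl

theorem lapp_restrictEquiv (φ : F.restrict U.ι ⟶ G.restrict U.ι) (V : (U : Scheme.{u}).Opens)
    (s : Γ(F, U.ι ''ᵁ V)) :
    localHom.lapp (restrictEquiv F G U φ) (U.ι_image_le V) s = happ φ V s :=
  lapp_ofRestrict φ V s

theorem restrictEquiv_precomp (f : F' ⟶ F) (φ : F.restrict U.ι ⟶ G.restrict U.ι) :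
    restrictEquiv F' G U ((Scheme.Modules.restrictFunctor U.ι).map f ≫ φ) =
      localHom.precomp f (restrictEquiv F G U φ) :=
  localHom.ext_image fun V s => by
    rw [localHom.lapp_precomp, lapp_restrictEquiv, lapp_restrictEquiv]
    rfl

theorem restrictEquiv_postcomp (g : G ⟶ G') (φ : F.restrict U.ι ⟶ G.restrict U.ι) :
    restrictEquiv F G' U (φ ≫ (Scheme.Modules.restrictFunctor U.ι).map g) =
      localHom.postcomp g (restrictEquiv F G U φ) :=
  localHom.ext_image fun V s => by
    rw [localHom.lapp_postcomp, lapp_restrictEquiv, lapp_restrictEquiv]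
    rfl

end Bridge

theorem le_preimage {X : Scheme.{u}} {U V : X.Opens} {W : (U : Scheme.{u}).Opens}
    (h : U.ι ''ᵁ W ≤ V) : W ≤ U.ι ⁻¹ᵁ V := fun _ hx => h ⟨_, hx, rfl⟩

/-! ### Extension by zero; restrictions of injective modules are injective -/

section Injective

variable {X : Scheme.{u}} {U : X.Opens} {A B : (U : Scheme.{u}).Modules} {I : X.Modules}

/-- The extension by zero of a sheaf of modules, as a subsheaf of the direct image. -/
noncomputable def extendZero (A : (U : Scheme.{u}).Modules) :
    SubSheaf ((Scheme.Modules.pushforward U.ι).obj A) where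
  obj V :=
    { carrier := {s | ∀ x ∈ V, x ∉ U → ∃ (W : X.Opens) (h : W ≤ V), x ∈ W ∧
        sres ((Scheme.Modules.pushforward U.ι).obj A) h s = 0}
      zero_mem' := fun x hx _ => ⟨V, le_rfl, hx, map_zero _⟩
      add_mem' := fun {a b} ha hb x hx hxU => by
        obtain ⟨W, hW, hxW, h⟩ := ha x hx hxU
        obtain ⟨W', hW', hxW', h'⟩ := hb x hx hxU
        refine ⟨W ⊓ W', inf_le_left.trans hW, ⟨hxW, hxW'⟩, ?_⟩
        rw [map_add, ← sres_sres hW inf_le_left, h, ← sres_sres hW' inf_le_right, h', map_zero,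
          map_zero, add_zero]
      smul_mem' := fun a s hs x hx hxU => by
        obtain ⟨W, hW, hxW, h⟩ := hs x hx hxU
        exact ⟨W, hW, hxW, by rw [sres_smul, h, smul_zero]⟩ }
  res {V W} h {s} hs x hx hxU := by
    obtain ⟨W', hW', hxW', h'⟩ := hs x (h hx) hxU
    refine ⟨W ⊓ W', inf_le_left, ⟨hx, hxW'⟩, ?_⟩
    rw [sres_sres, ← sres_sres hW' inf_le_right, h', map_zero]
  loc {V s} h x hx hxU := by
    obtain ⟨W, hW, hxW, h⟩ := h x hx
    obtain ⟨W', hW', hxW', h'⟩ := h x hxW hxU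
    exact ⟨W', hW'.trans hW, hxW', by rw [← sres_sres hW hW', h']⟩

/-- The section `t` of `I` over `V` is the extension by zero of the image of `s` under `φ`. -/
structure IsExtend (φ : A ⟶ I.restrict U.ι) {V : X.Opens} (s : Γ(A, U.ι ⁻¹ᵁ V)) {V' : X.Opens}
    (hV : V' ≤ V) (t : Γ(I, V')) : Prop where
  eq (W : (U : Scheme.{u}).Opens) (h : U.ι ''ᵁ W ≤ V') :
    sres I h t = happ φ W (sres A ((le_preimage h).trans (U.ι.preimage_mono hV)) s)
  zero (x : X) : x ∈ V' → x ∉ U → ∃ (W : X.Opens) (h : W ≤ V'), x ∈ W ∧ sres I h t = 0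

variable {φ : A ⟶ I.restrict U.ι} {V V' W : X.Opens} {s : Γ(A, U.ι ⁻¹ᵁ V)}

theorem IsExtend.unique {hV : V' ≤ V} {t t' : Γ(I, V')} (h : IsExtend φ s hV t)
    (h' : IsExtend φ s hV t') : t = t' := by
  refine section_ext fun x hx => ?_
  by_cases hxU : x ∈ U
  · have hW : U.ι ''ᵁ (U.ι ⁻¹ᵁ V') ≤ V' := U.ι.image_preimage_le V'
    refine ⟨_, hW, ⟨⟨x, hxU⟩, hx, rfl⟩, ?_⟩
    rw [h.eq _ hW, h'.eq _ hW]
  · obtain ⟨W, hW, hxW, h0⟩ := h.zero x hx hxU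
    obtain ⟨W', hW', hxW', h0'⟩ := h'.zero x hx hxU
    refine ⟨W ⊓ W', inf_le_left.trans hW, ⟨hxW, hxW'⟩, ?_⟩
    rw [← sres_sres hW inf_le_left, h0, ← sres_sres hW' inf_le_right, h0', map_zero, map_zero]

theorem IsExtend.restr {hV : V' ≤ V} {t : Γ(I, V')} (h : IsExtend φ s hV t) (hW : W ≤ V') :
    IsExtend φ s (hW.trans hV) (sres I hW t) where
  eq W' h' := by rw [sres_sres, h.eq W' (h'.trans hW)]
  zero x hx hxU := by
    obtain ⟨W', hW', hxW', h0⟩ := h.zero x (hW hx) hxU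
    refine ⟨W ⊓ W', inf_le_left, ⟨hx, hxW'⟩, ?_⟩
    rw [sres_sres, ← sres_sres hW' inf_le_right, h0, map_zero]

theorem IsExtend.of_sres {hV : V ≤ W} {s : Γ(A, U.ι ⁻¹ᵁ W)} {t : Γ(I, V)}
    (h : IsExtend φ s hV t) :
    IsExtend φ (sres A (U.ι.preimage_mono hV) s) le_rfl t where
  eq W' h' := by rw [h.eq W' h', sres_sres]
  zero := h.zero

theorem IsExtend.of_local {hV : V' ≤ V} {t : Γ(I, V')}
    (h : ∀ x ∈ V', ∃ (W : X.Opens) (hW : W ≤ V'), x ∈ W ∧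
      IsExtend φ s (hW.trans hV) (sres I hW t)) : IsExtend φ s hV t where
  eq W hW := by
    refine section_ext (F := I) fun y hy => ?_
    obtain ⟨W', hW', hyW', h'⟩ := h y (hW hy)
    obtain ⟨y, hyW, rfl⟩ := hy
    have h1 : U.ι ''ᵁ (W ⊓ U.ι ⁻¹ᵁ W') ≤ W' :=
      (U.ι.image_mono inf_le_right).trans (U.ι.image_preimage_le W')
    refine ⟨U.ι ''ᵁ (W ⊓ U.ι ⁻¹ᵁ W'), U.ι.image_mono inf_le_left, ⟨y, ⟨hyW, hyW'⟩, rfl⟩, ?_⟩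
    have h2 := h'.eq _ h1
    rw [sres_sres] at h2
    rw [sres_sres, h2]
    refine Eq.trans ?_ (happ_sres φ (inf_le_left : W ⊓ U.ι ⁻¹ᵁ W' ≤ W) _)
    rw [sres_sres]
  zero x hx hxU := by
    obtain ⟨W, hW, hxW, h'⟩ := h x hx
    obtain ⟨W', hW', hxW', h0⟩ := h'.zero x hxW hxU
    exact ⟨W', hW'.trans hW, hxW', by rw [← sres_sres hW hW', h0]⟩

/-- The section is φ(s) on U ∩ V and zero near the points outside U, where s vanishes. Uniqueness of
extensions by zero makes the pieces compatible. -/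
theorem exists_isExtend (φ : A ⟶ I.restrict U.ι) (hs : s ∈ (extendZero A).obj V) :
    ∃ t : Γ(I, V), IsExtend φ s le_rfl t := by
  obtain ⟨t, ht⟩ := section_glue_nhds (F := I) (fun V' hV t => IsExtend φ s hV t) (U := V)
    (fun x hx => by
      by_cases hxU : x ∈ U
      · refine ⟨U.ι ''ᵁ (U.ι ⁻¹ᵁ V), U.ι.image_preimage_le V, ⟨⟨x, hxU⟩, hx, rfl⟩,
          happ φ (U.ι ⁻¹ᵁ V) s, ?_, ?_⟩
        · intro W hW
          exact (happ_sres φ ((U.ι.image_le_image_iff _ _).1 hW) s).symm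
        · intro y hy hyU
          exact (hyU (U.ι_image_le _ hy)).elim
      · obtain ⟨W, hW, hxW, h0⟩ := hs x hx hxU
        refine ⟨W, hW, hxW, 0, ?_, ?_⟩
        · intro W' hW'
          rw [← sres_sres (U.ι.preimage_mono hW) (le_preimage hW'), map_zero]
          have : sres A (U.ι.preimage_mono hW) s = 0 := h0
          rw [this, map_zero, map_zero]
          rfl
        · exact fun y hy _ => ⟨W, le_rfl, hy, map_zero _⟩)
    (fun V₁ V₂ h₁ h₂ t₁ t₂ H₁ H₂ => (H₁.restr inf_le_left).unique (H₂.restr inf_le_right))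
  exact ⟨t, IsExtend.of_local ht⟩

theorem IsExtend.add {hV : V' ≤ V} {s s' : Γ(A, U.ι ⁻¹ᵁ V)} {t t' : Γ(I, V')}
    (h : IsExtend φ s hV t) (h' : IsExtend φ s' hV t') : IsExtend φ (s + s') hV (t + t') where
  eq W hW := by
    rw [map_add, h.eq W hW, h'.eq W hW, map_add, map_add]
    rfl
  zero x hx hxU := by
    obtain ⟨W, hW, hxW, h0⟩ := h.zero x hx hxU
    obtain ⟨W', hW', hxW', h0'⟩ := h'.zero x hx hxU
    refine ⟨W ⊓ W', inf_le_left.trans hW, ⟨hxW, hxW'⟩, ?_⟩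
    rw [map_add, ← sres_sres hW inf_le_left, h0, ← sres_sres hW' inf_le_right, h0', map_zero,
      map_zero, add_zero]

theorem appIso_inv_app {W : (U : Scheme.{u}).Opens} (h : U.ι ''ᵁ W ≤ V) (a : Γ(X, V)) :
    (U.ι.appIso W).inv.hom (rres (le_preimage h) ((U.ι.app V).hom a)) = rres h a := by
  rw [appIso_inv_rres]
  simp only [Scheme.Opens.ι_appIso]
  exact rres_rres _ _ _

theorem IsExtend.smul {s : Γ(A, U.ι ⁻¹ᵁ V)} {t : Γ(I, V)}
    (h : IsExtend φ s le_rfl t) (a : Γ(X, V)) :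
    IsExtend φ ((U.ι.app V).hom a • s) le_rfl (a • t) where
  eq W hW := by
    have h1 := (congrArg (happ φ W) (sres_smul (F := A) (le_preimage hW) ((U.ι.app V).hom a) s)).trans
      ((happ φ W).map_smul _ _)
    have h2 := smul_restrict (F := I) (rres (le_preimage hW) ((U.ι.app V).hom a))
      (happ φ W (sres A (le_preimage hW) s))
    rw [appIso_inv_app hW] at h2
    refine Eq.trans ?_ (h1.trans h2).symm
    rw [sres_smul]
    exact congrArg _ (h.eq W hW)
  zero x hx hxU := by
    obtain ⟨W, hW, hxW, h0⟩ := h.zero x hx hxU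
    exact ⟨W, hW, hxW, by rw [sres_smul, h0, smul_zero]⟩

/-- One half of the adjunction between extension by zero and restriction. Additivity, linearity and
compatibility with restriction all follow from `IsExtend.unique`. -/
theorem exists_extendHom (φ : A ⟶ I.restrict U.ι) : ∃ ψ : (extendZero A).toModules ⟶ I,
    ∀ (V : X.Opens) (s : Γ((extendZero A).toModules, V)),
      IsExtend φ (happ (extendZero A).ι V s) le_rfl (happ ψ V s) := by
  have hex := fun (V : X.Opens) (s : Γ((extendZero A).toModules, V)) =>
    exists_isExtend φ ((extendZero A).happ_ι_mem s)
  choose t ht using hex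
  refine ⟨mkHom (fun V => AddMonoidHom.mk' (t V) fun a b => (ht V _).unique ?_) (fun V a s =>
    (ht V _).unique ?_) fun V W h s => (ht W _).unique ?_, fun V s => ht V s⟩
  · exact (ht V a).add (ht V b)
  · exact (ht V s).smul a
  · rw [happ_sres]
    exact ((ht V s).restr h).of_sres

/-- The restriction of the extension by zero is the original module. -/
noncomputable def extendZeroRestrict (A : (U : Scheme.{u}).Modules) :
    (extendZero A).toModules.restrict U.ι ⟶ A :=
  (Scheme.Modules.restrictFunctor U.ι).map (extendZero A).ι ≫
    (Scheme.Modules.restrictAdjunction U.ι).counit.app A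

theorem happ_extendZeroRestrict (W : (U : Scheme.{u}).Opens)
    (s : Γ((extendZero A).toModules, U.ι ''ᵁ W)) :
    happ (extendZeroRestrict A) W s =
      sres A (U.ι.preimage_image_eq W).ge (happ (extendZero A).ι (U.ι ''ᵁ W) s) := rfl

theorem sres_bijective_of_eq {X : Scheme.{u}} {F : X.Modules} {V W : X.Opens} (h : V = W) :
    Function.Bijective (sres F h.ge) := by
  subst h
  exact ⟨fun a b hab => by simpa using hab, fun a => ⟨a, by simp⟩⟩

instance : IsIso (extendZeroRestrict A) := isIso_of_bijective fun W => by
  constructor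
  · intro a b hab
    exact (extendZero A).happ_ι_injective ((sres_bijective_of_eq (F := A)
      (U.ι.preimage_image_eq W)).1 hab)
  · intro b
    obtain ⟨b, rfl⟩ := (sres_bijective_of_eq (F := A) (U.ι.preimage_image_eq W)).2 b
    obtain ⟨a, rfl⟩ := (extendZero A).exists_happ_ι_eq (U := U.ι ''ᵁ W) (s := b)
      fun x hx hxU => (hxU (U.ι_image_le W hx)).elim
    exact ⟨a, happ_extendZeroRestrict W a⟩

/-- Restriction has the exact left adjoint "extension by zero". Concretely, a monomorphism A ⟶ B
stays a monomorphism after extension by zero, the transposed map extends along it into I, and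
restricting this extension to U solves the original problem. -/
instance injective_restrict (I : X.Modules) [Injective I] (U : X.Opens) :
    Injective (I.restrict U.ι) where
  factors {A B} φ i hi := by
    obtain ⟨φ', hφ'⟩ := exists_extendHom φ
    let i' : (extendZero A).toModules ⟶ (extendZero B).toModules :=
      (extendZero B).lift ((extendZero A).ι ≫ (Scheme.Modules.pushforward U.ι).map i)
        fun V s x hx hxU => by
          obtain ⟨W, hW, hxW, h0⟩ := (extendZero A).happ_ι_mem s x hx hxU
          exact ⟨W, hW, hxW, by rw [happ_comp, ← happ_sres, h0, map_zero]⟩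
    have hi' : i' ≫ (extendZero B).ι =
      (extendZero A).ι ≫ (Scheme.Modules.pushforward U.ι).map i := SubSheaf.lift_ι _ _ _
    have : Mono i' := by
      have : Mono (i' ≫ (extendZero B).ι) := by
        rw [hi']
        infer_instance
      exact mono_of_mono i' (extendZero B).ι
    let ψ := Injective.factorThru φ' i'
    have hψ : i' ≫ ψ = φ' := Injective.comp_factorThru φ' i'
    have hk : (Scheme.Modules.restrictFunctor U.ι).map i' ≫ extendZeroRestrict B =
        extendZeroRestrict A ≫ i := by
      simp only [extendZeroRestrict]
      rw [← Category.assoc, ← Functor.map_comp, hi', Functor.map_comp, Category.assoc,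
        Category.assoc]
      congr 1
      exact (Scheme.Modules.restrictAdjunction U.ι).counit.naturality i
    have hφ : extendZeroRestrict A ≫ φ = (Scheme.Modules.restrictFunctor U.ι).map φ' :=
      hom_ext_happ fun W s => by
        have := (hφ' _ s).eq W le_rfl
        rw [sres_self] at this
        exact this.symm
    refine ⟨inv (extendZeroRestrict B) ≫ (Scheme.Modules.restrictFunctor U.ι).map ψ, ?_⟩
    rw [← cancel_epi (extendZeroRestrict A), hφ, ← Category.assoc, ← hk, Category.assoc,
      IsIso.hom_inv_id_assoc, ← Functor.map_comp, hψ]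

end Injective

/-! ### Zigzags in the double complex `ℋom(L_i, J^j)` -/

/-- A left resolution `L` by locally free sheaves (except in degree zero) and a right resolution
`J` by injective sheaves (except in degree zero); both sequences are exact. -/
structure Bires (X : Scheme.{u}) where
  /-- the left resolution -/
  L : ℕ → X.Modules
  /-- its differential -/
  dL (i : ℕ) : L (i + 1) ⟶ L i
  /-- the right resolution -/
  J : ℕ → X.Modules
  /-- its differential -/
  dJ (j : ℕ) : J j ⟶ J (j + 1)
  dL_dL (i : ℕ) : dL (i + 1) ≫ dL i = 0
  dJ_dJ (j : ℕ) : dJ j ≫ dJ (j + 1) = 0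
  exactL (i : ℕ) : LocExact (dL (i + 1)) (dL i)
  surjL : LocSurj (dL 0)
  exactJ (j : ℕ) : LocExact (dJ j) (dJ (j + 1))
  injJ (U : X.Opens) : Function.Injective (happ (dJ 0) U)
  injective (j : ℕ) : Injective (J (j + 1))
  isLocallyFree (i : ℕ) : IsLocallyFreeOfFiniteRank (L (i + 1))

namespace Bires

variable {X : Scheme.{u}} (R : Bires X) {U V W : X.Opens}

/-- The terms of the double complex. -/
abbrev A (i j : ℕ) (U : X.Opens) := localHom (R.L i) (R.J j) U

/-- The differential induced by the left resolution. -/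
noncomputable def δ (i j : ℕ) : R.A i j U →+ R.A (i + 1) j U := localHom.precomp (R.dL i)

/-- The differential induced by the right resolution. -/
noncomputable def η (i j : ℕ) : R.A i j U →+ R.A i (j + 1) U := localHom.postcomp (R.dJ j)

variable {R} {i j : ℕ}

theorem δ_δ (x : R.A i j U) : R.δ _ _ (R.δ _ _ x) = 0 := by
  simp only [δ]
  rw [← localHom.precomp_comp, R.dL_dL, localHom.precomp_zero]

theorem η_η (x : R.A i j U) : R.η _ _ (R.η _ _ x) = 0 := by
  simp only [η]
  rw [← localHom.postcomp_comp, R.dJ_dJ, localHom.postcomp_zero]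

theorem δ_η (x : R.A i j U) : R.δ _ _ (R.η _ _ x) = R.η _ _ (R.δ _ _ x) := rfl

theorem res_δ (h : V ≤ U) (x : R.A i j U) :
    localHom.res h (R.δ i j x) = R.δ i j (localHom.res h x) := rfl

theorem res_η (h : V ≤ U) (x : R.A i j U) :
    localHom.res h (R.η i j x) = R.η i j (localHom.res h x) := rfl

theorem eq_zero_of_δ {x : R.A 0 j U} (hx : R.δ _ _ x = 0) : x = 0 := by
  refine localHom.ext_lapp fun V hV s => section_ext fun p hp => ?_
  obtain ⟨W, hW, hpW, t, ht⟩ := R.surjL V s p hp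
  refine ⟨W, hW, hpW, ?_⟩
  rw [← localHom.lapp_sres x hV hW, ← ht]
  exact congrArg (fun y => localHom.lapp y (hW.trans hV) t) hx |>.trans (map_zero _).symm

/-- Holds over all of U, without shrinking: the restriction of `R.J (j + 1)` to U is injective and
the restricted left resolution is exact. -/
theorem exists_δ_eq {x : R.A (i + 1) (j + 1) U} (hx : R.δ _ _ x = 0) :
    ∃ y : R.A i (j + 1) U, R.δ _ _ y = x := by
  have := R.injective j
  let S : ShortComplex X.Modules := ShortComplex.mk _ _ (R.dL_dL i)
  have hS : (S.map (Scheme.Modules.restrictFunctor U.ι)).Exact :=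
    restrict_exact (exact_of_locExact (R.exactL i)) U
  obtain ⟨x, rfl⟩ := (restrictEquiv _ _ U).surjective x
  have h0 : (Scheme.Modules.restrictFunctor U.ι).map (R.dL (i + 1)) ≫ x = 0 := by
    apply (restrictEquiv _ _ U).injective
    rw [restrictEquiv_precomp, map_zero]
    exact hx
  refine ⟨restrictEquiv _ _ U (hS.descToInjective x h0), ?_⟩
  refine (restrictEquiv_precomp (R.dL i) _).symm.trans (congrArg _ ?_)
  exact hS.comp_descToInjective x h0

theorem eq_zero_of_η {x : R.A i 0 U} (hx : R.η _ _ x = 0) : x = 0 :=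
  localHom.ext_lapp fun V hV s => R.injJ V
    ((congrArg (fun y => localHom.lapp y hV s) hx).trans (map_zero _).symm)

/-- Only local: `R.L (i + 1)` has a basis near p, and the finitely many values on it lift near p. -/
theorem exists_η_eq {x : R.A (i + 1) (j + 1) U} (hx : R.η _ _ x = 0) (p : X) (hp : p ∈ U) :
    ∃ (V : X.Opens) (hV : V ≤ U), p ∈ V ∧ ∃ y : R.A (i + 1) j V, R.η _ _ y = localHom.res hV x := by
  obtain ⟨W, n, e, hpW, he⟩ := (R.isLocallyFree i).exists_isBasis p
  obtain ⟨V, hV, hpV, y, hy⟩ := localHom.exists_postcomp_eq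
    (he.res (inf_le_left : W ⊓ U ≤ W)) (R.exactJ j) (localHom.res inf_le_right x)
    (congrArg (localHom.res (inf_le_right : W ⊓ U ≤ U)) hx) p ⟨hpW, hp⟩
  exact ⟨V, hV.trans inf_le_right, hpV, y, hy⟩

/-- The elements of the double complex linked to `c` by a zigzag. -/
inductive Zig {m : ℕ} (c : R.A m 0 U) : ∀ i j : ℕ, R.A i j U → Prop
  | base : Zig c m 0 c
  | step {i j : ℕ} (x : R.A i (j + 1) U) (y : R.A (i + 1) j U) :
      R.δ _ _ x = R.η _ _ y → Zig c (i + 1) j y → Zig c i (j + 1) x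

variable {m : ℕ} {c c' : R.A m 0 U}

theorem Zig.res {x : R.A i j U} (h : Zig c i j x) (hV : V ≤ U) :
    Zig (localHom.res hV c) i j (localHom.res hV x) := by
  induction h with
  | base => exact .base
  | step x y hxy _ ih =>
    exact .step _ _ (by rw [← res_δ, hxy, res_η]) ih

theorem Zig.add {x x' : R.A i j U} (h : Zig c i j x) (h' : Zig c' i j x') :
    Zig (c + c') i j (x + x') := by
  induction h with
  | base => cases h'; exact .base
  | step x y hxy _ ih =>
    cases h' with
    | step _ y' hxy' h' => exact .step _ _ (by rw [map_add, map_add, hxy, hxy']) (ih h')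

theorem Zig.neg {x : R.A i j U} (h : Zig c i j x) : Zig (-c) i j (-x) := by
  induction h with
  | base => exact .base
  | step x y hxy _ ih => exact .step _ _ (by rw [map_neg, map_neg, hxy]) ih

theorem Zig.sub {x x' : R.A i j U} (h : Zig c i j x) (h' : Zig c' i j x') :
    Zig (c - c') i j (x - x') := by
  rw [sub_eq_add_neg, sub_eq_add_neg]
  exact h.add h'.neg

/-- The condition needed to prolong a zigzag: at its start δc = 0, and later δηx = ηδx = ηηy = 0. -/
theorem Zig.δ_η {x : R.A i j U} (h : Zig c i j x) (hc : R.δ _ _ c = 0) :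
    R.δ _ _ (R.η _ _ x) = 0 := by
  rw [Bires.δ_η]
  cases h with
  | base => rw [hc, map_zero]
  | step _ y hxy _ => rw [hxy, η_η]

theorem exists_zig (hc : R.δ _ _ c = 0) : ∀ i j, i + j = m → ∃ x : R.A i j U, Zig c i j x := by
  intro i j
  induction j generalizing i with
  | zero =>
    intro h
    obtain rfl : i = m := h
    exact ⟨c, .base⟩
  | succ j ih =>
    intro h
    obtain ⟨y, hy⟩ := ih (i + 1) (by omega)
    obtain ⟨x, hx⟩ := exists_δ_eq (hy.δ_η hc)
    exact ⟨x, .step x y hx hy⟩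

/-- A zigzag from a cocycle ends at a cocycle of ℋom(F, I^•), since δ is injective in the column i =
0. -/
theorem Zig.η_eq_zero {x : R.A 0 j U} (h : Zig c 0 j x) (hc : R.δ _ _ c = 0) : R.η _ _ x = 0 :=
  eq_zero_of_δ (h.δ_η hc)

/-- The elements of the form `δ w`. -/
noncomputable def rangeδ (R : Bires X) (U : X.Opens) : ∀ i j : ℕ, AddSubgroup (R.A i j U)
  | 0, _ => ⊥
  | i + 1, j => (R.δ i j).range

/-- The elements of the form `η w`. -/
noncomputable def rangeη (R : Bires X) (U : X.Opens) : ∀ i j : ℕ, AddSubgroup (R.A i j U)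
  | _, 0 => ⊥
  | i, j + 1 => (R.η i j).range

theorem res_mem_rangeδ (h : V ≤ U) {x : R.A i j U} (hx : x ∈ R.rangeδ U i j) :
    localHom.res h x ∈ R.rangeδ V i j := by
  cases i with
  | zero =>
    obtain rfl : x = 0 := hx
    exact zero_mem _
  | succ i =>
    obtain ⟨y, rfl⟩ := hx
    exact ⟨localHom.res h y, rfl⟩

theorem η_of_mem_rangeη {x : R.A i j U} (hx : x ∈ R.rangeη U i j) : R.η _ _ x = 0 := by
  cases j with
  | zero =>
    obtain rfl : x = 0 := hx
    exact map_zero _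
  | succ i =>
    obtain ⟨y, rfl⟩ := hx
    exact η_η y

theorem δ_of_mem_rangeδ {x : R.A i j U} (hx : x ∈ R.rangeδ U i j) : R.δ _ _ x = 0 := by
  cases i with
  | zero =>
    obtain rfl : x = 0 := hx
    exact map_zero _
  | succ i =>
    obtain ⟨y, rfl⟩ := hx
    exact δ_δ y

theorem mem_rangeδ {x : R.A i (j + 1) U} (hx : R.δ _ _ x = 0) : x ∈ R.rangeδ U i (j + 1) := by
  cases i with
  | zero => exact eq_zero_of_δ hx
  | succ i => exact exists_δ_eq hx

theorem exists_mem_rangeη {x : R.A (i + 1) j U} (hx : R.η _ _ x = 0) (p : X) (hp : p ∈ U) :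
    ∃ (V : X.Opens) (hV : V ≤ U), p ∈ V ∧ localHom.res hV x ∈ R.rangeη V (i + 1) j := by
  cases j with
  | zero =>
    obtain rfl : x = 0 := eq_zero_of_η hx
    exact ⟨U, le_rfl, hp, zero_mem _⟩
  | succ j => exact exists_η_eq hx p hp

/-- Induction along the zigzag. If y = δv + w with ηw = 0, then δx = ηy = δηv, so x − ηv is
annihilated by δ and hence lies in the range of δ. -/
theorem Zig.exists_of_mem_rangeδ {x : R.A i j U} (h : Zig c i j x) (hc : c ∈ R.rangeδ U m 0) :
    ∃ w ∈ R.rangeδ U i j, ∃ w' ∈ R.rangeη U i j, x = w + w' := by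
  induction h with
  | base => exact ⟨c, hc, 0, zero_mem _, (add_zero c).symm⟩
  | @step i j x y hxy _ ih =>
    obtain ⟨_, ⟨v, rfl⟩, w, hw, rfl⟩ := ih
    rw [map_add, η_of_mem_rangeη hw, add_zero, ← Bires.δ_η, ← sub_eq_zero, ← map_sub] at hxy
    exact ⟨x - R.η _ _ v, mem_rangeδ hxy, R.η _ _ v, ⟨v, rfl⟩, (sub_add_cancel _ _).symm⟩

/-- The class of a zigzag starting at a coboundary vanishes. -/
theorem Zig.mem_rangeη {x : R.A 0 j U} (h : Zig c 0 j x) (hc : c ∈ R.rangeδ U m 0) :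
    x ∈ R.rangeη U 0 j := by
  obtain ⟨w, hw, w', hw', rfl⟩ := h.exists_of_mem_rangeδ hc
  obtain rfl : w = 0 := hw
  rwa [zero_add]

/-- The same argument run backwards, with the roles of δ and η exchanged; shrinking is needed
because η is exact only locally. -/
theorem Zig.exists_mem_rangeδ {x : R.A i j U} (h : Zig c i j x) (p : X)
    (hx : ∃ (V : X.Opens) (hV : V ≤ U), p ∈ V ∧
      ∃ w ∈ R.rangeδ V i j, ∃ w' ∈ R.rangeη V i j, localHom.res hV x = w + w') :
    ∃ (V : X.Opens) (hV : V ≤ U), p ∈ V ∧ localHom.res hV c ∈ R.rangeδ V m 0 := by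
  induction h with
  | base =>
    obtain ⟨V, hV, hpV, w, hw, w', hw', h⟩ := hx
    obtain rfl : w' = 0 := hw'
    rw [add_zero] at h
    exact ⟨V, hV, hpV, h ▸ hw⟩
  | @step i j x y hxy _ ih =>
    obtain ⟨V, hV, hpV, w, hw, _, ⟨v, rfl⟩, h⟩ := hx
    apply ih
    have h1 : R.η _ _ (localHom.res hV y - R.δ _ _ v) = 0 := by
      rw [map_sub, ← res_η, ← hxy, res_δ, h, map_add, δ_of_mem_rangeδ hw, zero_add]
      exact sub_self _
    obtain ⟨W, hW, hpW, h2⟩ := exists_mem_rangeη h1 p hpV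
    refine ⟨W, hW.trans hV, hpW, R.δ _ _ (localHom.res hW v), ⟨_, rfl⟩, _, h2, ?_⟩
    rw [map_sub]
    exact (add_sub_cancel (localHom.res hW (R.δ _ _ v)) _).symm

/-- Zigzags exist locally, starting from the other side. -/
theorem exists_zig_of_η (j : ℕ) : ∀ (i m : ℕ) (U : X.Opens) (x : R.A i j U), i + j = m →
    R.η _ _ (R.δ _ _ x) = 0 → ∀ p ∈ U, ∃ (V : X.Opens) (hV : V ≤ U), p ∈ V ∧
      ∃ c : R.A m 0 V, R.δ _ _ c = 0 ∧ Zig c i j (localHom.res hV x) := by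
  induction j with
  | zero =>
    intro i m U x h hx p hp
    obtain rfl : i = m := h
    exact ⟨U, le_rfl, hp, x, eq_zero_of_η hx, .base⟩
  | succ j ih =>
    intro i m U x h hx p hp
    obtain ⟨V, hV, hpV, y, hy⟩ := exists_η_eq hx p hp
    obtain ⟨W, hW, hpW, c, hc, hz⟩ := ih (i + 1) m V y (by omega)
      ((congrArg (R.δ (i + 1) (j + 1)) hy).trans
        (δ_δ (localHom.res hV x) : R.δ _ _ (R.δ i (j + 1) (localHom.res hV x)) = 0)) p hpV
    refine ⟨W, hW.trans hV, hpW, c, hc, .step _ _ ?_ hz⟩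
    exact (congrArg (localHom.res hW) hy).symm

end Bires

/-! ### Cohomology of complexes of sheaves of abelian groups, on sections -/

section AbSheaf

variable {X : TopCat.{u}} {P Q R : TopCat.Sheaf AddCommGrpCat.{u} X} {U V W : Opens X}

/-- Restriction of sections of a sheaf of abelian groups. -/
noncomputable def abres (P : TopCat.Sheaf AddCommGrpCat.{u} X) (h : V ≤ U) :
    P.obj.obj (op U) →+ P.obj.obj (op V) := (P.obj.map (homOfLE h).op).hom

/-- The map on sections of a morphism of sheaves of abelian groups. -/
noncomputable def abapp (f : P ⟶ Q) (U : Opens X) : P.obj.obj (op U) →+ Q.obj.obj (op U) :=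
  (f.hom.app (op U)).hom

@[simp]
theorem abres_abres (h : V ≤ U) (h' : W ≤ V) (s : P.obj.obj (op U)) :
    abres P h' (abres P h s) = abres P (h'.trans h) s := by
  change (P.obj.map _ ≫ P.obj.map _).hom s = _
  rw [← Functor.map_comp]
  rfl

theorem abapp_abres (f : P ⟶ Q) (h : V ≤ U) (s : P.obj.obj (op U)) :
    abapp f V (abres P h s) = abres Q h (abapp f U s) :=
  ConcreteCategory.congr_hom (f.hom.naturality (homOfLE h).op) s

theorem abapp_comp (f : P ⟶ Q) (g : Q ⟶ R) (s : P.obj.obj (op U)) :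
    abapp (f ≫ g) U s = abapp g U (abapp f U s) := rfl

theorem ab_ext {s t : P.obj.obj (op U)}
    (h : ∀ x ∈ U, ∃ (V : Opens X) (hV : V ≤ U), x ∈ V ∧ abres P hV s = abres P hV t) : s = t := by
  choose V hV hx hs using h
  exact TopCat.Sheaf.eq_of_locally_eq' P (fun x : U => V x.1 x.2) U (fun x => homOfLE (hV x.1 x.2))
    (fun x hxU => Opens.mem_iSup.2 ⟨⟨x, hxU⟩, hx x hxU⟩) s t (fun x => hs x.1 x.2)

/-- Taking sections over `U`. -/
noncomputable def absections (U : Opens X) :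
    TopCat.Sheaf AddCommGrpCat.{u} X ⥤ AddCommGrpCat.{u} :=
  sheafToPresheaf (Opens.grothendieckTopology X) AddCommGrpCat.{u} ⋙
    (evaluation _ _).obj (op U)

noncomputable instance : PreservesLimits (absections U) :=
  comp_preservesLimits (sheafToPresheaf (Opens.grothendieckTopology X) AddCommGrpCat.{u})
    ((evaluation _ _).obj (op U))

noncomputable instance : PreservesFiniteLimits (absections U) :=
  PreservesLimits.preservesFiniteLimits _

instance : (absections U).Additive where
  map_add := rfl

theorem abapp_injective (f : P ⟶ Q) [Mono f] (U : Opens X) : Function.Injective (abapp f U) :=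
  (AddCommGrpCat.mono_iff_injective ((absections U).map f)).1 inferInstance

/-- Taking sections is left exact, so no shrinking is needed when the first map is a monomorphism.
-/
theorem exists_abapp_eq {S : ShortComplex (TopCat.Sheaf AddCommGrpCat.{u} X)} (hS : S.Exact)
    [Mono S.f] (t : S.X₂.obj.obj (op U)) (ht : abapp S.g U t = 0) : ∃ s, abapp S.f U s = t :=
  (ShortComplex.ab_exact_iff _).1
    (hS.map_of_mono_of_preservesKernel (absections U) ‹_› inferInstance) t ht

theorem exists_abapp_eq_of_epi (f : P ⟶ Q) [Epi f] (t : Q.obj.obj (op U)) (x : X) (hx : x ∈ U) :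
    ∃ (V : Opens X) (hV : V ≤ U), x ∈ V ∧ ∃ s, abapp f V s = abres Q hV t := by
  have h := (TopCat.Sheaf.isLocallySurjective_iff_epi f).2 inferInstance
  obtain ⟨V, hV, ⟨s, hs⟩, hxV⟩ := (TopCat.Presheaf.isLocallySurjective_iff f.hom).1 h U t x hx
  exact ⟨V, hV, hxV, s, hs⟩

/-- The lift to the sheaf of cycles exists over U; only the epimorphism onto the cycles forces a
smaller neighbourhood. -/
theorem exists_abapp_eq_of_exact {S : ShortComplex (TopCat.Sheaf AddCommGrpCat.{u} X)}
    (hS : S.Exact) (t : S.X₂.obj.obj (op U)) (ht : abapp S.g U t = 0) (x : X) (hx : x ∈ U) :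
    ∃ (V : Opens X) (hV : V ≤ U), x ∈ V ∧ ∃ s, abapp S.f V s = abres S.X₂ hV t := by
  let T := ShortComplex.mk S.iCycles S.g S.iCycles_g
  have hT : T.Exact := T.exact_of_f_is_kernel S.cyclesIsKernel
  have : Mono T.f := inferInstanceAs (Mono S.iCycles)
  obtain ⟨z, rfl⟩ := exists_abapp_eq hT t ht
  have := (S.exact_iff_epi_toCycles).1 hS
  obtain ⟨V, hV, hxV, s, hs⟩ := exists_abapp_eq_of_epi S.toCycles z x hx
  refine ⟨V, hV, hxV, s, ?_⟩
  have h2 := congrArg (abapp S.iCycles V) hs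
  rw [← abapp_comp, S.toCycles_i, abapp_abres] at h2
  exact h2


/-! ### Cohomology classes of cocycles over open sets -/

section Cohomology

variable (D : CochainComplex (TopCat.Sheaf AddCommGrpCat.{u} X) ℕ) (p : ℕ)

/-- The cocycle `y` of `D` over `U` has cohomology class `s`. -/
def HasClass (y : (D.X p).obj.obj (op U)) (s : (D.homology p).obj.obj (op U)) : Prop :=
  ∃ z, abapp (D.iCycles p) U z = y ∧ abapp (D.homologyπ p) U z = s

variable {D p} {y y' : (D.X p).obj.obj (op U)} {s s' : (D.homology p).obj.obj (op U)}

theorem HasClass.res (h : HasClass D p y s) (hV : V ≤ U) :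
    HasClass D p (abres _ hV y) (abres _ hV s) := by
  obtain ⟨z, rfl, rfl⟩ := h
  exact ⟨abres _ hV z, abapp_abres _ _ _, abapp_abres _ _ _⟩

theorem HasClass.add (h : HasClass D p y s) (h' : HasClass D p y' s') :
    HasClass D p (y + y') (s + s') := by
  obtain ⟨z, rfl, rfl⟩ := h
  obtain ⟨z', rfl, rfl⟩ := h'
  exact ⟨z + z', map_add _ _ _, map_add _ _ _⟩

theorem HasClass.sub (h : HasClass D p y s) (h' : HasClass D p y' s') :
    HasClass D p (y - y') (s - s') := by
  obtain ⟨z, rfl, rfl⟩ := h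
  obtain ⟨z', rfl, rfl⟩ := h'
  exact ⟨z - z', map_sub _ _ _, map_sub _ _ _⟩

theorem HasClass.unique (h : HasClass D p y s) (h' : HasClass D p y s') : s = s' := by
  obtain ⟨z, rfl, rfl⟩ := h
  obtain ⟨z', hz, rfl⟩ := h'
  rw [abapp_injective (D.iCycles p) U hz]

theorem exists_hasClass (hy : abapp (D.d p (p + 1)) U y = 0) : ∃ s, HasClass D p y s := by
  let T := ShortComplex.mk (D.iCycles p) (D.d p (p + 1)) (D.iCycles_d p (p + 1))
  have hT : T.Exact := T.exact_of_f_is_kernel (D.cyclesIsKernel p (p + 1) (by simp))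
  have : Mono T.f := inferInstanceAs (Mono (D.iCycles p))
  obtain ⟨z, rfl⟩ := exists_abapp_eq hT y hy
  exact ⟨_, z, rfl, rfl⟩

theorem HasClass.d_eq_zero (h : HasClass D p y s) : abapp (D.d p (p + 1)) U y = 0 := by
  obtain ⟨z, rfl, rfl⟩ := h
  rw [← abapp_comp, D.iCycles_d]
  rfl

theorem exists_hasClass_local (s : (D.homology p).obj.obj (op U)) (x : X) (hx : x ∈ U) :
    ∃ (V : Opens X) (hV : V ≤ U), x ∈ V ∧ ∃ y, HasClass D p y (abres _ hV s) := by
  obtain ⟨V, hV, hxV, z, hz⟩ := exists_abapp_eq_of_epi (D.homologyπ p) s x hx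
  exact ⟨V, hV, hxV, _, z, rfl, hz⟩

theorem hasClass_d (w : (D.X p).obj.obj (op U)) :
    HasClass D (p + 1) (abapp (D.d p (p + 1)) U w) 0 := by
  refine ⟨abapp (D.toCycles p (p + 1)) U w, ?_, ?_⟩
  · rw [← abapp_comp, D.toCycles_i]
  · rw [← abapp_comp, D.toCycles_comp_homologyπ]
    rfl

theorem HasClass.exists_eq_d {y : (D.X (p + 1)).obj.obj (op U)} (h : HasClass D (p + 1) y 0)
    (x : X) (hx : x ∈ U) : ∃ (V : Opens X) (hV : V ≤ U), x ∈ V ∧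
      ∃ w, abapp (D.d p (p + 1)) V w = abres _ hV y := by
  obtain ⟨z, rfl, hz⟩ := h
  let T := ShortComplex.mk (D.toCycles p (p + 1)) (D.homologyπ (p + 1))
    (D.toCycles_comp_homologyπ p (p + 1))
  have hT : T.Exact := T.exact_of_g_is_cokernel (D.homologyIsCokernel p (p + 1) (by simp))
  obtain ⟨V, hV, hxV, w, hw⟩ := exists_abapp_eq_of_exact hT z hz x hx
  refine ⟨V, hV, hxV, w, ?_⟩
  have h2 := congrArg (abapp (D.iCycles (p + 1)) V) hw
  change abapp (D.iCycles (p + 1)) V (abapp (D.toCycles p (p + 1)) V w) = _ at h2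
  rw [← abapp_comp, D.toCycles_i, abapp_abres] at h2
  exact h2

end Cohomology

end AbSheaf
/-! ### Coboundaries over affine open subsets -/

namespace Bires

variable {X : Scheme.{u}} {R : Bires X} {U V W : X.Opens} {i : ℕ}

/-- The complex of `𝒪_X`-modules `ℋom(L_i, J^0)`. -/
noncomputable abbrev M (R : Bires X) (i : ℕ) : X.Modules := modHom (R.L i) (R.J 0)

/-- Its differential. -/
noncomputable abbrev dM (R : Bires X) (i : ℕ) : R.M i ⟶ R.M (i + 1) :=
  modHomPrecomp (R.dL i) (R.J 0)

theorem dM_dM (R : Bires X) (i : ℕ) : R.dM i ≫ R.dM (i + 1) = 0 :=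
  hom_ext_happ fun U s => δ_δ (modHomEquiv _ _ U s)

/-- The morphism from `ℋom(L_i, J^0)` to the subsheaf of coboundaries. -/
noncomputable def toIm (R : Bires X) (i : ℕ) : R.M i ⟶ (imSub (R.dM i)).toModules :=
  (imSub (R.dM i)).lift (R.dM i) fun U s _ hx => ⟨U, le_rfl, hx, s, (sres_self _ _).symm⟩

theorem toIm_ι : R.toIm i ≫ (imSub (R.dM i)).ι = R.dM i := SubSheaf.lift_ι _ _ _

theorem happ_toIm (s : Γ(R.M i, U)) :
    happ (imSub (R.dM i)).ι U (happ (R.toIm i) U s) = happ (R.dM i) U s := rfl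

theorem locSurj_toIm : LocSurj (R.toIm i) := by
  intro U t x hx
  obtain ⟨V, hV, hxV, s, hs⟩ := (imSub (R.dM i)).happ_ι_mem t x hx
  refine ⟨V, hV, hxV, s, (imSub (R.dM i)).happ_ι_injective ?_⟩
  rw [happ_toIm, hs, happ_sres]

theorem kernel_comp_toIm : kernel.ι (R.dM i) ≫ R.toIm i = 0 := by
  rw [← cancel_mono (imSub (R.dM i)).ι, Category.assoc, toIm_ι, kernel.condition, zero_comp]

theorem exists_of_toIm_eq_zero (V : X.Opens) (s : Γ(R.M i, V)) (hs : happ (R.toIm i) V s = 0) :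
    ∃ a, happ (kernel.ι (R.dM i)) V a = s :=
  exists_happ_kernel_ι_eq _ s (by rw [← happ_toIm, hs, map_zero])

/-- The index is i + 1 because `R.L 0` is the resolved sheaf, which is not assumed locally free. -/
theorem qcOn_M (hG : QCOn (R.J 0) V) : QCOn (R.M (i + 1)) V := (R.isLocallyFree i).qcOn_modHom hG

theorem qcOn_kernel_dM (hG : QCOn (R.J 0) V) : QCOn (kernel (R.dM (i + 1))) V := (qcOn_M hG).kernel (qcOn_M hG) _

/-- The image is the quotient of a quasi-coherent module by the quasi-coherent kernel of the
differential. -/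
theorem qcOn_im (hG : QCOn (R.J 0) V) : QCOn (imSub (R.dM (i + 1))).toModules V :=
  (qcOn_kernel_dM hG).of_cokernel (qcOn_M hG) (kernel.ι _) (R.toIm (i + 1))
    (injective_of_mono _) kernel_comp_toIm exists_of_toIm_eq_zero locSurj_toIm

/-- Over an affine open set, a local coboundary is a coboundary. -/
theorem mem_rangeδ_of_local (hG : QCOn (R.J 0) V) (hV : IsAffineOpen V) (c : R.A (i + 2) 0 V)
    (hc : ∀ x ∈ V, ∃ (W : X.Opens) (hW : W ≤ V), x ∈ W ∧
      localHom.res hW c ∈ R.rangeδ W (i + 2) 0) : c ∈ R.rangeδ V (i + 2) 0 := by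
  have hmem : (modHomEquiv _ _ V).symm c ∈ (imSub (R.dM (i + 1))).obj V := by
    intro x hx
    obtain ⟨W, hW, hxW, w, hw⟩ := hc x hx
    exact ⟨W, hW, hxW, (modHomEquiv _ _ W).symm w, hw⟩
  obtain ⟨t, ht⟩ := (imSub (R.dM (i + 1))).exists_happ_ι_eq hmem
  obtain ⟨w, rfl⟩ := surjective_of_qcOn_kernel hV (qcOn_kernel_dM hG) (kernel.ι _)
    (R.toIm (i + 1)) (injective_of_mono _) kernel_comp_toIm exists_of_toIm_eq_zero locSurj_toIm t
  exact ⟨modHomEquiv _ _ V w, ht⟩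

/-- Over an affine open set, cocycles which agree on overlaps up to local coboundaries are the
restrictions, up to local coboundaries, of one cocycle. -/
theorem exists_cocycle_of_local (hG : QCOn (R.J 0) V) (hV : IsAffineOpen V)
    (P : ∀ W : X.Opens, W ≤ V → R.A (i + 2) 0 W → Prop)
    (hP : ∀ x ∈ V, ∃ (W : X.Opens) (hW : W ≤ V), x ∈ W ∧ ∃ c, P W hW c ∧ R.δ _ _ c = 0)
    (hPP : ∀ W W' (hW : W ≤ V) (hW' : W' ≤ V) c c', P W hW c → P W' hW' c' →
      ∀ x ∈ W ⊓ W', ∃ (Y : X.Opens) (hY : Y ≤ W ⊓ W'), x ∈ Y ∧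
        localHom.res (hY.trans inf_le_left) c - localHom.res (hY.trans inf_le_right) c' ∈
          R.rangeδ Y (i + 2) 0) :
    ∃ c : R.A (i + 2) 0 V, R.δ _ _ c = 0 ∧ ∀ x ∈ V, ∃ (W : X.Opens) (hW : W ≤ V) (Y : X.Opens)
      (hY : Y ≤ W) (c' : _), x ∈ Y ∧ P W hW c' ∧
      localHom.res (hY.trans hW) c - localHom.res hY c' ∈ R.rangeδ Y (i + 2) 0 := by
  -- K is the sheaf of cocycles and the cokernel q of k below is the projection to the cohomology
  -- sheaf of ℋom(L_•, J^0).
  let K := kerSub (R.dM (i + 2))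
  let k : R.M (i + 1) ⟶ K.toModules := K.lift (R.dM (i + 1)) fun U s => by
    change happ (R.dM (i + 2)) U (happ (R.dM (i + 1)) U s) = 0
    rw [← happ_comp, dM_dM, happ_zero]
  have hk : ∀ (U : X.Opens) s, happ K.ι U (happ k U s) = happ (R.dM (i + 1)) U s :=
    fun _ _ => rfl
  have himK : ∀ (U : X.Opens) (s : Γ((imSub (R.dM (i + 1))).toModules, U)),
      happ (imSub (R.dM (i + 1))).ι U s ∈ K.obj U := by
    intro U s
    refine K.loc fun x hx => ?_
    obtain ⟨W, hW, hxW, w, hw⟩ := (imSub (R.dM (i + 1))).happ_ι_mem s x hx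
    refine ⟨W, hW, hxW, ?_⟩
    rw [← hw]
    exact K.happ_ι_mem (happ k W w)
  let l : (imSub (R.dM (i + 1))).toModules ⟶ K.toModules := K.lift _ himK
  have hl : ∀ (U : X.Opens) s, happ K.ι U (happ l U s) = happ (imSub (R.dM (i + 1))).ι U s :=
    fun _ _ => rfl
  let q := cokernel.π k
  have hexact : LocExact k q := locExact_of_exact (S := ShortComplex.mk k q (cokernel.condition k))
    (ShortComplex.exact_cokernel k)
  have hlk : R.toIm (i + 1) ≫ l = k := by
    rw [← cancel_mono K.ι]
    rfl
  have hlq : l ≫ q = 0 := by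
    have : Epi (R.toIm (i + 1)) := epi_of_locSurj locSurj_toIm
    rw [← cancel_epi (R.toIm (i + 1)), ← Category.assoc, hlk, cokernel.condition, comp_zero]
  have hkz : ∀ (U : X.Opens) (w : Γ(R.M (i + 1), U)), happ q U (happ k U w) = 0 := fun U w => by
    rw [← happ_comp, cokernel.condition, happ_zero]
  have hker : ∀ (U : X.Opens) (s : Γ(K.toModules, U)), happ q U s = 0 → ∀ x ∈ U,
      ∃ (W : X.Opens) (hW : W ≤ U), x ∈ W ∧
        localHom.res hW (modHomEquiv _ _ U (happ K.ι U s)) ∈ R.rangeδ W (i + 2) 0 := by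
    intro U s hs x hx
    obtain ⟨W, hW, hxW, w, hw⟩ := hexact U s hs x hx
    refine ⟨W, hW, hxW, modHomEquiv _ _ W w, ?_⟩
    have := congrArg (happ K.ι W) hw
    rw [hk, happ_sres] at this
    exact this
  -- The kernel of q is the sheaf of coboundaries, which is quasi-coherent, so cohomology sections
  -- over the affine V lift to cocycles.
  have hsurj : Function.Surjective (happ q V) := by
    refine surjective_of_qcOn_kernel hV (qcOn_im hG) l q (fun U a b hab => ?_) hlq ?_
      (locSurj_of_epi q)
    · apply (imSub (R.dM (i + 1))).happ_ι_injective
      rw [← hl, hab, hl]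
    · intro U s hs
      have hmem : happ K.ι U s ∈ (imSub (R.dM (i + 1))).obj U := by
        intro x hx
        obtain ⟨W, hW, hxW, w, hw⟩ := hker U s hs x hx
        exact ⟨W, hW, hxW, (modHomEquiv _ _ W).symm w, hw⟩
      obtain ⟨a, ha⟩ := (imSub (R.dM (i + 1))).exists_happ_ι_eq hmem
      exact ⟨a, K.happ_ι_injective (by rw [hl, ha])⟩
  -- The local cocycles agree in the cohomology sheaf, where they glue although they need not glue
  -- themselves.
  obtain ⟨t, ht⟩ := section_glue_nhds (F := cokernel k) (U := V)
    (fun W hW t => ∃ s, P W hW (modHomEquiv _ _ W (happ K.ι W s)) ∧ happ q W s = t)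
    (fun x hx => by
      obtain ⟨W, hW, hxW, c, hc, hδ⟩ := hP x hx
      obtain ⟨s, hs⟩ := K.exists_happ_ι_eq (U := W) (s := (modHomEquiv _ _ W).symm c) hδ
      refine ⟨W, hW, hxW, happ q W s, s, ?_, rfl⟩
      rw [hs]
      exact hc)
    (by
      rintro W W' hW hW' _ _ ⟨s, hs, rfl⟩ ⟨s', hs', rfl⟩
      rw [← happ_sres, ← happ_sres, ← sub_eq_zero, ← map_sub]
      refine section_ext fun x hx => ?_
      obtain ⟨Y, hY, hxY, w, hw⟩ := hPP _ _ _ _ _ _ hs hs' x hx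
      refine ⟨Y, hY, hxY, ?_⟩
      rw [map_zero, ← happ_sres, map_sub, sres_sres, sres_sres]
      rw [← hkz Y ((modHomEquiv _ _ Y).symm w)]
      congr 1
      apply K.happ_ι_injective
      rw [hk, map_sub, happ_sres, happ_sres]
      exact hw.symm)
  obtain ⟨s, rfl⟩ := hsurj t
  refine ⟨modHomEquiv _ _ V (happ K.ι V s), K.happ_ι_mem s, fun x hx => ?_⟩
  obtain ⟨W, hW, hxW, s', hs', he⟩ := ht x hx
  rw [← happ_sres, eq_comm, ← sub_eq_zero, ← map_sub] at he
  obtain ⟨Y, hY, hxY, hw⟩ := hker W _ he x hxW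
  refine ⟨W, hW, Y, hY, _, hxY, hs', ?_⟩
  rw [map_sub, happ_sres] at hw
  exact hw

end Bires
/-! ### Sections of the Ext sheaves and zigzags -/

section ExtClass

variable {X : Scheme.{u}} {F G : X.Modules}

/-- The terms of an injective resolution, augmented by the resolved object. -/
noncomputable def augObj (I : InjectiveResolution G) : ℕ → X.Modules
  | 0 => G
  | j + 1 => I.cocomplex.X j

/-- The differential of an augmented injective resolution. -/
noncomputable def augD (I : InjectiveResolution G) : ∀ j, augObj I j ⟶ augObj I (j + 1)
  | 0 => I.ι.f 0
  | j + 1 => I.cocomplex.d j (j + 1)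

theorem LocallyFreeResolution.locExact (E : LocallyFreeResolution F) (i : ℕ) :
    LocExact ((E.complex.augment E.aug E.d_comp_aug).d (i + 2) (i + 1))
      ((E.complex.augment E.aug E.d_comp_aug).d (i + 1) i) := by
  have h := E.exact (i + 1)
  rw [HomologicalComplex.exactAt_iff' _ (i + 2) (i + 1) i (by simp) (by simp)] at h
  exact locExact_of_exact h

theorem LocallyFreeResolution.locSurj (E : LocallyFreeResolution F) :
    LocSurj ((E.complex.augment E.aug E.d_comp_aug).d 1 0) := by
  have h := E.exact 0
  rw [HomologicalComplex.exactAt_iff' _ 1 0 0 (by simp) (by simp)] at h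
  have h0 := locExact_of_exact h
  intro U t x hx
  refine h0 U t ?_ x hx
  have : (E.complex.augment E.aug E.d_comp_aug).d 0 0 = 0 :=
    HomologicalComplex.shape _ _ _ (by simp)
  exact congrArg (fun f => happ f U t) this

/-- The two resolutions used to compute the Ext sheaves. -/
noncomputable def bires (E : LocallyFreeResolution F) (I : InjectiveResolution G) : Bires X where
  L i := (E.complex.augment E.aug E.d_comp_aug).X i
  dL i := (E.complex.augment E.aug E.d_comp_aug).d (i + 1) i
  J := augObj I
  dJ := augD I
  dL_dL i := HomologicalComplex.d_comp_d _ _ _ _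
  dJ_dJ j := by
    cases j with
    | zero => exact I.ι_f_zero_comp_complex_d
    | succ j => exact HomologicalComplex.d_comp_d _ _ _ _
  exactL := E.locExact
  surjL := E.locSurj
  exactJ j := by
    cases j with
    | zero => exact locExact_of_exact I.exact₀
    | succ j => exact locExact_of_exact (I.exact_succ j)
  injJ U := by
    have : Mono (I.ι.f 0) := inferInstance
    exact injective_of_mono (I.ι.f 0) U
  injective j := I.injective j
  isLocallyFree i := E.isLocallyFree i

/-- The complex of sheaves `ℋom(F, I^•)`. -/
noncomputable abbrev homComplex (F : X.Modules) (I : InjectiveResolution G) :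
    CochainComplex (TopCat.Sheaf AddCommGrpCat.{u} X) ℕ :=
  ((sheafHom F).mapHomologicalComplex (ComplexShape.up ℕ)).obj I.cocomplex

variable {I : InjectiveResolution G} {U V W : X.Opens} {p : ℕ}

theorem HasClass.congr {X : TopCat.{u}} {U : Opens X}
    {D : CochainComplex (TopCat.Sheaf AddCommGrpCat.{u} X) ℕ} {p : ℕ}
    {y : (D.X p).obj.obj (op U)} {s s' : (D.homology p).obj.obj (op U)} (h : HasClass D p y s)
    (hs : s = s') : HasClass D p y s' := hs ▸ h

/-- The sections of the Ext sheaves, computed with an injective resolution. -/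
noncomputable def extMap (F : X.Modules) (I : InjectiveResolution G) (p : ℕ) (U : X.Opens) :
    extSections F G p U →+ ((homComplex F I).homology p).obj.obj (op U) :=
  abapp (I.isoRightDerivedObj (sheafHom F) p).hom U

theorem extMap_injective : Function.Injective (extMap F I p U) :=
  abapp_injective (I.isoRightDerivedObj (sheafHom F) p).hom U

theorem extMap_surjective : Function.Surjective (extMap F I p U) := fun s =>
  ⟨abapp (I.isoRightDerivedObj (sheafHom F) p).inv U s,
    (abapp_comp (I.isoRightDerivedObj (sheafHom F) p).inv
      (I.isoRightDerivedObj (sheafHom F) p).hom s).symm.trans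
      (congrArg (fun f => abapp f U s) (Iso.inv_hom_id _))⟩

/-- Restriction of sections of the Ext sheaves. -/
noncomputable abbrev extRes (F G : X.Modules) (p : ℕ) (h : V ≤ U) :
    extSections F G p U →+ extSections F G p V := abres (extSheaf F G p) h

theorem extMap_extRes (h : V ≤ U) (s : extSections F G p U) :
    extMap F I p V (extRes F G p h s) = abres ((homComplex F I).homology p) h (extMap F I p U s) :=
  abapp_abres (I.isoRightDerivedObj (sheafHom F) p).hom h s

/-- The cocycle `z` of `ℋom(F, I^•)` over `U` represents the section `s` of the Ext sheaf. -/
def IsExtClass (I : InjectiveResolution G) (z : localHom F (I.cocomplex.X p) U)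
    (s : extSections F G p U) : Prop :=
  HasClass (homComplex F I) p z (extMap F I p U s)

theorem IsExtClass.res {z : localHom F (I.cocomplex.X p) U} {s : extSections F G p U}
    (h : IsExtClass I z s) (hV : V ≤ U) : IsExtClass I (localHom.res hV z) (extRes F G p hV s) :=
  (HasClass.res h hV).congr (extMap_extRes hV s).symm

theorem IsExtClass.add {z z' : localHom F (I.cocomplex.X p) U} {s s' : extSections F G p U}
    (h : IsExtClass I z s) (h' : IsExtClass I z' s') : IsExtClass I (z + z') (s + s') :=
  (HasClass.add h h').congr (map_add (extMap F I p U) s s').symm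

theorem IsExtClass.sub {z z' : localHom F (I.cocomplex.X p) U} {s s' : extSections F G p U}
    (h : IsExtClass I z s) (h' : IsExtClass I z' s') : IsExtClass I (z - z') (s - s') :=
  (HasClass.sub h h').congr (map_sub (extMap F I p U) s s').symm

theorem IsExtClass.unique {z : localHom F (I.cocomplex.X p) U} {s s' : extSections F G p U}
    (h : IsExtClass I z s) (h' : IsExtClass I z s') : s = s' :=
  extMap_injective (HasClass.unique h h')

theorem exists_isExtClass {z : localHom F (I.cocomplex.X p) U}
    (hz : localHom.postcomp (I.cocomplex.d p (p + 1)) z = 0) : ∃ s, IsExtClass I z s := by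
  obtain ⟨s, hs⟩ := exists_hasClass (D := homComplex F I) (p := p) (U := U) (y := z) hz
  obtain ⟨s, rfl⟩ := extMap_surjective s
  exact ⟨s, hs⟩

theorem IsExtClass.d_eq_zero {z : localHom F (I.cocomplex.X p) U} {s : extSections F G p U}
    (h : IsExtClass I z s) : localHom.postcomp (I.cocomplex.d p (p + 1)) z = 0 :=
  HasClass.d_eq_zero h

theorem exists_isExtClass_local (I : InjectiveResolution G) (s : extSections F G p U) (x : X)
    (hx : x ∈ U) : ∃ (V : X.Opens) (hV : V ≤ U), x ∈ V ∧
      ∃ z : localHom F (I.cocomplex.X p) V, IsExtClass I z (extRes F G p hV s) := by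
  obtain ⟨V, hV, hxV, y, hy⟩ := exists_hasClass_local (extMap F I p U s) x hx
  exact ⟨V, hV, hxV, y, hy.congr (extMap_extRes hV s).symm⟩

theorem isExtClass_d (w : localHom F (I.cocomplex.X p) U) :
    IsExtClass I (localHom.postcomp (I.cocomplex.d p (p + 1)) w) 0 :=
  (hasClass_d (D := homComplex F I) (p := p) w).congr (map_zero (extMap F I (p + 1) U)).symm

theorem IsExtClass.exists_eq_d {z : localHom F (I.cocomplex.X (p + 1)) U} (h : IsExtClass I z 0)
    (x : X) (hx : x ∈ U) : ∃ (V : X.Opens) (hV : V ≤ U), x ∈ V ∧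
      ∃ w : localHom F (I.cocomplex.X p) V,
        localHom.postcomp (I.cocomplex.d p (p + 1)) w = localHom.res hV z :=
  HasClass.exists_eq_d (HasClass.congr h (map_zero (extMap F I (p + 1) U))) x hx

/-- The cocycle `c` of `Hom(E_•|_U, G|_U)` represents the section `s` of the Ext sheaf. -/
def ZigClass (E : LocallyFreeResolution F) (I : InjectiveResolution G)
    (c : (bires E I).A (p + 1) 0 U) (s : extSections F G p U) : Prop :=
  ∃ z : (bires E I).A 0 (p + 1) U, Bires.Zig c 0 (p + 1) z ∧ IsExtClass I z s

variable {E : LocallyFreeResolution F} {c c' : (bires E I).A (p + 1) 0 U}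
  {s s' : extSections F G p U}

theorem ZigClass.res (h : ZigClass E I c s) (hV : V ≤ U) :
    ZigClass E I (localHom.res hV c) (extRes F G p hV s) := by
  obtain ⟨z, hz, hs⟩ := h
  exact ⟨_, hz.res hV, hs.res hV⟩

theorem ZigClass.add (h : ZigClass E I c s) (h' : ZigClass E I c' s') :
    ZigClass E I (c + c') (s + s') := by
  obtain ⟨z, hz, hs⟩ := h
  obtain ⟨z', hz', hs'⟩ := h'
  exact ⟨_, hz.add hz', hs.add hs'⟩

theorem ZigClass.sub (h : ZigClass E I c s) (h' : ZigClass E I c' s') :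
    ZigClass E I (c - c') (s - s') := by
  obtain ⟨z, hz, hs⟩ := h
  obtain ⟨z', hz', hs'⟩ := h'
  exact ⟨_, hz.sub hz', hs.sub hs'⟩

/-- The zigzag runs from `A (p + 1) 0`, the maps E_p ⟶ G, to `A 0 (p + 1)`, the maps F ⟶ I^p; the
indices are shifted by one because of the augmentations. -/
theorem exists_zigClass (hc : (bires E I).δ _ _ c = 0) : ∃ s, ZigClass E I c s := by
  obtain ⟨z, hz⟩ := Bires.exists_zig hc 0 (p + 1) (zero_add _)
  obtain ⟨s, hs⟩ := exists_isExtClass (I := I) (z := z) (hz.η_eq_zero hc)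
  exact ⟨s, z, hz, hs⟩

theorem exists_zigClass_local (E : LocallyFreeResolution F) (I : InjectiveResolution G)
    (s : extSections F G p U) (x : X) (hx : x ∈ U) :
    ∃ (V : X.Opens) (hV : V ≤ U), x ∈ V ∧ ∃ c : (bires E I).A (p + 1) 0 V,
      (bires E I).δ _ _ c = 0 ∧ ZigClass E I c (extRes F G p hV s) := by
  obtain ⟨V, hV, hxV, z, hz⟩ := exists_isExtClass_local I s x hx
  have h0 : (bires E I).η _ _ ((bires E I).δ 0 (p + 1) z) = 0 :=
    (congrArg ((bires E I).δ 0 (p + 2)) hz.d_eq_zero).trans (map_zero _)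
  obtain ⟨W, hW, hxW, c, hc, hcz⟩ := Bires.exists_zig_of_η (R := bires E I) (p + 1) 0 (p + 1) V z
    (zero_add _) h0 x hxV
  refine ⟨W, hW.trans hV, hxW, c, hc, _, hcz, ?_⟩
  have := hz.res hW
  rw [abres_abres] at this
  exact this

end ExtClass

/-! ### Ext sheaves in positive degree -/

section Positive

variable {X : Scheme.{u}} {F G : X.Modules} {I : InjectiveResolution G} {U V W : X.Opens} {p : ℕ}
variable {E : LocallyFreeResolution F} {c c' : (bires E I).A (p + 2) 0 U}
  {s s' : extSections F G (p + 1) U}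

/-- The zigzag of a coboundary ends at dw for some w : F ⟶ I^p over U. This needs a term of I^•
before the last one, hence the positive degree. -/
theorem ZigClass.eq_zero (h : ZigClass E I c s)
    (hc : c ∈ (bires E I).rangeδ U (p + 2) 0) : s = 0 := by
  obtain ⟨z, hz, hs⟩ := h
  obtain ⟨w, rfl⟩ := hz.mem_rangeη hc
  exact hs.unique (isExtClass_d w)

theorem ZigClass.exists_mem_rangeδ (h : ZigClass E I c 0) (x : X) (hx : x ∈ U) :
    ∃ (V : X.Opens) (hV : V ≤ U), x ∈ V ∧
      localHom.res hV c ∈ (bires E I).rangeδ V (p + 2) 0 := by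
  obtain ⟨z, hz, hs⟩ := h
  obtain ⟨V, hV, hxV, w, hw⟩ := hs.exists_eq_d x hx
  exact hz.exists_mem_rangeδ x ⟨V, hV, hxV, 0, zero_mem _, _, ⟨w, rfl⟩,
    hw.symm.trans (zero_add _).symm⟩

theorem ZigClass.mem_rangeδ (hG : QCOn G U) (hU : IsAffineOpen U) (h : ZigClass E I c 0) :
    c ∈ (bires E I).rangeδ U (p + 2) 0 :=
  Bires.mem_rangeδ_of_local (R := bires E I) hG hU c fun x hx => h.exists_mem_rangeδ x hx

/-- Over an affine open set, every section of the Ext sheaf is represented by a cocycle. -/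
theorem exists_zigClass_of_isAffineOpen (E : LocallyFreeResolution F) (I : InjectiveResolution G)
    (hG : QCOn G U) (hU : IsAffineOpen U) (s : extSections F G (p + 1) U) :
    ∃ c : (bires E I).A (p + 2) 0 U, (bires E I).δ _ _ c = 0 ∧ ZigClass E I c s := by
  obtain ⟨c, hc, h⟩ := Bires.exists_cocycle_of_local (R := bires E I) hG hU
    (fun W hW c => ZigClass E I c (extRes F G (p + 1) hW s))
    (fun x hx => by
      obtain ⟨W, hW, hxW, c, hc, hs⟩ := exists_zigClass_local E I s x hx
      exact ⟨W, hW, hxW, c, hs, hc⟩)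
    (fun W W' hW hW' c c' h h' x hx => by
      have h1 := (h.res (inf_le_left : W ⊓ W' ≤ W)).sub (h'.res (inf_le_right : W ⊓ W' ≤ W'))
      rw [abres_abres, abres_abres, sub_self] at h1
      obtain ⟨Y, hY, hxY, hc⟩ := h1.exists_mem_rangeδ x hx
      exact ⟨Y, hY, hxY, hc⟩)
  refine ⟨c, hc, ?_⟩
  -- The glued cocycle has some class; it equals s because near each point the cocycle differs by a
  -- coboundary from one representing s.
  obtain ⟨s', hs'⟩ := exists_zigClass hc
  obtain rfl : s' = s := by
    refine ab_ext fun x hx => ?_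
    obtain ⟨W, hW, Y, hY, c', hxY, hs, hcc'⟩ := h x hx
    refine ⟨Y, hY.trans hW, hxY, ?_⟩
    have h1 := ((hs'.res (hY.trans hW)).sub (hs.res hY)).eq_zero hcc'
    rw [abres_abres, sub_eq_zero] at h1
    exact h1
  exact hs'

end Positive

/-! ### From sections of the Ext sheaves to cohomology classes -/

section Phi

variable {X : Scheme.{u}} {F G : X.Modules} {E : LocallyFreeResolution F}
  {I : InjectiveResolution G} {U V : X.Opens} {p : ℕ}

/-- A morphism `E_p|_U ⟶ G|_U` as an element of the double complex. -/
noncomputable def toA (E : LocallyFreeResolution F) (I : InjectiveResolution G) (U : X.Opens)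
    (p : ℕ) : ((E.complexOn U).X p ⟶ G.restrict U.ι) ≃+ (bires E I).A (p + 1) 0 U :=
  restrictEquiv (E.complex.X p) G U

theorem toA_comp (h : (E.complexOn U).X p ⟶ G.restrict U.ι) :
    toA E I U (p + 1) ((E.complexOn U).d (p + 1) p ≫ h) =
      (bires E I).δ (p + 1) 0 (toA E I U p h) :=
  restrictEquiv_precomp (E.complex.d (p + 1) p) h

theorem mem_homCocycles_iff (c : (E.complexOn U).X p ⟶ G.restrict U.ι) :
    c ∈ homCocycles (E.complexOn U) (G.restrict U.ι) p ↔
      (bires E I).δ _ _ (toA E I U p c) = 0 := by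
  rw [← toA_comp, EmbeddingLike.map_eq_zero_iff]
  rfl

theorem mem_homCoboundaries_iff (c : (E.complexOn U).X (p + 1) ⟶ G.restrict U.ι) :
    c ∈ homCoboundaries (E.complexOn U) (G.restrict U.ι) (p + 1) ↔
      toA E I U (p + 1) c ∈ (bires E I).rangeδ U (p + 2) 0 := by
  constructor
  · rintro ⟨h, rfl⟩
    exact ⟨toA E I U p h, (toA_comp h).symm⟩
  · rintro ⟨h, hh⟩
    refine ⟨(toA E I U p).symm h, (toA E I U (p + 1)).injective ?_⟩
    refine (toA_comp (I := I) ((toA E I U p).symm h)).trans ?_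
    rw [AddEquiv.apply_symm_apply]
    exact hh

theorem homClass_eq_iff (c c' : homCocycles (E.complexOn U) (G.restrict U.ι) (p + 1)) :
    homClass c = homClass c' ↔
      toA E I U (p + 1) c.1 - toA E I U (p + 1) c'.1 ∈ (bires E I).rangeδ U (p + 2) 0 := by
  rw [← map_sub, ← mem_homCoboundaries_iff, homClass, homClass, eq_comm, QuotientAddGroup.eq,
    AddSubgroup.mem_addSubgroupOf, neg_add_eq_sub]
  rfl

/-- Cocycles are chosen over the affine V and only then restricted to U. Over V the choice is unique
up to coboundaries, which makes it additive modulo coboundaries. Changing the cocycle over U within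
its class does not change the section it represents, since coboundaries represent zero. -/
theorem exists_homCohomology_hom (E : LocallyFreeResolution F) (I : InjectiveResolution G)
    (hUV : U ≤ V) (hV : IsAffineOpen V) (hG : QCOn G V) (p : ℕ) :
    ∃ Φ : extSections F G (p + 1) ⊤ →+
        HomCohomology (E.complexOn U) (G.restrict U.ι) (p + 1),
      ∀ f c, homClass c = Φ f →
        ZigClass E I (toA E I U (p + 1) c.1) (extRes F G (p + 1) le_top f) := by
  choose c hc hcs using fun f : extSections F G (p + 1) ⊤ =>
    exists_zigClass_of_isAffineOpen E I hG hV (extRes F G (p + 1) le_top f)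
  let cU : extSections F G (p + 1) ⊤ → homCocycles (E.complexOn U) (G.restrict U.ι) (p + 1) :=
    fun f => ⟨(toA E I U (p + 1)).symm (localHom.res hUV (c f)), by
      rw [mem_homCocycles_iff (I := I), AddEquiv.apply_symm_apply, ← Bires.res_δ, hc, map_zero]⟩
  have hcU : ∀ f, toA E I U (p + 1) (cU f).1 = localHom.res hUV (c f) := fun f =>
    AddEquiv.apply_symm_apply _ _
  refine ⟨AddMonoidHom.mk' (fun f => homClass (cU f)) fun f g => ?_, fun f d hd => ?_⟩
  · change _ = homClass (cU f + cU g)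
    have key : toA E I U (p + 1) (cU (f + g)).1 - toA E I U (p + 1) (cU f + cU g).1 =
        localHom.res hUV (c (f + g) - (c f + c g)) := by
      refine (congrArg₂ (· - ·) (hcU (f + g)) ((map_add (toA E I U (p + 1)) _ _).trans
        (congrArg₂ (· + ·) (hcU f) (hcU g)))).trans ?_
      rfl
    have h0 := (hcs (f + g)).sub ((hcs f).add (hcs g))
    rw [map_add, sub_self] at h0
    rw [homClass_eq_iff (I := I), key]
    exact Bires.res_mem_rangeδ hUV (h0.mem_rangeδ hG hV)
  · replace hd : homClass d = homClass (cU f) := hd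
    rw [homClass_eq_iff (I := I), hcU] at hd
    obtain ⟨s, hs⟩ := exists_zigClass ((mem_homCocycles_iff (I := I) d.1).1 d.2)
    have h1 := (hcs f).res hUV
    rw [abres_abres] at h1
    have h2 := (hs.sub h1).eq_zero hd
    rw [sub_eq_zero] at h2
    rwa [h2] at hs

end Phi

/-! ### Pushout extensions represent the sections of the Ext sheaves -/

section Ladder

variable {A : Type v} [Category.{w} A] [Abelian A]

/-- A morphism into a complex of injective objects extends to a ladder. -/
theorem exists_ladder {S : ChainComplex A ℕ} (hS : ∀ i, S.ExactAt i) (Y : ℕ → A)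
    (e : ∀ j, Y j ⟶ Y (j + 1)) (he : ∀ j, e j ≫ e (j + 1) = 0) (hY : ∀ j, Injective (Y j))
    {p : ℕ} (b : S.X p ⟶ Y 0) (hb : S.d (p + 1) p ≫ b ≫ e 0 = 0) :
    ∃ ψ : ∀ i j : ℕ, i + j = p → (S.X i ⟶ Y j), ψ p 0 rfl = b ∧
      ∀ (i j : ℕ) (h : i + 1 + j = p), S.d (i + 1) i ≫ ψ i (j + 1) (by omega) =
        ψ (i + 1) j h ≫ e j := by
  -- One rung: ψ followed by e j vanishes on the image of S_{i+2}, so by exactness of S at i + 1 and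
  -- injectivity of Y (j + 1) it factors through S_{i+1} ⟶ S_i. The subtype carries the vanishing to
  -- the next rung.
  have step : ∀ (j i : ℕ) (ψ : {ψ : S.X (i + 1) ⟶ Y j // S.d (i + 2) (i + 1) ≫ ψ ≫ e j = 0}),
      ∃ ψ' : {ψ : S.X i ⟶ Y (j + 1) // S.d (i + 1) i ≫ ψ ≫ e (j + 1) = 0},
        S.d (i + 1) i ≫ ψ'.1 = ψ.1 ≫ e j := by
    intro j i ψ
    have h := hS (i + 1)
    rw [HomologicalComplex.exactAt_iff' _ (i + 2) (i + 1) i (by simp) (by simp)] at h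
    have := hY (j + 1)
    obtain ⟨g, h1⟩ : ∃ g : S.X i ⟶ Y (j + 1), S.d (i + 1) i ≫ g = ψ.1 ≫ e j :=
      ⟨h.descToInjective (ψ.1 ≫ e j) ψ.2, h.comp_descToInjective _ _⟩
    refine ⟨⟨g, ?_⟩, h1⟩
    rw [← Category.assoc, h1, Category.assoc, he, comp_zero]
  choose f hf using step
  let Ψ : ∀ j i : ℕ, i + j = p → {ψ : S.X i ⟶ Y j // S.d (i + 1) i ≫ ψ ≫ e j = 0} := fun j =>
    Nat.rec (motive := fun j => ∀ i : ℕ, i + j = p →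
        {ψ : S.X i ⟶ Y j // S.d (i + 1) i ≫ ψ ≫ e j = 0})
      (fun i h => by
        obtain rfl : i = p := h
        exact ⟨b, hb⟩)
      (fun j Ψ i h => f j i (Ψ (i + 1) (by omega))) j
  exact ⟨fun i j h => (Ψ j i h).1, rfl, fun i j h => hf j i (Ψ j (i + 1) h)⟩

end Ladder

/-! ### From pushout extensions to zigzags -/

section Represents

variable {X : Scheme.{u}} {F G : X.Modules} {E : LocallyFreeResolution F}
  {I : InjectiveResolution G} {U : X.Opens} {p : ℕ} {Y Y' : X.Modules}

/-- Morphisms out of the restricted augmented complex as local homomorphisms. -/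
noncomputable def toL (E : LocallyFreeResolution F) (Y : X.Modules) (U : X.Opens) : ∀ i : ℕ,
    (((E.complexOn U).augment (E.augOn U) (E.d_comp_augOn U)).X i ⟶ Y.restrict U.ι) ≃+
      localHom ((E.complex.augment E.aug E.d_comp_aug).X i) Y U
  | 0 => restrictEquiv F Y U
  | i + 1 => restrictEquiv (E.complex.X i) Y U

theorem toL_precomp (i : ℕ)
    (φ : ((E.complexOn U).augment (E.augOn U) (E.d_comp_augOn U)).X i ⟶ Y.restrict U.ι) :
    toL E Y U (i + 1)
      (((E.complexOn U).augment (E.augOn U) (E.d_comp_augOn U)).d (i + 1) i ≫ φ) =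
      localHom.precomp ((E.complex.augment E.aug E.d_comp_aug).d (i + 1) i) (toL E Y U i φ) := by
  cases i with
  | zero => exact restrictEquiv_precomp E.aug φ
  | succ i => exact restrictEquiv_precomp (E.complex.d (i + 1) i) φ

theorem toL_postcomp (i : ℕ) (g : Y ⟶ Y')
    (φ : ((E.complexOn U).augment (E.augOn U) (E.d_comp_augOn U)).X i ⟶ Y.restrict U.ι) :
    toL E Y' U i (φ ≫ (Scheme.Modules.restrictFunctor U.ι).map g) =
      localHom.postcomp g (toL E Y U i φ) := by
  cases i with
  | zero => exact restrictEquiv_postcomp g φ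
  | succ i => exact restrictEquiv_postcomp g φ

/-- Of the pushout property only the morphism t with its two end components is used: it pulls a
ladder on S back to a zigzag starting at c. -/
theorem represents_of_zigClass {c : homCocycles (E.complexOn U) (G.restrict U.ι) (p + 1)}
    {S : LengthExtension (p + 1) (G.restrict U.ι) (F.restrict U.ι)}
    (hS : IsPushoutExtension (E.complexOn U) (E.augOn U) (E.d_comp_augOn U) c S)
    {s : extSections F G (p + 1) U} (hs : ZigClass E I (toA E I U (p + 1) c.1) s) :
    Represents S s := by
  obtain ⟨t, ht0, -, htc, -⟩ := hS
  have hinj : ∀ j, Injective ((I.cocomplex.X j).restrict U.ι) := fun j => by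
    have := I.injective j
    infer_instance
  have hmono : Mono (S.complex.d (p + 2) (p + 1)) := by
    have h := S.exact (p + 2)
    rw [HomologicalComplex.exactAt_iff' _ (p + 3) (p + 2) (p + 1) (by simp) (by simp)] at h
    exact h.mono_g ((S.isZero (p + 3) (by omega)).eq_of_src _ _)
  let ε : G.restrict U.ι ⟶ (I.cocomplex.X 0).restrict U.ι := (Scheme.Modules.restrictFunctor U.ι).map (I.ι.f 0)
  let e : ∀ j, (I.cocomplex.X j).restrict U.ι ⟶ (I.cocomplex.X (j + 1)).restrict U.ι :=
    fun j => (Scheme.Modules.restrictFunctor U.ι).map (I.cocomplex.d j (j + 1))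
  have hεe : ε ≫ e 0 = 0 := by
    refine (Functor.map_comp _ _ _).symm.trans ?_
    exact (congrArg (Scheme.Modules.restrictFunctor U.ι).map I.ι_f_zero_comp_complex_d).trans
      (Functor.map_zero _ _ _)
  obtain ⟨b, hb⟩ : ∃ b, S.complex.d (p + 2) (p + 1) ≫ b = S.left.hom ≫ ε :=
    ⟨Injective.factorThru (J := (I.cocomplex.X 0).restrict U.ι) (S.left.hom ≫ ε)
      (S.complex.d (p + 2) (p + 1)), Injective.comp_factorThru _ _⟩
  obtain ⟨ψ, hψ0, hψ⟩ := exists_ladder S.exact (fun j => (I.cocomplex.X j).restrict U.ι) e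
    (fun j => by
      refine (Functor.map_comp _ _ _).symm.trans ?_
      rw [HomologicalComplex.d_comp_d, Functor.map_zero]) hinj b (by
      rw [← Category.assoc, hb, Category.assoc]
      rw [hεe, comp_zero])
  -- The component (i, j) of the ladder sits at (i, j + 1) in the double complex, since `J 0` is G.
  -- As t commutes with differentials, the ladder squares become the zigzag relations.
  have hzig : ∀ (j i : ℕ) (h : i + j = p + 1), Bires.Zig (R := bires E I)
      (toA E I U (p + 1) c.1) i (j + 1)
      (toL E (I.cocomplex.X j) U i (t.f i ≫ ψ i j h)) := by
    intro j
    induction j with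
    | zero =>
      intro i h
      obtain rfl : i = p + 1 := h
      refine .step _ _ ?_ .base
      refine (toL_precomp (p + 1) (t.f (p + 1) ≫ ψ (p + 1) 0 rfl)).symm.trans ?_
      refine Eq.trans ?_ (toL_postcomp (p + 2) (I.ι.f 0) c.1)
      rw [← Category.assoc, ← t.comm, Category.assoc, hψ0, hb, ← Category.assoc]
      exact congrArg (fun f => toL E _ U (p + 2) (f ≫ ε)) htc
    | succ j ih =>
      intro i h
      refine .step _ _ ?_ (ih (i + 1) (by omega))
      refine (toL_precomp i (t.f i ≫ ψ i (j + 1) h)).symm.trans ?_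
      refine Eq.trans ?_ (toL_postcomp (i + 1) (I.cocomplex.d j (j + 1)) _)
      rw [← Category.assoc, ← t.comm, Category.assoc, hψ, Category.assoc]
  have hz := hzig (p + 1) 0 (zero_add _)
  obtain ⟨s', hs'⟩ := exists_isExtClass (I := I)
    (hz.η_eq_zero ((mem_homCocycles_iff (I := I) c.1).1 c.2))
  -- Both classes come from zigzags starting at c; the difference starts at 0, a coboundary, and so
  -- represents zero.
  have hss' : s' = s := by
    have h1 : ZigClass E I (toA E I U (p + 1) c.1) s' := ⟨_, hz, hs'⟩
    have h2 := (h1.sub hs).eq_zero (by rw [sub_self]; exact zero_mem _)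
    exact sub_eq_zero.1 h2
  subst hss'
  have ht0' : t.f 0 = S.right.inv := (Iso.comp_hom_eq_id S.right).1 ht0
  refine ⟨I, ψ, by rw [hψ0]; exact hb, hψ, ?_⟩
  obtain ⟨z, hz1, hz2⟩ := hs'
  refine ⟨z, fun V => ?_, hz2⟩
  have h1 := congrArg (fun w : localHom F (I.cocomplex.X (p + 1)) U =>
    w.1 ⟨U.ι ''ᵁ V, U.ι_image_le V⟩) hz1
  refine Eq.trans h1 ?_
  rw [← ht0']
  ext s
  exact lapp_restrictEquiv (F := F) (t.f 0 ≫ ψ 0 (p + 1) (zero_add _)) V s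

end Represents

/-! ### Existence and uniqueness of pushout extensions -/

/-- Precomposing both legs with an epimorphism does not change the cocones. This replaces the
cokernel K_p by C_p in the pushout squares. -/
theorem IsPushout.of_epi_comp {A : Type v} [Category.{w} A] {X Y Z P : A} {f : X ⟶ Y} {g : X ⟶ Z}
    {i : Y ⟶ P} {j : Z ⟶ P} {X' : A} {e : X' ⟶ X} [Epi e] (h : IsPushout (e ≫ f) (e ≫ g) i j) :
    IsPushout f g i j := by
  have w : f ≫ i = g ≫ j := by
    rw [← cancel_epi e, ← Category.assoc, h.w, Category.assoc]
  refine ⟨⟨w⟩, ⟨PushoutCocone.IsColimit.mk w (fun s => h.desc s.inl s.inr (by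
    rw [Category.assoc, s.condition, Category.assoc])) (fun s => h.inl_desc _ _ _)
    (fun s => h.inr_desc _ _ _) fun s m h1 h2 => h.hom_ext ?_ ?_⟩⟩
  · rw [h1, h.inl_desc]
  · rw [h2, h.inr_desc]

theorem IsPushout.epi_comp {A : Type v} [Category.{w} A] {X Y Z P : A} {f : X ⟶ Y} {g : X ⟶ Z}
    {i : Y ⟶ P} {j : Z ⟶ P} {X' : A} (e : X' ⟶ X) [Epi e] (h : IsPushout f g i j) :
    IsPushout (e ≫ f) (e ≫ g) i j := by
  have w : (e ≫ f) ≫ i = (e ≫ g) ≫ j := by rw [Category.assoc, h.w, Category.assoc]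
  refine ⟨⟨w⟩, ⟨PushoutCocone.IsColimit.mk w (fun s => h.desc s.inl s.inr (by
    rw [← cancel_epi e, ← Category.assoc, s.condition, Category.assoc]))
    (fun s => h.inl_desc _ _ _)
    (fun s => h.inr_desc _ _ _) fun s m h1 h2 => h.hom_ext ?_ ?_⟩⟩
  · rw [h1, h.inl_desc]
  · rw [h2, h.inr_desc]

section PushoutExtension

variable {A : Type v} [Category.{w} A] [Abelian A]

/-- `X ⟶ Y ⟶ Z` is an exact sequence. -/
def ExactPair {X Y Z : A} (f : X ⟶ Y) (g : Y ⟶ Z) : Prop :=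
  ∃ w : f ≫ g = 0, (ShortComplex.mk f g w).Exact

theorem ExactPair.exists_lift {X Y Z : A} {f : X ⟶ Y} {g : Y ⟶ Z} (h : ExactPair f g) {T : A}
    (y : T ⟶ Y) (hy : y ≫ g = 0) :
    ∃ (T' : A) (π : T' ⟶ T) (_ : Epi π) (x : T' ⟶ X), π ≫ y = x ≫ f :=
  (ShortComplex.exact_iff_exact_up_to_refinements _).1 h.2 y hy

theorem exactPair_of_lift {X Y Z : A} {f : X ⟶ Y} {g : Y ⟶ Z} (w : f ≫ g = 0)
    (h : ∀ (T : A) (y : T ⟶ Y), y ≫ g = 0 →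
      ∃ (T' : A) (π : T' ⟶ T) (_ : Epi π) (x : T' ⟶ X), π ≫ y = x ≫ f) : ExactPair f g :=
  ⟨w, (ShortComplex.exact_iff_exact_up_to_refinements _).2 h⟩

variable {X Y Z P : A} {f : X ⟶ Y} {g : X ⟶ Z} {i : Y ⟶ P} {j : Z ⟶ P}

theorem IsPushout.exists_refinement (h : IsPushout f g i j) {T : A} (x : T ⟶ P) :
    ∃ (T' : A) (π : T' ⟶ T) (_ : Epi π) (y : T' ⟶ Y) (z : T' ⟶ Z), π ≫ x = y ≫ i + z ≫ j := by
  have : Epi (biprod.desc i j) := h.epi_shortComplex_g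
  obtain ⟨T', π, hπ, y, hy⟩ := surjective_up_to_refinements_of_epi (biprod.desc i j) x
  exact ⟨T', π, hπ, y ≫ biprod.fst, y ≫ biprod.snd, by rw [hy, biprod.desc_eq]; simp⟩

theorem IsPushout.exists_refinement_of_eq_zero (h : IsPushout f g i j) {T : A} (z : T ⟶ Z)
    (hz : z ≫ j = 0) :
    ∃ (T' : A) (π : T' ⟶ T) (_ : Epi π) (x : T' ⟶ X), x ≫ f = 0 ∧ π ≫ z = - (x ≫ g) := by
  have hex : ExactPair (biprod.lift f (-g)) (biprod.desc i j) := ⟨_, h.exact_shortComplex⟩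
  obtain ⟨T', π, hπ, x, hx⟩ := hex.exists_lift (z ≫ biprod.inr) (by simp [hz])
  refine ⟨T', π, hπ, x, ?_, ?_⟩
  · have := congrArg (· ≫ biprod.fst) hx
    simpa using this.symm
  · have := congrArg (· ≫ biprod.snd) hx
    simpa using this

/-- Changing one of the two morphisms of a pushout square by a morphism which extends to the
opposite corner. -/
theorem IsPushout.add {g' : X ⟶ Z} (h : IsPushout f g' i j) (k : Y ⟶ Z) (hk : g = g' + f ≫ k) :
    IsPushout f g (i + k ≫ j) j := by
  subst hk
  have w : f ≫ (i + k ≫ j) = (g' + f ≫ k) ≫ j := by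
    rw [Preadditive.comp_add, Preadditive.add_comp, h.w, Category.assoc]
  refine ⟨⟨w⟩, ⟨PushoutCocone.IsColimit.mk w (fun s => h.desc (s.inl - k ≫ s.inr) s.inr (by
    rw [Preadditive.comp_sub, s.condition, Preadditive.add_comp, Category.assoc,
      add_sub_cancel_right]))
    (fun s => by rw [Preadditive.add_comp, h.inl_desc, Category.assoc, h.inr_desc, sub_add_cancel])
    (fun s => h.inr_desc _ _ _) fun s m h1 h2 => h.hom_ext ?_ ?_⟩⟩
  · rw [h.inl_desc, ← h1, ← h2, Preadditive.add_comp, Category.assoc, add_sub_cancel_right]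
  · rw [h2, h.inr_desc]

/-- The data of a pushout extension, with the sheaf on the right split off. -/
theorem exists_pushout_sequence {N : A} : ∀ (q : ℕ) (M : A) (C : ℕ → A) (dC : ∀ n, C (n + 1) ⟶ C n)
    (aug : C 0 ⟶ M), ExactPair (dC 0) aug → (∀ n, ExactPair (dC (n + 1)) (dC n)) →
    ∀ c : C (q + 1) ⟶ N, dC (q + 1) ≫ c = 0 →
    ∃ (Y : ℕ → A) (dY : ∀ n, Y (n + 1) ⟶ Y n) (d₀ : Y 0 ⟶ M) (t : ∀ n, C n ⟶ Y n),
      t 0 ≫ d₀ = aug ∧ (∀ n, t (n + 1) ≫ dY n = dC n ≫ t n) ∧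
      (∀ (Z : A) (g : M ⟶ Z), aug ≫ g = 0 → d₀ ≫ g = 0) ∧
      ExactPair (dY 0) d₀ ∧ (∀ n, ExactPair (dY (n + 1)) (dY n)) ∧
      (∀ n, n < q → IsIso (t n)) ∧
      ∃ l : Y (q + 1) ≅ N, t (q + 1) ≫ l.hom = c ∧ (∀ n, q + 1 < n → IsZero (Y n)) ∧
        IsPushout (dC q) c (t q) (l.inv ≫ dY q) := by
  intro q
  induction q with
  | zero =>
    intro M C dC aug h0 hC c hc
    have hp : IsPushout (dC 0) c (pushout.inl (dC 0) c) (pushout.inr (dC 0) c) :=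
      IsPushout.of_hasPushout _ _
    obtain ⟨O, hO⟩ := HasZeroObject.zero (C := A)
    let Y : ℕ → A := fun n => match n with
      | 0 => pushout (dC 0) c
      | 1 => N
      | _ + 2 => O
    let dY : ∀ n, Y (n + 1) ⟶ Y n := fun n => match n with
      | 0 => pushout.inr (dC 0) c
      | _ + 1 => 0
    let d₀ : Y 0 ⟶ M := pushout.desc aug 0 (by rw [h0.1, comp_zero])
    have hl : pushout.inl (dC 0) c ≫ d₀ = aug := pushout.inl_desc _ _ _
    have hr : pushout.inr (dC 0) c ≫ d₀ = 0 := pushout.inr_desc _ _ _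
    let t : ∀ n, C n ⟶ Y n := fun n => match n with
      | 0 => pushout.inl (dC 0) c
      | 1 => c
      | _ + 2 => 0
    have hZ : ∀ n, IsZero (Y (n + 2)) := fun n => hO
    refine ⟨Y, dY, d₀, t, hl, fun n => ?_, fun Z g hg => ?_, ?_, fun n => ?_,
      fun n hn => absurd hn (by omega), Iso.refl N, Category.comp_id c, fun n hn => ?_, ?_⟩
    · match n with
      | 0 => exact hp.w.symm
      | 1 => exact (zero_comp).trans hc.symm
      | n + 2 => exact (hZ n).eq_of_tgt _ _
    · refine hp.hom_ext ?_ ?_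
      · rw [← Category.assoc, hl, hg, comp_zero]
      · rw [← Category.assoc, hr, zero_comp, comp_zero]
    -- After refinement an element of the pushout is a sum of a from C_0 and b from N. If it dies in
    -- M then so does a, which therefore comes from C_1 and can be moved across the square into N.
    · refine exactPair_of_lift hr fun T y hy => ?_
      obtain ⟨T', π, hπ, a, b, hab⟩ := IsPushout.exists_refinement hp y
      have ha : a ≫ aug = 0 := by
        have h1 := congrArg (· ≫ d₀) hab
        simp only [Category.assoc, Preadditive.add_comp, hy, hl, hr, comp_zero, add_zero] at h1
        exact h1.symm
      obtain ⟨T'', π', hπ', z, hz⟩ := h0.exists_lift a ha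
      refine ⟨T'', π' ≫ π, epi_comp _ _, z ≫ c + π' ≫ b, ?_⟩
      rw [Category.assoc, hab, Preadditive.comp_add, ← Category.assoc, hz, Category.assoc, hp.w,
        Preadditive.add_comp, Category.assoc, Category.assoc]
    · match n with
      | 0 =>
        refine exactPair_of_lift zero_comp fun T y hy => ?_
        obtain ⟨T', π, hπ, x, hx, hxy⟩ := IsPushout.exists_refinement_of_eq_zero hp y hy
        obtain ⟨T'', π', hπ', z, hz⟩ := (hC 0).exists_lift x hx
        refine ⟨T'', π' ≫ π, epi_comp _ _, 0, ?_⟩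
        rw [Category.assoc, hxy, Preadditive.comp_neg, ← Category.assoc, hz, Category.assoc, hc,
          comp_zero, neg_zero, zero_comp]
      | n + 1 =>
        exact exactPair_of_lift zero_comp fun T y hy =>
          ⟨T, 𝟙 T, inferInstance, 0, (hZ n).eq_of_tgt _ _⟩
    · match n with
      | n + 2 => exact hZ n
    · have : (Iso.refl N).inv ≫ dY 0 = pushout.inr (dC 0) c := Category.id_comp _
      rw [this]
      exact hp
  | succ q ih =>
    intro M C dC aug h0 hC c hc
    -- The induction treats the complex from degree one on as a resolution of the image in C_0. The
    -- clause on maps out of M is carried along because here it yields d₀' ≫ aug = 0.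
    obtain ⟨Y', dY', d₀', t', h1, h2, h3, h4, h5, h6, l, h7, h8, h9⟩ :=
      ih (C 0) (fun n => C (n + 1)) (fun n => dC (n + 1)) (dC 0) (hC 0) (fun n => hC (n + 1)) c hc
    let Y : ℕ → A := fun n => match n with
      | 0 => C 0
      | n + 1 => Y' n
    let dY : ∀ n, Y (n + 1) ⟶ Y n := fun n => match n with
      | 0 => d₀'
      | n + 1 => dY' n
    let t : ∀ n, C n ⟶ Y n := fun n => match n with
      | 0 => 𝟙 (C 0)
      | n + 1 => t' n
    refine ⟨Y, dY, aug, t, Category.id_comp aug, fun n => ?_, fun Z g hg => hg, ?_, fun n => ?_,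
      fun n hn => ?_, l, h7, fun n hn => ?_, h9⟩
    · match n with
      | 0 => exact h1.trans (Category.comp_id _).symm
      | n + 1 => exact h2 n
    · refine exactPair_of_lift (h3 _ aug h0.1) fun T y hy => ?_
      obtain ⟨T', π, hπ, z, hz⟩ := h0.exists_lift y hy
      exact ⟨T', π, hπ, z ≫ t' 0, by rw [hz, Category.assoc]; exact congrArg (z ≫ ·) h1.symm⟩
    · match n with
      | 0 => exact h4
      | n + 1 => exact h5 n
    · match n with
      | 0 => exact inferInstanceAs (IsIso (𝟙 (C 0)))
      | n + 1 => exact h6 n (by omega)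
    · match n with
      | n + 1 => exact h8 n (by omega)

end PushoutExtension

/-! ### Pushout extensions as complexes -/

section PushoutExtension

variable {A : Type v} [Category.{w} A] [Abelian A] {C : ChainComplex A ℕ} {M N : A}
  {aug : C.X 0 ⟶ M} {w : C.d 1 0 ≫ aug = 0} {p : ℕ}

theorem exactPair_of_exactAt {K : ChainComplex A ℕ} {n : ℕ} (h : K.ExactAt (n + 1)) :
    ExactPair (K.d (n + 2) (n + 1)) (K.d (n + 1) n) := by
  rw [HomologicalComplex.exactAt_iff' _ (n + 2) (n + 1) n (by simp) (by simp)] at h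
  exact ⟨_, h⟩

theorem exactAt_of_exactPair {K : ChainComplex A ℕ} {n : ℕ}
    (h : ExactPair (K.d (n + 2) (n + 1)) (K.d (n + 1) n)) : K.ExactAt (n + 1) := by
  rw [HomologicalComplex.exactAt_iff' _ (n + 2) (n + 1) n (by simp) (by simp)]
  exact h.2

theorem epi_of_exactAt_zero {K : ChainComplex A ℕ} (h : K.ExactAt 0) : Epi (K.d 1 0) := by
  rw [HomologicalComplex.exactAt_iff' _ 1 0 0 (by simp) (by simp)] at h
  exact h.epi_f (K.shape _ _ (by simp))

theorem exactAt_zero_of_epi {K : ChainComplex A ℕ} (h : Epi (K.d 1 0)) : K.ExactAt 0 := by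
  rw [HomologicalComplex.exactAt_iff' _ 1 0 0 (by simp) (by simp)]
  rw [ShortComplex.exact_iff_epi _ (K.shape _ _ (by simp))]
  exact h

/-- The pushout square of a pushout extension, in terms of cocycles. -/
theorem isPushout_opcycles_iff {K : ChainComplex A ℕ} {H : A} {c : K.X (p + 1) ⟶ N}
    (hc : K.d (p + 2) (p + 1) ≫ c = 0) {i : K.X p ⟶ H} {j : N ⟶ H} :
    IsPushout (K.fromOpcycles (p + 1) p)
      (K.descOpcycles (i := p + 1) c (p + 2) (by simp) hc) i j ↔
      IsPushout (K.d (p + 1) p) c i j := by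
  have h1 : K.pOpcycles (p + 1) ≫ K.fromOpcycles (p + 1) p = K.d (p + 1) p :=
    K.p_fromOpcycles _ _
  have h2 : K.pOpcycles (p + 1) ≫ K.descOpcycles c (p + 2) (by simp) hc = c :=
    K.p_descOpcycles _ _ _ _
  constructor
  · intro h
    have := IsPushout.epi_comp (K.pOpcycles (p + 1)) h
    rwa [h1, h2] at this
  · intro h
    refine IsPushout.of_epi_comp (e := K.pOpcycles (p + 1)) ?_
    rwa [h1, h2]

theorem exists_pushoutExtension (hK : ∀ i, (C.augment aug w).ExactAt i)
    (c : homCocycles C N (p + 1)) :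
    ∃ S : LengthExtension (p + 1) N M, IsPushoutExtension C aug w c S := by
  obtain ⟨Y, dY, d₀, t, h1, h2, h3, h4, h5, h6, l, h7, h8, h9⟩ :=
    exists_pushout_sequence p M C.X (fun n => C.d (n + 1) n) aug
      (exactPair_of_exactAt (hK 1)) (fun n => exactPair_of_exactAt (K := C.augment aug w) (hK (n + 2))) c.1 c.2
  let Y' : ChainComplex A ℕ := ChainComplex.of Y dY fun n => (h5 n).1
  have hY' : ∀ n, Y'.d (n + 1) n = dY n := fun n => ChainComplex.of_d _ _ _
  let K' : ChainComplex A ℕ := Y'.augment d₀ (by rw [hY']; exact h4.1)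
  have hK' : ∀ n, K'.d (n + 2) (n + 1) = dY n := hY'
  have hd₀ : Epi d₀ := by
    have h10 : Epi aug := epi_of_exactAt_zero (hK 0)
    exact @epi_of_epi_fac _ _ _ _ _ (t 0) d₀ aug h10 h1
  let S : LengthExtension (p + 1) N M :=
    { complex := K'
      exact := fun i => by
        match i with
        | 0 =>
          exact exactAt_zero_of_epi hd₀
        | 1 =>
          refine exactAt_of_exactPair ?_
          rw [hK']
          exact h4
        | n + 2 =>
          refine exactAt_of_exactPair ?_
          rw [hK', hK']
          exact h5 n
      right := Iso.refl M
      left := l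
      isZero := fun i hi => by
        match i with
        | n + 1 => exact h8 n (by omega) }
  let τ : C.augment aug w ⟶ K' :=
    { f := fun i => match i with
        | 0 => 𝟙 M
        | n + 1 => t n
      comm' := fun i j hij => by
        obtain rfl : j + 1 = i := hij
        match j with
        | 0 => exact h1.trans (Category.comp_id aug).symm
        | n + 1 =>
          rw [hK']
          exact h2 n }
  refine ⟨S, τ, Category.comp_id _, fun i hi => ?_, h7, ?_⟩
  · match i with
    | 0 => exact inferInstanceAs (IsIso (𝟙 M))
    | n + 1 => exact h6 n (by omega)
  · refine (isPushout_opcycles_iff (K := C.augment aug w) (c := c.1) c.2).2 ?_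
    have : S.complex.d (p + 2) (p + 1) = dY p := hK' p
    rw [this]
    exact h9

/-- By `IsPushout.add`, the middle term of S' is also a pushout for c, with coprojection altered by
h; comparing it with the pushout in S gives the isomorphism at H. -/
theorem isomorphic_of_isPushoutExtension {c c' : homCocycles C N (p + 1)}
    {S S' : LengthExtension (p + 1) N M} (hS : IsPushoutExtension C aug w c S)
    (hS' : IsPushoutExtension C aug w c' S') (h : C.X p ⟶ N)
    (hc : c.1 = c'.1 + C.d (p + 1) p ≫ h) : S.Isomorphic S' := by
  obtain ⟨t, h1, h2, h3, h4⟩ := hS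
  obtain ⟨t', h1', h2', h3', h4'⟩ := hS'
  replace h4 := (isPushout_opcycles_iff (K := C.augment aug w) (c := c.1) c.2).1 h4
  replace h4' := (isPushout_opcycles_iff (K := C.augment aug w) (c := c'.1) c'.2).1 h4'
  have h5 := IsPushout.add h4' (g := c.1) h hc
  let h' : (C.augment aug w).X (p + 1) ⟶ N := h
  -- In degrees at most p both terms are identified with those of the augmented complex; degree p +
  -- 1 is the pushout, degree p + 2 is N, and the rest is zero.
  let e : ∀ i, S.complex.X i ≅ S'.complex.X i := fun i =>
    if hi : i < p + 1 then
      (@asIso _ _ _ _ (t.f i) (h2 i hi)).symm ≪≫ @asIso _ _ _ _ (t'.f i) (h2' i hi)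
    else if hi : p + 1 = i then
      Eq.rec (motive := fun i _ => S.complex.X i ≅ S'.complex.X i) (h4.isoIsPushout _ _ h5) hi
    else if hi : p + 2 = i then
      Eq.rec (motive := fun i _ => S.complex.X i ≅ S'.complex.X i) (S.left ≪≫ S'.left.symm) hi
    else (S.isZero i (by omega)).iso (S'.isZero i (by omega))
  have e1 : ∀ i, i < p + 1 → t.f i ≫ (e i).hom = t'.f i := fun i hi => by
    have : e i = (@asIso _ _ _ _ (t.f i) (h2 i hi)).symm ≪≫ @asIso _ _ _ _ (t'.f i) (h2' i hi) :=
      dif_pos hi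
    have h6 := h2 i hi
    rw [this]
    simp
  have e2 : e (p + 1) = h4.isoIsPushout _ _ h5 :=
    (dif_neg (by omega)).trans (dif_pos rfl)
  have e3 : e (p + 2) = S.left ≪≫ S'.left.symm :=
    (dif_neg (by omega)).trans ((dif_neg (by omega)).trans (dif_pos rfl))
  have hl : t.f (p + 1) ≫ (e (p + 1)).hom =
      t'.f (p + 1) + h' ≫ S'.left.inv ≫ S'.complex.d (p + 2) (p + 1) := by
    rw [e2]
    exact h4.inl_isoIsPushout_hom _ _ h5
  have hr : S.left.inv ≫ S.complex.d (p + 2) (p + 1) ≫ (e (p + 1)).hom =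
      S'.left.inv ≫ S'.complex.d (p + 2) (p + 1) := by
    rw [e2, ← Category.assoc]
    exact h4.inr_isoIsPushout_hom _ _ h5
  refine ⟨HomologicalComplex.Hom.isoOfComponents e fun i j hij => ?_, ?_, ?_⟩
  · obtain rfl : j + 1 = i := hij
    rcases lt_trichotomy j p with hj | rfl | hj
    · have := h2 (j + 1) (by omega)
      rw [← cancel_epi (t.f (j + 1)), ← Category.assoc, e1 _ (by omega), t'.comm, ← Category.assoc,
        t.comm, Category.assoc, e1 _ (by omega)]
    · refine h4.hom_ext ?_ ?_
      · rw [← Category.assoc, hl, Preadditive.add_comp, t'.comm, ← Category.assoc (t.f (j + 1)),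
          t.comm, Category.assoc _ (t.f j), e1 _ (by omega)]
        have hz : (h' ≫ S'.left.inv ≫ S'.complex.d (j + 2) (j + 1)) ≫ S'.complex.d (j + 1) j =
            0 := by
          rw [Category.assoc, Category.assoc, S'.complex.d_comp_d, comp_zero, comp_zero]
        exact (congrArg _ hz).trans (add_zero _)
      · rw [Category.assoc, ← Category.assoc (S.complex.d _ _), ← Category.assoc S.left.inv, hr]
        simp
    · rcases Nat.lt_or_ge (p + 1) j with hj' | hj'
      · exact (S.isZero _ (by omega)).eq_of_src _ _
      · obtain rfl : j = p + 1 := by omega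
        rw [e3, ← cancel_epi S.left.inv, hr]
        simp
  · have := h2 0 (by omega)
    change (e 0).hom ≫ _ = _
    rw [← cancel_epi (t.f 0), ← Category.assoc, e1 0 (by omega), h1, h1']
  · change (e (p + 2)).hom ≫ _ = _
    rw [e3]
    simp

end PushoutExtension

/-! ### Representation of Ext sections over subsets of affine opens -/

section LocalRepresentation

variable {X : Scheme.{u}} {F G : X.Modules} {U V : X.Opens}

theorem LocallyFreeResolution.exactAt_augment_on (E : LocallyFreeResolution F) (U : X.Opens)
    (i : ℕ) : ((E.complexOn U).augment (E.augOn U) (E.d_comp_augOn U)).ExactAt i := by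
  match i with
  | 0 =>
    have h1 : (ShortComplex.mk (C := X.Modules) E.aug (0 : F ⟶ F) comp_zero).Exact :=
      (ShortComplex.exact_iff_epi _ rfl).2 (epi_of_exactAt_zero (E.exact 0))
    exact exactAt_zero_of_epi ((ShortComplex.exact_iff_epi _ rfl).1 (restrict_exact h1 U))
  | 1 =>
    obtain ⟨w, h⟩ := exactPair_of_exactAt (E.exact 1)
    exact exactAt_of_exactPair ⟨_, restrict_exact h U⟩
  | n + 2 =>
    obtain ⟨w, h⟩ := exactPair_of_exactAt (E.exact (n + 2))
    exact exactAt_of_exactPair ⟨_, restrict_exact h U⟩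

theorem exists_representing_hom (E : LocallyFreeResolution F) (hUV : U ≤ V)
    (hV : IsAffineOpen V) (hG : QCOn G V) (p : ℕ) :
    ∃ Φ : extSections F G (p + 1) ⊤ →+ HomCohomology (E.complexOn U) (G.restrict U.ι) (p + 1),
      ∀ f : extSections F G (p + 1) ⊤,
        (∀ c : homCocycles (E.complexOn U) (G.restrict U.ι) (p + 1), homClass c = Φ f →
          (∃ S : LengthExtension (p + 1) (G.restrict U.ι) (F.restrict U.ι),
            IsPushoutExtension (E.complexOn U) (E.augOn U) (E.d_comp_augOn U) c S) ∧
          ∀ S : LengthExtension (p + 1) (G.restrict U.ι) (F.restrict U.ι),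
            IsPushoutExtension (E.complexOn U) (E.augOn U) (E.d_comp_augOn U) c S →
            Represents S (extSectionsRestrict f U)) ∧
        ∀ (c c' : homCocycles (E.complexOn U) (G.restrict U.ι) (p + 1))
          (S S' : LengthExtension (p + 1) (G.restrict U.ι) (F.restrict U.ι)),
          homClass c = Φ f → homClass c' = Φ f →
          IsPushoutExtension (E.complexOn U) (E.augOn U) (E.d_comp_augOn U) c S →
          IsPushoutExtension (E.complexOn U) (E.augOn U) (E.d_comp_augOn U) c' S' →
          S.Isomorphic S' := by
  obtain ⟨Φ, hΦ⟩ := exists_homCohomology_hom E (injectiveResolution G) hUV hV hG p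
  refine ⟨Φ, fun f => ⟨fun c hc => ⟨exists_pushoutExtension (E.exactAt_augment_on U) c,
    fun S hS => represents_of_zigClass hS (hΦ f c hc)⟩, fun c c' S S' hc hc' hS hS' => ?_⟩⟩
  have h := hc'.trans hc.symm
  rw [homClass, homClass, QuotientAddGroup.eq, AddSubgroup.mem_addSubgroupOf] at h
  obtain ⟨g, hg⟩ := h
  refine isomorphic_of_isPushoutExtension hS hS' g ?_
  refine Eq.trans ?_ (congrArg _ hg.symm)
  exact (add_neg_cancel_left c'.1 c.1).symm

end LocalRepresentation

/-! ### Extension of sections over a sequence of multiplication maps -/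

section Tower

variable {X : Scheme.{u}} (F : ℕ ⥤ X.Modules) {D U V W : X.Opens} {l m n : ℕ}

/-- The transition maps on sections of a sequence of modules. -/
noncomputable def trans (h : m ≤ n) (U : X.Opens) :
    Γ(F.obj m, U) →ₗ[Γ(X, U)] Γ(F.obj n, U) :=
  happ (F.map (homOfLE h)) U

@[simp]
theorem trans_self (h : m ≤ m) (t : Γ(F.obj m, U)) : trans F h U t = t := by
  have : F.map (homOfLE h) = 𝟙 _ := F.map_id m
  rw [trans, this, happ_id]

@[simp]
theorem trans_trans (h : l ≤ m) (h' : m ≤ n) (t : Γ(F.obj l, U)) :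
    trans F h' U (trans F h U t) = trans F (h.trans h') U t := by
  have : F.map (homOfLE (h.trans h')) = F.map (homOfLE h) ≫ F.map (homOfLE h') :=
    F.map_comp _ _
  rw [trans, trans, trans, this, happ_comp]

@[simp]
theorem trans_sres (h : m ≤ n) (h' : V ≤ U) (t : Γ(F.obj m, U)) :
    trans F h V (sres (F.obj m) h' t) = sres (F.obj n) h' (trans F h U t) :=
  happ_sres _ _ _

/-- The transition maps of the sequence `F` are locally, up to a local homomorphism,
multiplication by an equation of the complement of `D`. -/
def IsMulTower (D : X.Opens) : Prop :=
  ∀ x : X, ∃ (U : X.Opens) (σ : Γ(X, U)), x ∈ U ∧ D ⊓ U = X.basicOpen σ ∧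
    ∀ m, ∃ ρ : localHom (F.obj m) (F.obj (m + 1)) U, ∀ (V : X.Opens) (h : V ≤ U)
      (t : Γ(F.obj m, V)), trans F m.le_succ V t = rres h σ • localHom.lapp ρ h t

variable {F}

/-- Each transition map supplies one factor σ, so k of them absorb the k-th power. -/
theorem trans_eq_zero_of_pow_smul {σ : Γ(X, U)}
    (hρ : ∀ m, ∃ ρ : localHom (F.obj m) (F.obj (m + 1)) U, ∀ (V : X.Opens) (h : V ≤ U)
      (t : Γ(F.obj m, V)), trans F m.le_succ V t = rres h σ • localHom.lapp ρ h t)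
    (hW : W ≤ U) (k : ℕ) : ∀ (m n : ℕ) (h : m ≤ n) (_ : n = m + k) (t : Γ(F.obj m, W)),
      rres hW σ ^ k • t = 0 → trans F h W t = 0 := by
  induction k with
  | zero =>
    rintro m n h rfl t ht
    rw [pow_zero, one_smul] at ht
    rw [ht, map_zero]
  | succ k ih =>
    intro m n h hn t ht
    obtain ⟨ρ, hρ⟩ := hρ m
    rw [← trans_trans F m.le_succ (by omega : m + 1 ≤ n), hρ W hW]
    refine ih (m + 1) n _ (by omega) _ ?_
    rw [smul_smul, ← pow_succ, ← map_smul, ht, map_zero]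

/-- Applying ρ to t removes one factor: it restricts to ρ(σ^(k+1) τ), which is σ^k times the image
of τ one level up. -/
theorem exists_extend_of_pow_smul {σ : Γ(X, U)}
    (hρ : ∀ m, ∃ ρ : localHom (F.obj m) (F.obj (m + 1)) U, ∀ (V : X.Opens) (h : V ≤ U)
      (t : Γ(F.obj m, V)), trans F m.le_succ V t = rres h σ • localHom.lapp ρ h t)
    (hW : W ≤ U) (hV : V ≤ W) (k : ℕ) : ∀ (m n : ℕ) (h : m ≤ n) (_ : n = m + k)
      (τ : Γ(F.obj m, V)) (t : Γ(F.obj m, W)),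
      sres (F.obj m) hV t = rres (hV.trans hW) σ ^ k • τ →
        ∃ t' : Γ(F.obj n, W), sres (F.obj n) hV t' = trans F h V τ := by
  induction k with
  | zero =>
    rintro m n h rfl τ t ht
    exact ⟨t, by rw [ht, pow_zero, one_smul, trans_self]⟩
  | succ k ih =>
    intro m n h hn τ t ht
    obtain ⟨ρ, hρ⟩ := hρ m
    rw [← trans_trans F m.le_succ (by omega : m + 1 ≤ n)]
    refine ih (m + 1) n _ (by omega) _ (localHom.lapp ρ hW t) ?_
    rw [← localHom.lapp_sres, ht, map_smul, hρ V (hV.trans hW), smul_smul, ← pow_succ]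

theorem IsMulTower.exists_affine (hD : IsMulTower F D) (x : X) (hx : x ∈ V) :
    ∃ (U W : X.Opens) (σ : Γ(X, U)) (_ : W ≤ U), IsAffineOpen W ∧ x ∈ W ∧ W ≤ V ∧
      W ⊓ D = W ⊓ X.basicOpen σ ∧
      ∀ m, ∃ ρ : localHom (F.obj m) (F.obj (m + 1)) U, ∀ (V : X.Opens) (h : V ≤ U)
        (t : Γ(F.obj m, V)), trans F m.le_succ V t = rres h σ • localHom.lapp ρ h t := by
  obtain ⟨U, σ, hxU, hσ, hρ⟩ := hD x
  obtain ⟨W, hW, hxW, hWU⟩ := exists_isAffineOpen_mem_and_subset (U := U ⊓ V) ⟨hxU, hx⟩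
  have hWU' : W ≤ U := fun y hy => (hWU hy).1
  refine ⟨U, W, σ, hWU', hW, hxW, fun y hy => (hWU hy).2, ?_, hρ⟩
  rw [← hσ, inf_comm D, ← inf_assoc, inf_eq_left.2 hWU']

/-- On an affine neighbourhood with equation σ, quasi-coherence gives σ^k t = 0, so t dies k levels
up. Open sets of a Noetherian space are compact, so one level works everywhere. -/
theorem IsMulTower.exists_trans_eq_zero [NoetherianSpace X] (hD : IsMulTower F D)
    (hF : ∀ m, QCOn (F.obj m) ⊤) (t : Γ(F.obj m, V))
    (ht : sres (F.obj m) (inf_le_left : V ⊓ D ≤ V) t = 0) :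
    ∃ (n : ℕ) (h : m ≤ n), trans F h V t = 0 := by
  have hc : IsCompact (V : Set X) := NoetherianSpace.isCompact _
  suffices H : ∃ (n : ℕ) (h : m ≤ n) (W : X.Opens) (hW : W ≤ V), (V : Set X) ⊆ W ∧
      trans F h W (sres (F.obj m) hW t) = 0 by
    obtain ⟨n, h, W, hW, hVW, h0⟩ := H
    obtain rfl : W = V := le_antisymm hW hVW
    exact ⟨n, h, by rwa [sres_self] at h0⟩
  refine hc.induction_on (p := fun S => ∃ (n : ℕ) (h : m ≤ n) (W : X.Opens) (hW : W ≤ V),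
    S ⊆ W ∧ trans F h W (sres (F.obj m) hW t) = 0) ?_ ?_ ?_ ?_
  · exact ⟨m, le_rfl, ⊥, bot_le, Set.empty_subset _, section_ext fun x hx => hx.elim⟩
  · rintro S T hST ⟨n, h, W, hW, hTW, h0⟩
    exact ⟨n, h, W, hW, hST.trans hTW, h0⟩
  · rintro S T ⟨n, h, W, hW, hTW, h0⟩ ⟨n', h', W', hW', hTW', h0'⟩
    refine ⟨max n n', h.trans (le_max_left _ _), W ⊔ W', sup_le hW hW',
      Set.union_subset (hTW.trans (le_sup_left : W ≤ W ⊔ W'))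
        (hTW'.trans (le_sup_right : W' ≤ W ⊔ W')), section_ext ?_⟩
    rintro x (hx | hx)
    · refine ⟨W, le_sup_left, hx, ?_⟩
      rw [← trans_sres, sres_sres, ← trans_trans F h (le_max_left n n'), h0, map_zero, map_zero]
    · refine ⟨W', le_sup_right, hx, ?_⟩
      rw [← trans_sres, sres_sres, ← trans_trans F h' (le_max_right n n'), h0', map_zero,
        map_zero]
  · intro x hx
    obtain ⟨U, W, σ, hWU, hW, hxW, hWV, hWD, hρ⟩ := hD.exists_affine x hx
    obtain ⟨k, hk⟩ := (hF m).exists_pow_smul_eq_zero hW le_top hWU σ hWD inf_le_left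
      (sres (F.obj m) hWV t) (by
        have := congrArg (sres (F.obj m) (inf_le_inf_right D hWV)) ht
        rwa [sres_sres, map_zero, ← sres_sres hWV] at this)
    exact ⟨W, mem_nhdsWithin_of_mem_nhds (W.isOpen.mem_nhds hxW), m + k, m.le_add_right k, W, hWV,
      subset_rfl, trans_eq_zero_of_pow_smul hρ hWU k m _ _ rfl _ hk⟩

theorem section_glue_two {G : X.Modules} (s : Γ(G, V)) (t : Γ(G, W))
    (h : sres G (inf_le_left : V ⊓ W ≤ V) s = sres G (inf_le_right : V ⊓ W ≤ W) t) :
    ∃ r : Γ(G, V ⊔ W), sres G le_sup_left r = s ∧ sres G le_sup_right r = t := by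
  obtain ⟨r, hr⟩ := section_glue (F := G) (U := V ⊔ W) (ι := ULift Bool)
    (fun i => if i.down then V else W) (by rintro ⟨_ | _⟩ <;> simp)
    (by
      rintro x (hx | hx)
      · exact Opens.mem_iSup.2 ⟨⟨true⟩, hx⟩
      · exact Opens.mem_iSup.2 ⟨⟨false⟩, hx⟩)
    (fun i => match i with | ⟨true⟩ => s | ⟨false⟩ => t)
    (by
      have h' := congrArg (sres G (inf_comm W V).le) h.symm
      rw [sres_sres, sres_sres] at h'
      rintro ⟨_ | _⟩ ⟨_ | _⟩
      · rfl
      · exact h'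
      · exact h
      · rfl)
  exact ⟨r, hr ⟨true⟩, hr ⟨false⟩⟩

/-- A section over `D` extends to the whole scheme after moving up the sequence. -/
theorem IsMulTower.exists_extend [NoetherianSpace X] (hD : IsMulTower F D)
    (hF : ∀ m, QCOn (F.obj m) ⊤) (τ : Γ(F.obj m, D)) :
    ∃ (n : ℕ) (h : m ≤ n) (t : Γ(F.obj n, ⊤)),
      sres (F.obj n) le_top t = trans F h D τ := by
  have hc : IsCompact (Set.univ : Set X) := NoetherianSpace.isCompact _
  suffices H : ∃ (n : ℕ) (h : m ≤ n) (W : X.Opens) (t : Γ(F.obj n, W)), (Set.univ : Set X) ⊆ W ∧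
      sres (F.obj n) (inf_le_left : W ⊓ D ≤ W) t =
        sres (F.obj n) inf_le_right (trans F h D τ) by
    obtain ⟨n, h, W, t, hW, ht⟩ := H
    obtain rfl : W = ⊤ := top_le_iff.1 hW
    refine ⟨n, h, t, ?_⟩
    have := congrArg (sres (F.obj n) (top_inf_eq D).ge) ht
    rwa [sres_sres, sres_sres, sres_self] at this
  refine hc.induction_on (p := fun S => ∃ (n : ℕ) (h : m ≤ n) (W : X.Opens) (t : Γ(F.obj n, W)),
    S ⊆ W ∧ sres (F.obj n) (inf_le_left : W ⊓ D ≤ W) t =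
        sres (F.obj n) inf_le_right (trans F h D τ)) ?_ ?_ ?_ ?_
  · exact ⟨m, le_rfl, ⊥, 0, Set.empty_subset _, section_ext fun x hx => hx.1.elim⟩
  · rintro S T hST ⟨n, h, W, t, hTW, h0⟩
    exact ⟨n, h, W, t, hST.trans hTW, h0⟩
  · rintro S T ⟨n₁, h₁, W₁, t₁, hS, ht₁⟩ ⟨n₂, h₂, W₂, t₂, hT, ht₂⟩
    have e₁ := le_max_left n₁ n₂
    have e₂ := le_max_right n₁ n₂
    -- The two partial extensions agree on the part of W₁ ∩ W₂ inside D, hence on all of it after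
    -- moving further up.
    obtain ⟨n, h, h0⟩ := hD.exists_trans_eq_zero hF (V := W₁ ⊓ W₂)
      (sres _ inf_le_left (trans F e₁ W₁ t₁) - sres _ inf_le_right (trans F e₂ W₂ t₂)) (by
        have a₁ := congrArg (fun s => trans F e₁ _ (sres _
          (inf_le_inf_right D (inf_le_left : W₁ ⊓ W₂ ≤ W₁)) s)) ht₁
        have a₂ := congrArg (fun s => trans F e₂ _ (sres _
          (inf_le_inf_right D (inf_le_right : W₁ ⊓ W₂ ≤ W₂)) s)) ht₂
        simp only [sres_sres, trans_sres, trans_trans] at a₁ a₂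
        rw [map_sub, sres_sres, sres_sres, a₁, a₂, sub_self])
    rw [map_sub, trans_sres, trans_sres, trans_trans, trans_trans, sub_eq_zero] at h0
    obtain ⟨t, hr₁, hr₂⟩ := section_glue_two _ _ h0
    refine ⟨n, h₁.trans (e₁.trans h), W₁ ⊔ W₂, t, Set.union_subset
      (hS.trans (le_sup_left : W₁ ≤ W₁ ⊔ W₂)) (hT.trans (le_sup_right : W₂ ≤ W₁ ⊔ W₂)),
      section_ext ?_⟩
    rintro x ⟨hx | hx, hxD⟩
    · refine ⟨W₁ ⊓ D, inf_le_inf_right D le_sup_left, ⟨hx, hxD⟩, ?_⟩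
      have a₁ := congrArg (trans F (e₁.trans h) _) ht₁
      simp only [trans_sres, trans_trans] at a₁
      rw [sres_sres, sres_sres, ← sres_sres le_sup_left inf_le_left t, hr₁, a₁]
    · refine ⟨W₂ ⊓ D, inf_le_inf_right D le_sup_right, ⟨hx, hxD⟩, ?_⟩
      have a₂ := congrArg (trans F (e₂.trans h) _) ht₂
      simp only [trans_sres, trans_trans] at a₂
      rw [sres_sres, sres_sres, ← sres_sres le_sup_right inf_le_left t, hr₂, a₂]
  · intro x _
    obtain ⟨U, W, σ, hWU, hW, hxW, -, hWD, hρ⟩ := hD.exists_affine x (Opens.mem_top x)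
    obtain ⟨k, s, hs⟩ := (hF m).exists_extend hW le_top hWU σ hWD inf_le_left
      (sres (F.obj m) inf_le_right τ)
    obtain ⟨t, ht⟩ := exists_extend_of_pow_smul hρ hWU inf_le_left k m _ (m.le_add_right k) rfl
      _ _ hs
    exact ⟨W, mem_nhdsWithin_of_mem_nhds (W.isOpen.mem_nhds hxW), m + k, m.le_add_right k, W, t,
      subset_rfl, by rw [ht, trans_sres]⟩

end Tower

/-! ### Twisting by a line bundle -/

section Twist

variable {X : Scheme.{u}} {E F G H M N : X.Modules} {U V W : X.Opens}

theorem isUnit_rres_of_le_basicOpen (h : V ≤ U) {σ : Γ(X, U)} (hV : V ≤ X.basicOpen σ) :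
    IsUnit (rres h σ) := by
  have h1 : IsUnit (rres (X.basicOpen_le σ) σ) := X.toRingedSpace.isUnit_res_basicOpen σ
  have h2 := h1.map (rres hV)
  rwa [rres_rres] at h2

theorem le_basicOpen_of_isUnit (h : V ≤ U) {σ : Γ(X, U)} (hσ : IsUnit (rres h σ)) :
    V ≤ X.basicOpen σ := by
  have h1 := X.basicOpen_of_isUnit hσ
  rw [basicOpen_rres] at h1
  exact inf_eq_left.1 h1

theorem IsBasis.bijective_smul {e : Fin 1 → Γ(E, U)} (he : IsBasis E U e) (h : V ≤ U) :
    Function.Bijective fun a : Γ(X, V) => a • sres E h (e 0) := by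
  have := (he V h).comp (Equiv.funUnique (Fin 1) Γ(X, V)).symm.bijective
  convert this using 1
  funext a
  simp

theorem isBasis_of_bijective_smul {e : Fin 1 → Γ(E, U)}
    (he : ∀ (V : X.Opens) (h : V ≤ U), Function.Bijective fun a : Γ(X, V) => a • sres E h (e 0)) :
    IsBasis E U e := by
  intro V h
  have := (he V h).comp (Equiv.funUnique (Fin 1) Γ(X, V)).bijective
  convert this using 1
  funext a
  simp

theorem isBasis_unitModule (U : X.Opens) :
    IsBasis (unitModule X) U fun _ : Fin 1 => (unitEquiv U).symm 1 :=
  isBasis_of_bijective_smul fun V h => by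
    convert (unitEquiv V).symm.bijective using 1
    funext a
    rw [sres_unitEquiv_symm, ← map_smul, map_one, smul_eq_mul, mul_one]

/-- The line bundle `M` is trivial near every point, by a trivialization in which the section `s`
is given by an equation of the complement of `D`. -/
def IsEquation (M : X.Modules) (s : Γ(M, ⊤)) (D : X.Opens) : Prop :=
  ∀ x : X, ∃ (U : X.Opens) (e : Fin 1 → Γ(M, U)) (σ : Γ(X, U)), x ∈ U ∧ IsBasis M U e ∧
    sres M le_top s = σ • e 0 ∧ D ⊓ U = X.basicOpen σ

/-- In a trivialization s is σ times the basis vector, and a ↦ a • s is bijective over every smaller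
open exactly where σ is invertible. -/
theorem isEquation_nonvanishingLocus
    (hM : ∀ x : X, ∃ (U : X.Opens) (e : Fin 1 → Γ(M, U)), x ∈ U ∧ IsBasis M U e) (s : Γ(M, ⊤)) :
    IsEquation M s (nonvanishingLocus M s) := by
  intro x
  obtain ⟨U, e, hx, he⟩ := hM x
  obtain ⟨σ, hσ⟩ := (he.bijective_smul le_rfl).2 (sres M le_top s)
  replace hσ : sres M le_top s = σ • e 0 := by
    rw [← hσ]
    simp
  have hs : ∀ V (h : V ≤ U), sres M le_top s = rres h σ • sres M h (e 0) := fun V h => by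
    rw [← sres_smul, ← hσ, sres_sres]
  refine ⟨U, e, σ, hx, he, hσ, le_antisymm ?_ (le_inf ?_ (X.basicOpen_le σ))⟩
  · rintro y ⟨hy, hyU⟩
    obtain ⟨W, hW, hyW⟩ := Opens.mem_sSup.1 hy
    have h1 : W ⊓ U ≤ U := inf_le_right
    obtain ⟨a, ha⟩ := (hW (W ⊓ U) inf_le_left).2 (sres M h1 (e 0))
    replace ha : a • sres M le_top s = sres M h1 (e 0) := ha
    rw [hs _ h1, smul_smul] at ha
    have h2 : a * rres h1 σ = 1 := (he.bijective_smul h1).1 (by simpa using ha)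
    exact le_basicOpen_of_isUnit h1 (IsUnit.of_mul_eq_one_right a h2) ⟨hyW, hyU⟩
  · refine le_sSup fun V hV => ?_
    have h1 : V ≤ U := hV.trans (X.basicOpen_le σ)
    obtain ⟨c, hc⟩ := isUnit_rres_of_le_basicOpen h1 hV
    have h2 := (he.bijective_smul h1).comp (Units.mulRight c).bijective
    convert h2 using 1
    funext a
    change a • sres M le_top s = (a * c) • sres M h1 (e 0)
    rw [hs V h1, smul_smul, hc]

namespace localHom

/-- Composition of local homomorphisms. -/
noncomputable def comp (φ : localHom F G U) (ψ : localHom G H U) : localHom F H U :=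
  mk' (fun _ h => (lapp ψ h).comp (lapp φ h)) fun V W hV hW s => by
    simp only [LinearMap.comp_apply]
    rw [lapp_sres φ hV hW, lapp_sres ψ hV hW]

/-- Precomposition with a local homomorphism. -/
noncomputable def precompLocal (φ : localHom F G U) (H : X.Modules) :
    localHom (modHom G H) (modHom F H) U :=
  mk' (fun V h =>
    { toFun := fun t => (modHomEquiv F H V).symm (comp (res h φ) (modHomEquiv G H V t))
      map_add' := fun _ _ => rfl
      map_smul' := fun _ _ => (modHomEquiv F H V).injective (ext_lapp fun _ _ _ => rfl) })
    fun _ _ _ _ _ => rfl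

/-- Evaluation of local homomorphisms at a section. -/
noncomputable def evalAt (e : Γ(M, U)) (N : X.Modules) : localHom (modHom M N) N U :=
  mk' (fun V h =>
    { toFun := fun φ => lapp (modHomEquiv M N V φ) le_rfl (sres M h e)
      map_add' := fun _ _ => rfl
      map_smul' := fun a φ => by
        rw [map_smul, lapp_smul, rres_self]
        rfl }) fun V W hV hW φ => by
    refine Eq.trans ?_ (lapp_sres (modHomEquiv M N V φ) le_rfl hW (sres M hV e))
    rw [sres_sres]
    rfl

end localHom

theorem IsBasis.modHom {e : Fin 1 → Γ(M, U)} (he : IsBasis M U e) {f : Fin 1 → Γ(N, U)}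
    (hf : IsBasis N U f) :
    IsBasis (modHom M N) U fun _ : Fin 1 => (modHomEquiv M N U).symm (localHom.ofBasis he f) :=
  isBasis_of_bijective_smul fun V h => by
    let θ : Γ(SheafExt.modHom M N, V) ≃ Γ(N, V) :=
      ((modHomEquiv M N V).trans (localHom.basisEquiv he h)).toEquiv.trans
        (Equiv.funUnique (Fin 1) _)
    refine (Function.Bijective.of_comp_iff' θ.bijective _).1 ?_
    convert hf.bijective_smul h using 1
    funext a
    change localHom.lapp (a • localHom.res h (localHom.ofBasis he f)) le_rfl (sres M h (e 0)) = _
    rw [localHom.lapp_smul, rres_self, localHom.lapp_res, localHom.lapp_ofBasis]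

/-- The line bundles `𝒪, ℋom(M, 𝒪), ℋom(M, ℋom(M, 𝒪)), …`. -/
noncomputable def twist (M : X.Modules) : ℕ → X.Modules
  | 0 => unitModule X
  | n + 1 => modHom M (twist M n)

theorem IsBasis.twist {e : Fin 1 → Γ(M, U)} (he : IsBasis M U e) (n : ℕ) :
    ∃ f : Fin 1 → Γ(twist M n, U), IsBasis (twist M n) U f := by
  induction n with
  | zero => exact ⟨_, isBasis_unitModule U⟩
  | succ n ih =>
    obtain ⟨f, hf⟩ := ih
    exact ⟨_, he.modHom hf⟩

theorem IsEquation.isLocallyFree_twist {s : Γ(M, ⊤)} {D : X.Opens} (h : IsEquation M s D) (n : ℕ) :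
    IsLocallyFreeOfFiniteRank (twist M n) :=
  isLocallyFreeOfFiniteRank_of_isBasis fun x => by
    obtain ⟨U, e, -, hx, he, -⟩ := h x
    obtain ⟨f, hf⟩ := he.twist n
    exact ⟨U, 1, f, hx, hf⟩

/-- Evaluation at the section `s`. -/
noncomputable def twistEval (s : Γ(M, ⊤)) (n : ℕ) : twist M (n + 1) ⟶ twist M n :=
  localHom.toHom (localHom.evalAt s (twist M n))

/-- The sequence of the modules of homomorphisms from the twists to `F`. -/
noncomputable def twistTower (s : Γ(M, ⊤)) (F : X.Modules) : ℕ ⥤ X.Modules :=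
  Functor.ofSequence (X := fun n => modHom (twist M n) F)
    fun n => modHomPrecomp (twistEval s n) F

theorem trans_twistTower (s : Γ(M, ⊤)) (n : ℕ) (t : Γ(modHom (twist M n) F, V)) :
    trans (twistTower s F) n.le_succ V t = happ (modHomPrecomp (twistEval s n) F) V t := by
  have : (twistTower s F).map (homOfLE n.le_succ) = modHomPrecomp (twistEval s n) F :=
    Functor.ofSequence_map_homOfLE_succ _ n
  rw [trans, this]
  rfl

theorem happ_twistEval {s : Γ(M, ⊤)} {e : Fin 1 → Γ(M, U)} {σ : Γ(X, U)}
    (hs : sres M le_top s = σ • e 0) (h : V ≤ U) (n : ℕ) (y : Γ(twist M (n + 1), V)) :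
    happ (twistEval s n) V y = rres h σ • localHom.lapp (localHom.evalAt (e 0) (twist M n)) h y := by
  have h1 : sres M (le_top : V ≤ ⊤) s = rres h σ • sres M h (e 0) := by
    rw [← sres_smul, ← hs, sres_sres]
  change localHom.lapp (modHomEquiv M (twist M n) V y) le_rfl (sres M le_top s) = _
  rw [h1, map_smul]
  rfl

/-- Evaluation at s is σ times evaluation at the local basis vector, so ρ is precomposition with the
latter evaluation. -/
theorem IsEquation.isMulTower {s : Γ(M, ⊤)} {D : X.Opens} (h : IsEquation M s D) :
    IsMulTower (twistTower s F) D := by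
  intro x
  obtain ⟨U, e, σ, hx, he, hs, hD⟩ := h x
  refine ⟨U, σ, hx, hD, fun m =>
    ⟨localHom.precompLocal (localHom.evalAt (e 0) (twist M m)) F, fun V hV t => ?_⟩⟩
  refine (trans_twistTower s m t).trans ?_
  refine (modHomEquiv (twist M (m + 1)) F V).injective (localHom.ext_lapp fun W hW y => ?_)
  refine (congrArg (localHom.lapp (modHomEquiv (twist M m) F V t) hW)
    (happ_twistEval hs (hW.trans hV) m y)).trans ?_
  rw [map_smul]
  refine Eq.trans ?_ (congrArg (fun φ => localHom.lapp φ hW y)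
    (map_smul (modHomEquiv (twist M (m + 1)) F V) _ _)).symm
  rw [localHom.lapp_smul, rres_rres]
  rfl

theorem exists_twistEval_eq {s : Γ(M, ⊤)} {e : Fin 1 → Γ(M, U)} (he : IsBasis M U e)
    {σ : Γ(X, U)} (hs : sres M le_top s = σ • e 0) (hV : V ≤ X.basicOpen σ) (n : ℕ)
    (y : Γ(twist M n, V)) : ∃ y', happ (twistEval s n) V y' = y := by
  have h : V ≤ U := hV.trans (X.basicOpen_le σ)
  obtain ⟨c, hc⟩ := isUnit_rres_of_le_basicOpen h hV
  refine ⟨(modHomEquiv M (twist M n) V).symm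
    (localHom.ofBasis (he.res h) fun _ => (↑c⁻¹ : Γ(X, V)) • y), ?_⟩
  have := localHom.lapp_ofBasis (he.res h) (fun _ => (↑c⁻¹ : Γ(X, V)) • y) le_rfl 0
  rw [sres_self, sres_self] at this
  refine (happ_twistEval hs h n _).trans ((congrArg (rres h σ • ·) this).trans ?_)
  rw [← hc, smul_smul, Units.mul_inv, one_smul]

/-- A section over `D` lies, locally, in the image of a morphism from a line bundle. -/
theorem IsEquation.exists_hom [NoetherianSpace X] {s : Γ(M, ⊤)} {D : X.Opens}
    (h : IsEquation M s D) (hF : QCOn F ⊤) (τ : Γ(F, D)) :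
    ∃ (E : X.Modules) (φ : E ⟶ F), IsLocallyFreeOfFiniteRank E ∧ τ ∈ (imSub φ).obj D := by
  -- τ as a homomorphism 𝒪 ⟶ F over D, at level zero of the tower.
  let τ₀ : Γ((twistTower s F).obj 0, D) :=
    (modHomEquiv (unitModule X) F D).symm (localHom.ofBasis (isBasis_unitModule D) fun _ => τ)
  obtain ⟨n, hn, t, ht⟩ := h.isMulTower.exists_extend
    (fun m => (h.isLocallyFree_twist m).qcOn_modHom hF) τ₀
  refine ⟨twist M n, localHom.toHom (modHomEquiv (twist M n) F ⊤ t), h.isLocallyFree_twist n,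
    fun x hx => ?_⟩
  obtain ⟨U, e, σ, hxU, he, hs, hD⟩ := h x
  have hV : D ⊓ U ≤ D := inf_le_left
  -- Evaluation at s is surjective over D ∩ U, where σ is a unit; going up the tower therefore keeps
  -- τ in the image.
  have key : ∀ (m : ℕ) (hm : 0 ≤ m), ∃ y : Γ(twist M m, D ⊓ U),
      localHom.lapp (modHomEquiv (twist M m) F D (trans (twistTower s F) hm D τ₀)) hV y =
        sres F hV τ := by
    intro m hm
    induction m with
    | zero =>
      refine ⟨(unitEquiv _).symm 1, ?_⟩
      rw [trans_self]
      have := localHom.lapp_ofBasis (isBasis_unitModule D) (fun _ => τ) hV 0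
      have h1 : rres hV (1 : Γ(X, D)) = 1 := map_one _
      refine Eq.trans ?_ this
      rw [sres_unitEquiv_symm, h1]
      rfl
    | succ m ih =>
      obtain ⟨y, hy⟩ := ih (Nat.zero_le m)
      obtain ⟨y', hy'⟩ := exists_twistEval_eq he hs hD.le m y
      refine ⟨y', ?_⟩
      have h1 := (trans_trans (twistTower s F) (Nat.zero_le m) m.le_succ τ₀).symm.trans
        (trans_twistTower s m _)
      refine (congrArg (fun t => localHom.lapp (modHomEquiv (twist M (m + 1)) F D t) hV y')
        h1).trans (Eq.trans ?_ hy)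
      exact congrArg (localHom.lapp (modHomEquiv (twist M m) F D
        (trans (twistTower s F) (Nat.zero_le m) D τ₀)) hV) hy'
  obtain ⟨y, hy⟩ := key n hn
  refine ⟨D ⊓ U, hV, ⟨hx, hxU⟩, y, ?_⟩
  rw [← ht] at hy
  exact hy

end Twist

/-! ### Tensor powers of line bundles -/

section Tensor

variable {X : Scheme.{u}} {U V W : X.Opens}

/-- The presheaf tensor product. -/
noncomputable abbrev preTensor (M N : X.Modules) :
    PresheafOfModules (X.presheaf ⋙ forget₂ CommRingCat RingCat) :=
  MonoidalCategory.tensorObj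
      (C := PresheafOfModules (X.presheaf ⋙ forget₂ CommRingCat RingCat)) M.val N.val

/-- The map from the presheaf tensor product to the tensor product. -/
noncomputable def toTensor (M N : X.Modules) (U : X.Opens) :
    TensorProduct Γ(X, U) Γ(M, U) Γ(N, U) →ₗ[Γ(X, U)] Γ(tensor M N, U) :=
  (((PresheafOfModules.sheafificationAdjunction (𝟙 X.ringCatSheaf.obj)).unit.app
    (preTensor M N)).app (op U)).hom

variable {M N : X.Modules}

theorem toTensor_sres (h : V ≤ U) (m : Γ(M, U)) (n : Γ(N, U)) :
    toTensor M N V (sres M h m ⊗ₜ sres N h n) = sres (tensor M N) h (toTensor M N U (m ⊗ₜ n)) :=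
  PresheafOfModules.naturality_apply
    ((PresheafOfModules.sheafificationAdjunction (𝟙 X.ringCatSheaf.obj)).unit.app
    (preTensor M N)) (homOfLE h).op (m ⊗ₜ n)

theorem tmul_eq_zero_local (m : Γ(M, U)) (n : Γ(N, U)) (h : toTensor M N U (m ⊗ₜ n) = 0) (x : X)
    (hx : x ∈ U) : ∃ (V : X.Opens) (hV : V ≤ U), x ∈ V ∧
      (sres M hV m ⊗ₜ sres N hV n : TensorProduct Γ(X, V) Γ(M, V) Γ(N, V)) = 0 := by
  have hinj : Presheaf.IsLocallyInjective (Opens.grothendieckTopology X)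
      (CategoryTheory.toSheafify (Opens.grothendieckTopology X) (preTensor M N).presheaf) :=
    inferInstance
  obtain ⟨V, i, hV, hxV⟩ := Presheaf.equalizerSieve_mem (Opens.grothendieckTopology X)
    (CategoryTheory.toSheafify (Opens.grothendieckTopology X) (preTensor M N).presheaf)
    (X := op U) (m ⊗ₜ[Γ(X, U)] n) 0 (h.trans (map_zero (toTensor M N U)).symm) x hx
  exact ⟨V, i.le, hxV, hV.trans (map_zero ((preTensor M N).presheaf.map i.op).hom)⟩

theorem toTensor_locally_surjective (t : Γ(tensor M N, U)) (x : X) (hx : x ∈ U) :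
    ∃ (V : X.Opens) (hV : V ≤ U), x ∈ V ∧ ∃ z, toTensor M N V z = sres (tensor M N) hV t := by
  have hsurj : Presheaf.IsLocallySurjective (Opens.grothendieckTopology X)
      (CategoryTheory.toSheafify (Opens.grothendieckTopology X) (preTensor M N).presheaf) :=
    inferInstance
  obtain ⟨V, i, ⟨z, hz⟩, hxV⟩ := Presheaf.imageSieve_mem (Opens.grothendieckTopology X)
    (CategoryTheory.toSheafify (Opens.grothendieckTopology X) (preTensor M N).presheaf)
    (U := op U) t x hx
  exact ⟨V, i.le, hxV, z, hz⟩

/-- The product of the two coordinate functionals on the tensor product takes the value a. -/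
theorem eq_zero_of_smul_tmul {e : Fin 1 → Γ(M, U)} {f : Fin 1 → Γ(N, U)} (he : IsBasis M U e)
    (hf : IsBasis N U f) (h : V ≤ U) (a : Γ(X, V))
    (ha : (a • sres M h (e 0)) ⊗ₜ[Γ(X, V)] sres N h (f 0) = 0) : a = 0 := by
  let φ : Γ(M, V) →ₗ[Γ(X, V)] Γ(X, V) := (LinearMap.proj 0).comp (he.coord h).toLinearMap
  let ψ : Γ(N, V) →ₗ[Γ(X, V)] Γ(X, V) := (LinearMap.proj 0).comp (hf.coord h).toLinearMap
  have hφ : φ (sres M h (e 0)) = 1 := by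
    have := congrFun (he.coord_sum h fun _ => 1) 0
    rw [Fin.sum_univ_one, one_smul] at this
    exact this
  have hψ : ψ (sres N h (f 0)) = 1 := by
    have := congrFun (hf.coord_sum h fun _ => 1) 0
    rw [Fin.sum_univ_one, one_smul] at this
    exact this
  have := congrArg (fun z => LinearMap.mul' Γ(X, V) Γ(X, V) (TensorProduct.map φ ψ z)) ha
  simpa [hφ, hψ] using this

theorem exists_eq_smul_tmul {e : Fin 1 → Γ(M, U)} {f : Fin 1 → Γ(N, U)} (he : IsBasis M U e)
    (hf : IsBasis N U f) (h : V ≤ U) (z : TensorProduct Γ(X, V) Γ(M, V) Γ(N, V)) :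
    ∃ a : Γ(X, V), z = a • (sres M h (e 0)) ⊗ₜ[Γ(X, V)] sres N h (f 0) := by
  induction z using TensorProduct.induction_on with
  | zero => exact ⟨0, by rw [zero_smul]⟩
  | tmul m n =>
    obtain ⟨a, rfl⟩ := (he.bijective_smul h).2 m
    obtain ⟨b, rfl⟩ := (hf.bijective_smul h).2 n
    exact ⟨a * b, TensorProduct.smul_tmul_smul _ _ _ _⟩
  | add z z' hz hz' =>
    obtain ⟨a, rfl⟩ := hz
    obtain ⟨b, rfl⟩ := hz'
    exact ⟨a + b, (add_smul _ _ _).symm⟩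

theorem IsBasis.tensor {e : Fin 1 → Γ(M, U)} {f : Fin 1 → Γ(N, U)} (he : IsBasis M U e)
    (hf : IsBasis N U f) :
    IsBasis (tensor M N) U fun _ : Fin 1 => toTensor M N U (e 0 ⊗ₜ f 0) := by
  have hinj : ∀ (V : X.Opens) (h : V ≤ U), Function.Injective fun a : Γ(X, V) =>
      a • sres (SheafExt.tensor M N) h (toTensor M N U (e 0 ⊗ₜ f 0)) := by
    intro V h a b hab
    replace hab : (a - b) • sres (SheafExt.tensor M N) h (toTensor M N U (e 0 ⊗ₜ f 0)) = 0 := by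
      rw [sub_smul, sub_eq_zero]
      exact hab
    rw [← toTensor_sres, ← map_smul, TensorProduct.smul_tmul'] at hab
    refine sub_eq_zero.1 ((unitEquiv V).symm.injective (section_ext fun x hx => ?_))
    obtain ⟨W, hW, hxW, h0⟩ := tmul_eq_zero_local _ _ hab x hx
    refine ⟨W, hW, hxW, ?_⟩
    rw [sres_smul, sres_sres, sres_sres] at h0
    rw [sres_unitEquiv_symm, eq_zero_of_smul_tmul he hf (hW.trans h) _ h0, map_zero, map_zero,
      map_zero]
  refine isBasis_of_bijective_smul fun V h => ⟨hinj V h, fun t => ?_⟩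
  -- Sheafification is locally surjective, so coefficients exist locally; they agree on overlaps by
  -- the injectivity just shown.
  obtain ⟨a, ha⟩ := section_glue_nhds (F := unitModule X) (U := V) (fun W hW a =>
    unitEquiv W a • sres (SheafExt.tensor M N) (hW.trans h) (toTensor M N U (e 0 ⊗ₜ f 0)) =
      sres (SheafExt.tensor M N) hW t) (fun x hx => by
        obtain ⟨W, hW, hxW, z, hz⟩ := toTensor_locally_surjective t x hx
        obtain ⟨a, rfl⟩ := exists_eq_smul_tmul he hf (hW.trans h) z
        refine ⟨W, hW, hxW, (unitEquiv W).symm a, ?_⟩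
        rw [← hz, map_smul, toTensor_sres, LinearEquiv.apply_symm_apply])
    (fun W W' hW hW' a b ha hb => by
      refine (unitEquiv _).injective (hinj _ (inf_le_left.trans (hW.trans h)) ?_)
      have ha' := congrArg (sres (SheafExt.tensor M N) (inf_le_left : W ⊓ W' ≤ W)) ha
      have hb' := congrArg (sres (SheafExt.tensor M N) (inf_le_right : W ⊓ W' ≤ W')) hb
      simp only [sres_smul, sres_sres] at ha' hb'
      exact ha'.trans hb'.symm)
  refine ⟨unitEquiv V a, section_ext fun x hx => ?_⟩
  obtain ⟨W, hW, hxW, hWa⟩ := ha x hx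
  refine ⟨W, hW, hxW, ?_⟩
  rw [sres_smul, sres_sres]
  exact hWa

theorem IsBasis.tensorPower {e : Fin 1 → Γ(M, U)} (he : IsBasis M U e) (n : ℕ) :
    ∃ f : Fin 1 → Γ(tensorPower M n, U), IsBasis (tensorPower M n) U f := by
  induction n with
  | zero => exact ⟨_, isBasis_unitModule U⟩
  | succ n ih =>
    obtain ⟨f, hf⟩ := ih
    exact ⟨_, hf.tensor he⟩

theorem IsLineBundle.isEquation_nonvanishingLocus (hM : IsLineBundle M) (n : ℕ)
    (s : Γ(tensorPower M n, ⊤)) :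
    IsEquation (tensorPower M n) s (nonvanishingLocus (tensorPower M n) s) :=
  SheafExt.isEquation_nonvanishingLocus (fun x => by
    obtain ⟨U, e, hx, he⟩ := hM.exists_isBasis x
    obtain ⟨f, hf⟩ := he.tensorPower n
    exact ⟨U, f, hx, hf⟩) s

end Tensor

/-! ### Locally free resolutions -/

section Resolution

variable {X : Scheme.{u}} {E E' F G : X.Modules} {U V W : X.Opens}

theorem IsBasis.reindex {ι ι' : Type} [Fintype ι] [Fintype ι'] {e : ι → Γ(E, U)}
    (he : IsBasis E U e) (σ : ι' ≃ ι) : IsBasis E U (e ∘ σ) := by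
  intro V h
  have := (he V h).comp (σ.arrowCongr (Equiv.refl Γ(X, V))).bijective
  convert this using 1
  funext a
  refine Fintype.sum_equiv σ _ _ fun i => ?_
  simp

theorem isBasis_of_directSum {B : X.Modules} {ι ι' : Type} [Fintype ι] [Fintype ι']
    {e : ι → Γ(E, U)} {e' : ι' → Γ(E', U)} (he : IsBasis E U e) (he' : IsBasis E' U e')
    (i₁ : E ⟶ B) (i₂ : E' ⟶ B)
    (h : ∀ V ≤ U, Function.Bijective fun s : Γ(E, V) × Γ(E', V) => happ i₁ V s.1 + happ i₂ V s.2) :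
    IsBasis B U (Sum.elim (fun i => happ i₁ U (e i)) fun i => happ i₂ U (e' i)) := by
  intro V hV
  have h1 := ((h V hV).comp ((he V hV).prodMap (he' V hV))).comp
    (Equiv.sumArrowEquivProdArrow ι ι' Γ(X, V)).bijective
  convert h1 using 1
  funext a
  refine (Fintype.sum_sum_type _).trans ?_
  refine congrArg₂ (· + ·) ?_ ?_
  · exact (Finset.sum_congr rfl fun i _ => by
      rw [map_smul, happ_sres]
      rfl).trans (map_sum (happ i₁ V) (fun i => a (Sum.inl i) • sres E hV (e i)) _).symm
  · exact (Finset.sum_congr rfl fun i _ => by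
      rw [map_smul, happ_sres]
      rfl).trans (map_sum (happ i₂ V) (fun i => a (Sum.inr i) • sres E' hV (e' i)) _).symm

theorem bijective_biprod (V : X.Opens) :
    Function.Bijective fun s : Γ(E, V) × Γ(E', V) =>
      happ (biprod.inl : E ⟶ E ⊞ E') V s.1 + happ (biprod.inr : E' ⟶ E ⊞ E') V s.2 := by
  have h : ∀ {A B : X.Modules} {f g : A ⟶ B}, f = g → ∀ s : Γ(A, V), happ f V s = happ g V s := by
    rintro A B f _ rfl s
    rfl
  refine Function.bijective_iff_has_inverse.2 ⟨fun s =>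
    (happ (biprod.fst : E ⊞ E' ⟶ E) V s, happ (biprod.snd : E ⊞ E' ⟶ E') V s),
    fun s => Prod.ext ?_ ?_, fun s => h (biprod.total (X := E) (Y := E')) s⟩
  · refine (map_add (happ (biprod.fst : E ⊞ E' ⟶ E) V) _ _).trans ?_
    refine (congrArg₂ (· + ·) (h (biprod.inl_fst (X := E) (Y := E')) s.1)
      (h (biprod.inr_fst (X := E) (Y := E')) s.2)).trans ?_
    exact add_zero _
  · refine (map_add (happ (biprod.snd : E ⊞ E' ⟶ E') V) _ _).trans ?_
    refine (congrArg₂ (· + ·) (h (biprod.inl_snd (X := E) (Y := E')) s.1)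
      (h (biprod.inr_snd (X := E) (Y := E')) s.2)).trans ?_
    exact zero_add _

theorem IsLocallyFreeOfFiniteRank.biprod (hE : IsLocallyFreeOfFiniteRank E)
    (hE' : IsLocallyFreeOfFiniteRank E') : IsLocallyFreeOfFiniteRank (E ⊞ E') :=
  isLocallyFreeOfFiniteRank_of_isBasis fun x => by
    obtain ⟨U, n, e, hx, he⟩ := hE.exists_isBasis x
    obtain ⟨U', n', e', hx', he'⟩ := hE'.exists_isBasis x
    exact ⟨U ⊓ U', n + n', _, ⟨hx, hx'⟩,
      (isBasis_of_directSum (he.res inf_le_left) (he'.res inf_le_right)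
        (biprod.inl : E ⟶ E ⊞ E') (biprod.inr : E' ⟶ E ⊞ E') fun V _ => bijective_biprod V).reindex
          finSumFinEquiv.symm⟩

theorem isLocallyFree_unitModule : IsLocallyFreeOfFiniteRank (unitModule X) :=
  isLocallyFreeOfFiniteRank_of_isBasis fun _ => ⟨⊤, 1, _, trivial, isBasis_unitModule ⊤⟩

theorem happ_biprod_desc_inl (φ : E ⟶ F) (ψ : E' ⟶ F) (s : Γ(E, U)) :
    happ (biprod.desc φ ψ) U (happ (biprod.inl : E ⟶ E ⊞ E') U s) = happ φ U s :=
  congrArg (fun f => happ f U s) (biprod.inl_desc φ ψ)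

theorem happ_biprod_desc_inr (φ : E ⟶ F) (ψ : E' ⟶ F) (s : Γ(E', U)) :
    happ (biprod.desc φ ψ) U (happ (biprod.inr : E' ⟶ E ⊞ E') U s) = happ ψ U s :=
  congrArg (fun f => happ f U s) (biprod.inr_desc φ ψ)

theorem imSub_le_desc_left (φ : E ⟶ F) (ψ : E' ⟶ F) {s : Γ(F, U)} (hs : s ∈ (imSub φ).obj U) :
    s ∈ (imSub (biprod.desc φ ψ)).obj U := fun x hx => by
  obtain ⟨V, hV, hxV, t, ht⟩ := hs x hx
  exact ⟨V, hV, hxV, _, (happ_biprod_desc_inl φ ψ t).trans ht⟩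

theorem imSub_le_desc_right (φ : E ⟶ F) (ψ : E' ⟶ F) {s : Γ(F, U)} (hs : s ∈ (imSub ψ).obj U) :
    s ∈ (imSub (biprod.desc φ ψ)).obj U := fun x hx => by
  obtain ⟨V, hV, hxV, t, ht⟩ := hs x hx
  exact ⟨V, hV, hxV, _, (happ_biprod_desc_inr φ ψ t).trans ht⟩

theorem exists_hom_of_family (h : ∀ τ : Γ(F, U), ∃ (E : X.Modules) (φ : E ⟶ F),
      IsLocallyFreeOfFiniteRank E ∧ τ ∈ (imSub φ).obj U) (n : ℕ) (τ : Fin n → Γ(F, U)) :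
    ∃ (E : X.Modules) (φ : E ⟶ F), IsLocallyFreeOfFiniteRank E ∧ ∀ i, τ i ∈ (imSub φ).obj U := by
  induction n with
  | zero => exact ⟨unitModule X, 0, isLocallyFree_unitModule, fun i => i.elim0⟩
  | succ n ih =>
    obtain ⟨E, φ, hE, hφ⟩ := ih (fun i => τ i.castSucc)
    obtain ⟨E', ψ, hE', hψ⟩ := h (τ (Fin.last n))
    exact ⟨E ⊞ E', biprod.desc φ ψ, hE.biprod hE', fun i =>
      Fin.lastCases (imSub_le_desc_right φ ψ hψ) (fun i => imSub_le_desc_left φ ψ (hφ i)) i⟩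

/-- Over an affine open, a quasi-coherent module locally generated by finitely many sections is
generated near each point by finitely many sections over the whole affine open. -/
theorem LocallyFinitelyGenerated.exists_generates (hF : LocallyFinitelyGenerated F)
    (hQ : QCOn F ⊤) (hU : IsAffineOpen U) (x : X) (hx : x ∈ U) :
    ∃ (V : X.Opens) (hV : V ≤ U) (n : ℕ) (τ : Fin n → Γ(F, U)), x ∈ V ∧
      Generates F V fun i => sres F hV (τ i) := by
  obtain ⟨W, n, σ, hxW, hσ⟩ := hF x
  obtain ⟨r, hrW, hxr⟩ := exists_basicOpen hU hx hxW
  -- Powers of r times the local generators extend to U; r is a unit on D(r), so they still generate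
  -- there.
  choose k τ hτ using fun i => hQ.ext U le_top hU r (sres F hrW (σ i))
  obtain ⟨c, hc⟩ := isUnit_rres_of_le_basicOpen (X.basicOpen_le r) (le_refl (X.basicOpen r))
  refine ⟨X.basicOpen r, X.basicOpen_le r, n, τ, hxr, fun V hV t y hy => ?_⟩
  obtain ⟨V', hV', hyV', a, ha⟩ := hσ V (hV.trans hrW) t y hy
  refine ⟨V', hV', hyV', fun i => a i * rres (hV'.trans hV) (↑(c⁻¹ ^ k i) : Γ(X, X.basicOpen r)),
    ?_⟩
  rw [← ha]
  refine Finset.sum_congr rfl fun i _ => ?_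
  beta_reduce
  have h1 := congrArg (sres F (hV'.trans hV)) (hτ i)
  rw [sres_sres, sres_smul, sres_sres] at h1
  rw [sres_sres, h1, mul_smul, smul_smul (rres _ _), ← map_mul, ← hc, Units.val_pow_eq_pow_val,
    ← mul_pow, Units.inv_mul, one_pow, map_one, one_smul]

theorem mem_imSub_of_generates {n : ℕ} {σ : Fin n → Γ(F, U)} (hσ : Generates F U σ) (φ : E ⟶ F)
    (h : ∀ i, σ i ∈ (imSub φ).obj U) (hV : V ≤ U) (t : Γ(F, V)) : t ∈ (imSub φ).obj V := by
  refine (imSub φ).loc fun x hx => ?_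
  obtain ⟨W, hW, hxW, a, ha⟩ := hσ V hV t x hx
  refine ⟨W, hW, hxW, ?_⟩
  rw [← ha]
  exact Submodule.sum_mem _ fun i _ => Submodule.smul_mem _ _ ((imSub φ).res _ (h i))

/-- `X` is covered by affine opens over which sections of modules extend, up to a twist by a line
bundle. -/
def HasAmpleCover (X : Scheme.{u}) : Prop :=
  ∀ x : X, ∃ (M : X.Modules) (s : Γ(M, ⊤)) (D : X.Opens), IsEquation M s D ∧ IsAffineOpen D ∧ x ∈ D

theorem IsAmple.hasAmpleCover {L : X.Modules} (hL : IsAmple L) : HasAmpleCover X := fun x => by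
  obtain ⟨n, -, s, hx, hs⟩ := hL.2 x
  exact ⟨_, s, _, hL.1.isEquation_nonvanishingLocus n s, hs, hx⟩

theorem HasAmpleCover.exists_epi [NoetherianSpace X] (hX : HasAmpleCover X) (hQ : QCOn F ⊤)
    (hF : LocallyFinitelyGenerated F) :
    ∃ (E : X.Modules) (φ : E ⟶ F), IsLocallyFreeOfFiniteRank E ∧ Epi φ := by
  have hc : IsCompact (Set.univ : Set X) := NoetherianSpace.isCompact _
  suffices H : ∃ (E : X.Modules) (φ : E ⟶ F) (U : X.Opens), IsLocallyFreeOfFiniteRank E ∧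
      Set.univ ⊆ (U : Set X) ∧ ∀ V ≤ U, ∀ t : Γ(F, V), t ∈ (imSub φ).obj V by
    obtain ⟨E, φ, U, hE, hU, h⟩ := H
    exact ⟨E, φ, hE, epi_of_locSurj fun V t => h V (fun x _ => hU (Set.mem_univ x)) t⟩
  refine hc.induction_on (p := fun S => ∃ (E : X.Modules) (φ : E ⟶ F) (U : X.Opens),
    IsLocallyFreeOfFiniteRank E ∧ S ⊆ (U : Set X) ∧
      ∀ V ≤ U, ∀ t : Γ(F, V), t ∈ (imSub φ).obj V) ?_ ?_ ?_ ?_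
  · exact ⟨unitModule X, 0, ⊥, isLocallyFree_unitModule, Set.empty_subset _,
      fun V hV t x hx => (hV hx).elim⟩
  · rintro S T hST ⟨E, φ, U, hE, hU, h⟩
    exact ⟨E, φ, U, hE, hST.trans hU, h⟩
  · rintro S T ⟨E, φ, U, hE, hU, h⟩ ⟨E', ψ, U', hE', hU', h'⟩
    refine ⟨E ⊞ E', biprod.desc φ ψ, U ⊔ U', hE.biprod hE',
      Set.union_subset (hU.trans (le_sup_left : U ≤ U ⊔ U'))
        (hU'.trans (le_sup_right : U' ≤ U ⊔ U')), fun V hV t => SubSheaf.loc _ fun x hx => ?_⟩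
    rcases hV hx with hxU | hxU
    · exact ⟨V ⊓ U, inf_le_left, ⟨hx, hxU⟩, imSub_le_desc_left φ ψ (h _ inf_le_right _)⟩
    · exact ⟨V ⊓ U', inf_le_left, ⟨hx, hxU⟩, imSub_le_desc_right φ ψ (h' _ inf_le_right _)⟩
  · intro x _
    obtain ⟨M, s, D, hM, hD, hx⟩ := hX x
    obtain ⟨V, hV, n, τ, hxV, hτ⟩ := hF.exists_generates hQ hD x hx
    obtain ⟨E, φ, hE, hφ⟩ := exists_hom_of_family (fun τ => hM.exists_hom hQ τ) n τ
    exact ⟨V, mem_nhdsWithin_of_mem_nhds (V.isOpen.mem_nhds hxV), E, φ, V, hE, subset_rfl,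
      fun W hW t => mem_imSub_of_generates hτ φ (fun i => (imSub φ).res hV (hφ i)) hW t⟩

/-- Over a small affine W the sections of F embed in a finite free module over a Noetherian ring, so
they are finitely generated. Quasi-coherence carries the generators to smaller opens. -/
theorem LocallyFinitelyGenerated.of_mono [IsLocallyNoetherian X] (hE : IsLocallyFreeOfFiniteRank E)
    (hF : QCOn F ⊤) (i : F ⟶ E) (hi : ∀ U, Function.Injective (happ i U)) :
    LocallyFinitelyGenerated F := by
  intro x
  obtain ⟨U, n, e, hx, he⟩ := hE.exists_isBasis x
  obtain ⟨W, hW, hxW, hWU⟩ := exists_isAffineOpen_mem_and_subset hx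
  have hN : IsNoetherianRing Γ(X, W) := IsLocallyNoetherian.component_noetherian ⟨W, hW⟩
  have hM : IsNoetherian Γ(X, W) Γ(F, W) :=
    isNoetherian_of_injective ((he.coord hWU).toLinearMap.comp (happ i W))
      ((he.coord hWU).injective.comp (hi W))
  obtain ⟨k, σ, hσ⟩ := Module.Finite.exists_fin (R := Γ(X, W)) (M := Γ(F, W))
  refine ⟨W, k, σ, hxW, fun V hV t y hy => ?_⟩
  obtain ⟨r, hrV, hyr⟩ := exists_basicOpen hW (hV hy) hy
  obtain ⟨m, s, hs⟩ := hF.ext W le_top hW r (sres F hrV t)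
  obtain ⟨c, hc⟩ := isUnit_rres_of_le_basicOpen (X.basicOpen_le r) (le_refl (X.basicOpen r))
  obtain ⟨a, rfl⟩ := (Submodule.mem_span_range_iff_exists_fun Γ(X, W)).1
    (hσ.ge (Submodule.mem_top (x := s)))
  refine ⟨X.basicOpen r, hrV, hyr,
    fun j => (↑(c⁻¹ ^ m) : Γ(X, X.basicOpen r)) * rres (X.basicOpen_le r) (a j), ?_⟩
  simp only [map_sum, sres_smul] at hs
  simp only [mul_smul, ← Finset.smul_sum]
  rw [hs, ← hc, smul_smul, Units.val_pow_eq_pow_val, ← mul_pow, Units.inv_mul, one_pow, one_smul]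

theorem exactPair_kernel {A : Type v} [Category.{w} A] [Abelian A] {Y Z Z' T : A} {f : Y ⟶ Z}
    (π : T ⟶ kernel f) (i : Z ⟶ Z') [Epi π] [Mono i] : ExactPair (π ≫ kernel.ι f) (f ≫ i) := by
  refine exactPair_of_lift (by simp) fun S y hy => ?_
  rw [← Category.assoc] at hy
  have hy' : y ≫ f = 0 := zero_of_comp_mono i hy
  obtain ⟨S', ρ, hρ, z, hz⟩ := surjective_up_to_refinements_of_epi π (kernel.lift f y hy')
  refine ⟨S', ρ, hρ, z, ?_⟩
  rw [← Category.assoc, ← hz, Category.assoc, kernel.lift_ι]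

theorem HasAmpleCover.exists_resolution [NoetherianSpace X] [IsLocallyNoetherian X]
    (hX : HasAmpleCover X) (hQ : QCOn F ⊤) (hF : LocallyFinitelyGenerated F) :
    Nonempty (LocallyFreeResolution F) := by
  -- The class of modules covered by locally free sheaves; it is stable under passing to the kernels
  -- of the chosen epimorphisms, so the resolution is built by recursion.
  let P : X.Modules → Prop := fun F => QCOn F ⊤ ∧ LocallyFinitelyGenerated F
  choose E φ hE hφ using fun F : {F // P F} => hX.exists_epi F.2.1 F.2.2
  have hK : ∀ F : {F // P F}, P (kernel (φ F)) := fun F => by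
    have h := (hE F).qcOn.kernel F.2.1 (φ F)
    exact ⟨h, .of_mono (hE F) h (kernel.ι (φ F)) (injective_of_mono _)⟩
  let K : ℕ → {F // P F} := Nat.rec ⟨F, hQ, hF⟩ fun _ F => ⟨kernel (φ F), hK F⟩
  let d : ∀ n, E (K (n + 1)) ⟶ E (K n) := fun n => φ (K (n + 1)) ≫ kernel.ι (φ (K n))
  have hd : ∀ n, ExactPair (A := X.Modules) (d (n + 1)) (d n) := fun n =>
    exactPair_kernel (f := φ (K (n + 1))) (φ (K (n + 2))) (kernel.ι (φ (K n)))
  have h0 : ExactPair (A := X.Modules) (d 0) (φ (K 0)) := by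
    have := exactPair_kernel (f := φ (K 0)) (φ (K 1)) (𝟙 _)
    rwa [Category.comp_id] at this
  let C : ChainComplex X.Modules ℕ := ChainComplex.of (fun n => E (K n)) d fun n => (hd n).1
  have hC : ∀ n, C.d (n + 1) n = d n := fun n => ChainComplex.of_d (fun n => E (K n)) d n
  refine ⟨{ complex := C, isLocallyFree := fun n => hE (K n), aug := φ (K 0)
            d_comp_aug := by rw [hC]; exact h0.1, exact := fun i => ?_ }⟩
  match i with
  | 0 => exact exactAt_zero_of_epi (hφ (K 0))
  | 1 =>
    refine exactAt_of_exactPair ?_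
    have : ExactPair (A := X.Modules) (C.d 1 0) (φ (K 0)) := by
      rw [hC]
      exact h0
    exact this
  | n + 2 =>
    refine exactAt_of_exactPair ?_
    have : ExactPair (A := X.Modules) (C.d (n + 2) (n + 1)) (C.d (n + 1) n) := by
      rw [hC, hC]
      exact hd n
    exact this

end Resolution

end SheafExt

/-! ### The main theorem -/

theorem mainTheorem8 (X : Scheme.{0}) (π : X ⟶ Spec (CommRingCat.of ℂ)) [IsSeparated π]
    [LocallyOfFiniteType π] [QuasiCompact π] (L : X.Modules) (hL : SheafExt.IsAmple L) :
    -- every coherent sheaf has a resolution by locally free sheaves of finite rank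
    (∀ F : X.Modules, SheafExt.IsCoherent F → Nonempty (SheafExt.LocallyFreeResolution F)) ∧
    -- for every open cover `U` of `X` that refines a suitable open cover `V` of `X`
    ∃ (κ : Type) (V : κ → X.Opens), (⨆ k, V k) = ⊤ ∧
      ∀ (ι : Type) (U : ι → X.Opens), (⨆ i, U i) = ⊤ → (∀ i, ∃ k, U i ≤ V k) →
      ∀ (F G : X.Modules), SheafExt.IsCoherent F → SheafExt.IsCoherent G →
      ∀ (E : SheafExt.LocallyFreeResolution F) (p : ℕ), 0 < p → ∀ i : ι,
      -- each global section of the Ext sheaf determines a cohomology class over `U i`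
      ∃ Φ : SheafExt.extSections F G p ⊤ →+
          SheafExt.HomCohomology (E.complexOn (U i)) (G.restrict (U i).ι) p,
      ∀ f : SheafExt.extSections F G p ⊤,
        -- the pushout along any cocycle in that class gives an extension representing `f`
        (∀ c : SheafExt.homCocycles (E.complexOn (U i)) (G.restrict (U i).ι) p,
          SheafExt.homClass c = Φ f →
          (∃ S : SheafExt.LengthExtension p (G.restrict (U i).ι) (F.restrict (U i).ι),
            SheafExt.IsPushoutExtension (E.complexOn (U i)) (E.augOn (U i))
              (E.d_comp_augOn (U i)) c S) ∧
          ∀ S : SheafExt.LengthExtension p (G.restrict (U i).ι) (F.restrict (U i).ι),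
            SheafExt.IsPushoutExtension (E.complexOn (U i)) (E.augOn (U i))
              (E.d_comp_augOn (U i)) c S →
            SheafExt.Represents S (SheafExt.extSectionsRestrict f (U i))) ∧
        -- and the extension does not depend on the cocycle
        ∀ (c c' : SheafExt.homCocycles (E.complexOn (U i)) (G.restrict (U i).ι) p)
          (S S' : SheafExt.LengthExtension p (G.restrict (U i).ι) (F.restrict (U i).ι)),
          SheafExt.homClass c = Φ f → SheafExt.homClass c' = Φ f →
          SheafExt.IsPushoutExtension (E.complexOn (U i)) (E.augOn (U i))
            (E.d_comp_augOn (U i)) c S →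
          SheafExt.IsPushoutExtension (E.complexOn (U i)) (E.augOn (U i))
            (E.d_comp_augOn (U i)) c' S' →
          S.Isomorphic S' := by
  have : IsLocallyNoetherian X := LocallyOfFiniteType.isLocallyNoetherian π
  have : CompactSpace X := QuasiCompact.compactSpace_of_compactSpace π
  have : IsNoetherian X := {}
  -- The cover by all affine opens works simultaneously for all F, G, E and p.
  refine ⟨fun F hF => hL.hasAmpleCover.exists_resolution hF.qcOn hF.1.locallyFinitelyGenerated,
    X.affineOpens,
    fun V => V.1, eq_top_iff.2 fun x _ => ?_, fun ι U _ hUV F G _ hG E p hp i => ?_⟩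
  · obtain ⟨V, hV, hx, -⟩ := exists_isAffineOpen_mem_and_subset (Opens.mem_top x)
    exact Opens.mem_iSup.2 ⟨⟨V, hV⟩, hx⟩
  · obtain ⟨q, rfl⟩ := Nat.exists_eq_add_of_le' hp
    obtain ⟨V, hV⟩ := hUV i
    exact SheafExt.exists_representing_hom E hV V.2 (hG.qcOn.mono le_top) q
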